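/- Let $H\in(1/4,1)$, $d\ge 0$, and $\theta_i>0$, $\sigma_i>0$, $\mu_i\in\mathbb R$ for $1\le i\le d$. Let $X=(X^1,\dots,X^d)$, indexed by $[0,\infty)$, be the stationary fractional Ornstein--Uhlenbeck process with independent coordinates: $X$ is a continuous, strictly stationary process whose coordinates are independent and satisfy $$dX^i_t=-\theta_i(X^i_t-\mu_i)\,dt+\sigma_i\,dB^{H,i}_t,$$ where $B^{H,1},\dots,B^{H,d}$ are independent fractional Brownian motions with Hurst parameter $H$. Let $\tilde X_t=X_t-X_0$ be the centered increment process, let $R^i(\tau)=\operatorname{Cov}(X^i_0,X^i_\tau)$, and let $\Delta>0$. The level-2 signature $S^{(2)}=(S^{(2)}_{ij})_{i,j\le d}$ of $\tilde X$ over $[0,\Delta]$ is the $L^2$-limit of the iterated integrals $\int_{0<u_1<u_2<\Delta}d\tilde X^{i,D}_{u_1}\,d\tilde X^{j,D}_{u_2}$ of the piecewise-linear interpolations $\tilde X^D$ of $\tilde X$, along every sequence of dissections $D$ of $[0,\Delta]$ with mesh tending to zero. For $p>\max(2,1/H)$, a canonical geometric $p$-rough path lift of $\tilde X$ over $[0,\Delta]$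 is a limit in probability, in rough path $p$-variation (levels $1,\dots,\lfloor p\rfloor$), of the lifts of the $\tilde X^D$ along every such sequence. Put $$f_i(\lambda)=\frac{\lambda^{1-2H}}{\theta_i^2+\lambda^2}\quad(\lambda>0),\qquad \zeta_i=\frac{\sigma_i^2\,\Gamma(2H+1)}{2\theta_i^{2H}\cdot 2\int_0^\infty f_i(\lambda)\,d\lambda}.$$ Then: 1. The level-2 signature $S^{(2)}$ exists and is unique up to null sets; its entries are integrable, and $$\mathbb E\bigl[S^{(2)}_{ij}\bigr]=\begin{cases}v_i:=R^i(0)-R^i(\Delta)&\text{if } i=j,\\ 0&\text{if } i\ne j.\end{cases}$$ 2. For every $p>\max(2,1/H)$, the level-2 component over $[0,\Delta]$ of every canonical geometric $p$-rough path lift of $\tilde X$ over $[0,\Delta]$ is this $S^{(2)}$; in particular it is integrable with the same expectation. 3. All $X^i_t$ are square integrable, $f_i$ and $\lambda\mapsto(1-\cos(\lambda\Delta))f_i(\lambda)$ are integrable on $(0,\infty)$, and $$v_i=R^i(0)-R^i(\Delta)=2\zeta_i\int_0^\infty(1-\cos(\lambda\Delta))\,f_i(\lambda)\,d\lambda .$$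 -/

import Mathlib

open MeasureTheory ProbabilityTheory Filter Topology
open scoped NNReal ENNReal

noncomputable section

/-! ### Fractional Brownian motion and the stationary fractional Ornstein-Uhlenbeck process -/

/-- A real fractional Brownian motion with Hurst index `H`, indexed by `[0, ∞)`: a centered Gaussian
process with covariance `(s^{2H} + t^{2H} - |s - t|^{2H}) / 2` and almost surely continuous paths. -/
structure IsFBM {Ω : Type*} [MeasurableSpace Ω] (P : Measure Ω) (H : ℝ)
    (B : ℝ≥0 → Ω → ℝ) : Prop where
  measurable : ∀ t, Measurable (B t)
  gaussian : IsGaussianProcess B P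
  mean_zero : ∀ t, ∫ ω, B t ω ∂P = 0
  covariance : ∀ s t, cov[B s, B t; P] =
    ((s : ℝ) ^ (2 * H) + (t : ℝ) ^ (2 * H) - |(s : ℝ) - (t : ℝ)| ^ (2 * H)) / 2
  continuous : ∀ᵐ ω ∂P, Continuous fun t => B t ω

/-- Strict stationarity of an `ℝ^d`-valued process `X = (X^1, …, X^d)` indexed by `[0, ∞)`:
the joint law of any finite family of time marginals is invariant under time shifts. -/
def IsStrictlyStationary {Ω : Type*} [MeasurableSpace Ω] (P : Measure Ω) {d : ℕ}
    (X : Fin d → ℝ≥0 → Ω → ℝ) : Prop :=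
  ∀ (τ : ℝ≥0) (n : ℕ) (t : Fin n → ℝ≥0),
    IdentDistrib (fun ω (k : Fin n) (i : Fin d) => X i (τ + t k) ω)
      (fun ω (k : Fin n) (i : Fin d) => X i (t k) ω) P P

/-- `X` is the stationary `d`-dimensional fractional Ornstein-Uhlenbeck process with independent
coordinates, driven by the independent fractional Brownian motions `B^1, …, B^d`: a continuous,
strictly stationary solution of `dX^i = -θ_i (X^i - μ_i) dt + σ_i dB^i`. -/
structure IsStationaryFOU {Ω : Type*} [MeasurableSpace Ω] (P : Measure Ω) (H : ℝ) {d : ℕ}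
    (θ μ σ : Fin d → ℝ) (B X : Fin d → ℝ≥0 → Ω → ℝ) : Prop where
  fbm : ∀ i, IsFBM P H (B i)
  indep_noise : iIndepFun (fun i ω (t : ℝ≥0) => B i t ω) P
  measurable : ∀ i t, Measurable (X i t)
  continuous : ∀ i, ∀ᵐ ω ∂P, Continuous fun t => X i t ω
  equation : ∀ i, ∀ᵐ ω ∂P, ∀ t : ℝ≥0,
    X i t ω = X i 0 ω - θ i * (∫ s in (0 : ℝ)..t, (X i s.toNNReal ω - μ i)) + σ i * B i t ω
  stationary : IsStrictlyStationary P X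
  indep_coord : iIndepFun (fun i ω (t : ℝ≥0) => X i t ω) P

/-- The autocovariance `R^i(τ) = Cov(X^i_0, X^i_τ)` of a coordinate of a stationary process. -/
def autocov {Ω : Type*} [MeasurableSpace Ω] (P : Measure Ω) {d : ℕ}
    (X : Fin d → ℝ≥0 → Ω → ℝ) (i : Fin d) (τ : ℝ≥0) : ℝ :=
  cov[X i 0, X i τ; P]

/-- The sample path of the centered increment process `X̃_t = X_t - X_0`. -/
def incrPath {Ω : Type*} {d : ℕ} (X : Fin d → ℝ≥0 → Ω → ℝ) (ω : Ω) : Fin d → ℝ → ℝ :=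
  fun i u => X i u.toNNReal ω - X i 0 ω

/-- The unnormalized spectral density `f(l) = l^{1-2H} / (θ² + l²)`, `l > 0`. -/
def fouSpectral (H θ l : ℝ) : ℝ := l ^ (1 - 2 * H) / (θ ^ 2 + l ^ 2)

/-- The normalization `ζ = σ² Γ(2H+1) / (2 θ^{2H} · 2 ∫_0^∞ f(l) dl)`. -/
def fouZeta (H θ σ : ℝ) : ℝ :=
  σ ^ 2 * Real.Gamma (2 * H + 1) /
    (2 * θ ^ (2 * H) * (2 * ∫ l in Set.Ioi (0 : ℝ), fouSpectral H θ l))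

/-! ### Iterated integrals of piecewise-linear interpolations -/

/-- A dissection `0 = t_0 < t_1 < ⋯ < t_n = T` of `[0, T]`. -/
structure Dissection (T : ℝ) where
  /-- number of cells -/
  n : ℕ
  /-- the nodes -/
  pt : Fin (n + 1) → ℝ
  strictMono : StrictMono pt
  first : pt 0 = 0
  last : pt (Fin.last n) = T

/-- The mesh `max_k (t_{k+1} - t_k)` of a dissection. -/
def Dissection.mesh {T : ℝ} (D : Dissection T) : ℝ :=
  ⨆ k : Fin D.n, (D.pt k.succ - D.pt k.castSucc)

/-- The piecewise-linear interpolation of a real path at the nodes of `D`: on `[t_k, t_{k+1}]` it is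
`x(t_k) + (x(t_{k+1}) - x(t_k)) (u - t_k) / (t_{k+1} - t_k)`. -/
def plInterp {T : ℝ} (D : Dissection T) (x : ℝ → ℝ) (u : ℝ) : ℝ :=
  x 0 + ∑ k : Fin D.n, (x (D.pt k.succ) - x (D.pt k.castSucc)) *
    max 0 (min 1 ((u - D.pt k.castSucc) / (D.pt k.succ - D.pt k.castSucc)))

/-- The signature coordinate `∫_{s < u_1 < ⋯ < u_m < t} dx^{i_1}_{u_1} ⋯ dx^{i_m}_{u_m}` of a
piecewise-linear (or piecewise smooth) path `x`, for the word `i_1 … i_m`: integrate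
`dx^{i_1}_{u_1}` over `[s, t]` against the coordinate of `i_2 … i_m` over `[u_1, t]`. -/
def iterInt {d : ℕ} (x : Fin d → ℝ → ℝ) : List (Fin d) → ℝ → ℝ → ℝ
  | [], _, _ => 1
  | i :: w, s, t => ∫ u in s..t, deriv (x i) u * iterInt x w u t

/-- The signature coordinate, over `[s, t]` and along the word `w`, of the piecewise-linear
interpolation at the nodes of `D` of the path `x`. -/
def plSig {d : ℕ} {T : ℝ} (D : Dissection T) (x : Fin d → ℝ → ℝ) (s t : ℝ) (w : List (Fin d)) : ℝ :=
  iterInt (fun i => plInterp D (x i)) w s t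

/-! ### The level-2 signature and the canonical rough path lift -/

/-- `S` is the level-2 signature over `[0, T]` of the increments of `X`: the `L²` limit of the
level-2 iterated integrals of the piecewise-linear interpolations, along every sequence of
dissections of `[0, T]` whose mesh tends to zero. -/
def IsLevelTwoSignature {Ω : Type*} [MeasurableSpace Ω] (P : Measure Ω) {d : ℕ}
    (X : Fin d → ℝ≥0 → Ω → ℝ) (T : ℝ) (S : Fin d → Fin d → Ω → ℝ) : Prop :=
  ∀ i j, MemLp (S i j) 2 P ∧
    ∀ D : ℕ → Dissection T, Tendsto (fun n => (D n).mesh) atTop (𝓝 0) →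
      Tendsto (fun n => eLpNorm (fun ω => plSig (D n) (incrPath X ω) 0 T [i, j] - S i j ω) 2 P)
        atTop (𝓝 0)

/-- The (inhomogeneous) rough path `p`-variation distance on `[0, T]` of two two-parameter
functionals with values in the truncated tensor algebra of degree `⌊p⌋`, given by their
coordinates along words: level `k` is measured in `p/k`-variation. -/
def pVarDist {d : ℕ} (p T : ℝ) (A B : ℝ → ℝ → List (Fin d) → ℝ) : ℝ≥0∞ :=
  ⨆ (w : List (Fin d)) (_ : 1 ≤ w.length ∧ w.length ≤ ⌊p⌋₊) (D : Dissection T),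
    (∑ k : Fin D.n, ENNReal.ofReal
      |A (D.pt k.castSucc) (D.pt k.succ) w - B (D.pt k.castSucc) (D.pt k.succ) w|
        ^ (p / w.length)) ^ ((w.length : ℝ) / p)

/-- `L` is the canonical geometric `p`-rough path lift over `[0, T]` of the increments of the
Gaussian process `X`: the limit in probability, in rough path `p`-variation, of the canonical lifts
of the piecewise-linear interpolations, along every sequence of dissections with mesh tending to
zero. (Being such a limit, `L` is almost surely a geometric `p`-rough path above the increments of
`X`.) -/
def IsCanonicalLift {Ω : Type*} [MeasurableSpace Ω] (P : Measure Ω) {d : ℕ}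
    (X : Fin d → ℝ≥0 → Ω → ℝ) (p T : ℝ) (L : Ω → ℝ → ℝ → List (Fin d) → ℝ) : Prop :=
  (∀ s t w, Measurable fun ω => L ω s t w) ∧
  ∀ D : ℕ → Dissection T, Tendsto (fun n => (D n).mesh) atTop (𝓝 0) →
    ∀ ε : ℝ≥0∞, 0 < ε → Tendsto
      (fun n => P {ω | ε ≤ pVarDist p T (plSig (D n) (incrPath X ω)) (L ω)}) atTop (𝓝 0)

end

/-! The level-2 iterated integral of a piecewise-linear path is the trapezoidal sum `∑ (x_{k+1} -
x_k) (y_T - (y_k + y_{k+1}) / 2)` (`plSig_two`). On the diagonal it equals `(x_T - x_0)² / 2` for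
every dissection (`trapezoid_self`), so everything reduces to the off-diagonal entries. For each
dissection the expectation already has the claimed value: half a mean square increment on the
diagonal, and zero off it, because the coordinates are independent and their increments are centered
(`integral_plSig`). It remains to prove `L²` convergence.

By a common refinement it is enough to compare a coarse trapezoidal sum with a fine one. The
difference is half the sum of the discrete areas of the coarse cells (`trapezoid_sub_eq`).
Independence turns its second moment into a double sum of products of inner products in `L²(P)`. If
the increments of both coordinates have covariances dominated by those of a fractional Brownian
motion of index `α / 2`, with `1 / 2 < α < 1`, this sum is `O(mesh ^ (2α - 1))`
(`RoughGrid.sum_cells_le`). The area of one cell is handled by polarization and by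
`rpow_gap_mul_rectIncr_le`, which trades second differences of `t ^ α` for telescoping ones of `t ^
(2α)`; two different cells interact through the square of a rectangular increment. The choice `α =
min (2H) (3/4)` is possible because `H > 1/4`.

Neither Gaussianity nor integrability of `X` is assumed. Moments come from stationarity: the initial
value is damped exponentially while the noise stays bounded in `L⁴` (`lintegral_pow_four_lt_top`).
Taking the second moment of the equation gives, for the autocovariance `R`, the identity `σ² t^{2H}
= 2 (R(0) - R(t)) + 2 θ² ∫∫ R` (`acov_equation`), whatever the dependence between `X_0` and the
noise. It yields the regularity of the variance function. It also yields the spectral formula: the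
spectral covariance solves the same equation (`spectralCov_equation`), and the difference of two
solutions is a multiple of `cosh (θ t)`, hence zero if bounded.

Finally, rough path distance dominates the level-2 coordinate over the whole interval, so a
canonical lift has the same limit in probability (`ae_eq_of_isCanonicalLift`). -/

noncomputable section

/-! ### Rectangular increments -/

/-- The increment of `(u, v) ↦ -φ (v - u)` over the rectangle `[a, b] × [c, d]`. -/
def rectIncr (φ : ℝ → ℝ) (a b c d : ℝ) : ℝ := φ (c - a) + φ (d - b) - φ (c - b) - φ (d - a)

lemma sum_Ico_telescope (f : ℕ → ℝ) {a b : ℕ} (h : a ≤ b) :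
    ∑ i ∈ Finset.Ico a b, (f (i + 1) - f i) = f b - f a := by
  induction b, h using Nat.le_induction with
  | base => simp
  | succ n hn ih => rw [Finset.sum_Ico_succ_top hn, ih]; ring

lemma sum_rectIncr_right (φ : ℝ → ℝ) (s : ℕ → ℝ) (a b : ℝ) {l m : ℕ} (h : l ≤ m) :
    ∑ q ∈ Finset.Ico l m, rectIncr φ a b (s q) (s (q + 1)) = rectIncr φ a b (s l) (s m) := by
  have := sum_Ico_telescope (fun q => φ (s q - b) - φ (s q - a)) h
  unfold rectIncr
  rw [← sub_eq_zero] at this ⊢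
  rw [← this]
  have e : ∀ x ∈ Finset.Ico l m, φ (s x - a) + φ (s (x + 1) - b) - φ (s x - b) - φ (s (x + 1) - a) =
    φ (s (x + 1) - b) - φ (s (x + 1) - a) - (φ (s x - b) - φ (s x - a)) := fun x _ => by ring
  rw [Finset.sum_congr rfl e]
  ring

lemma sum_rectIncr_left (φ : ℝ → ℝ) (s : ℕ → ℝ) (c d : ℝ) {l m : ℕ} (h : l ≤ m) :
    ∑ q ∈ Finset.Ico l m, rectIncr φ (s q) (s (q + 1)) c d = rectIncr φ (s l) (s m) c d := by
  have := sum_Ico_telescope (fun q => φ (d - s q) - φ (c - s q)) h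
  unfold rectIncr
  rw [← sub_eq_zero] at this ⊢
  rw [← this]
  have e : ∀ x ∈ Finset.Ico l m, φ (c - s x) + φ (d - s (x + 1)) - φ (c - s (x + 1)) - φ (d - s x) =
    φ (d - s (x + 1)) - φ (c - s (x + 1)) - (φ (d - s x) - φ (c - s x)) := fun x _ => by ring
  rw [Finset.sum_congr rfl e]
  ring

/-- Second differences of a convex function are nonnegative. -/
lemma ConvexOn.second_diff_nonneg {f : ℝ → ℝ} {S : Set ℝ} (hf : ConvexOn ℝ S f) {x a b : ℝ}
    (ha : 0 ≤ a) (hb : 0 ≤ b) (hx : x ∈ S) (hy : x + a + b ∈ S) :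
    f (x + a) + f (x + b) ≤ f x + f (x + a + b) := by
  rcases (add_nonneg ha hb).eq_or_lt with h | h
  · have h1 : a = 0 := by linarith
    have h2 : b = 0 := by linarith
    subst h1 h2; simp
  · have e1 := hf.2 hx hy (div_nonneg hb h.le) (div_nonneg ha h.le)
      (by rw [← add_div, add_comm b a, div_self h.ne'])
    have e2 := hf.2 hx hy (div_nonneg ha h.le) (div_nonneg hb h.le)
      (by rw [← add_div, div_self h.ne'])
    simp only [smul_eq_mul] at e1 e2
    have h1 : b / (a + b) * x + a / (a + b) * (x + a + b) = x + a := by field_simp; ring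
    have h2 : a / (a + b) * x + b / (a + b) * (x + a + b) = x + b := by field_simp; ring
    rw [h1] at e1; rw [h2] at e2
    have h3 : a / (a + b) + b / (a + b) = 1 := by rw [← add_div, div_self h.ne']
    have h4 : b / (a + b) = 1 - a / (a + b) := by linarith
    rw [h4] at e1 e2
    linarith

/-! ### Second differences of powers -/

section
variable {α : ℝ}

/-- This is concavity of `t ^ α` on `[0, ∞)`, the smallest argument being the gap `c - b`. Up to the
factor `-2`, the quantity is the covariance of the increments of a fractional Brownian motion of
index `α / 2` over the two intervals. -/
lemma rectIncr_rpow_nonneg (h0 : 0 ≤ α) (h1 : α ≤ 1) {a b c d : ℝ} (hab : a ≤ b) (hbc : b ≤ c)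
    (hcd : c ≤ d) : 0 ≤ rectIncr (· ^ α) a b c d := by
  have := (Real.concaveOn_rpow h0 h1).neg.second_diff_nonneg (x := c - b) (a := b - a)
    (b := d - c) (by linarith) (by linarith) (by simp; linarith) (by simp; linarith)
  simp only [Pi.neg_apply] at this
  unfold rectIncr
  rw [show c - b + (b - a) = c - a by ring, show c - b + (d - c) = d - b by ring,
    show c - a + (d - c) = d - a by ring] at this
  linarith

/-- Rectangular increments are additive: the large rectangle is the small one plus four others, each
with nonnegative increment. -/
lemma rectIncr_rpow_mono (h0 : 0 ≤ α) (h1 : α ≤ 1) {a a' b' b c c' d' d : ℝ} (h₁ : a ≤ a')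
    (h₂ : a' ≤ b') (h₃ : b' ≤ b) (h₄ : b ≤ c) (h₅ : c ≤ c') (h₆ : c' ≤ d') (h₇ : d' ≤ d) :
    rectIncr (· ^ α) a' b' c' d' ≤ rectIncr (· ^ α) a b c d := by
  have e1 := rectIncr_rpow_nonneg h0 h1 h₁ (h₂.trans (h₃.trans h₄)) (h₅.trans (h₆.trans h₇))
  have e2 := rectIncr_rpow_nonneg h0 h1 h₃ h₄ (h₅.trans (h₆.trans h₇))
  have e3 := rectIncr_rpow_nonneg h0 h1 h₂ (h₃.trans h₄) h₅
  have e4 := rectIncr_rpow_nonneg h0 h1 h₂ (h₃.trans (h₄.trans (h₅.trans h₆))) h₇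
  unfold rectIncr at *
  linarith

lemma rpow_zero_exp (h0 : 0 < α) : (0 : ℝ) ^ α = 0 := Real.zero_rpow h0.ne'

/-- Extend `[c, d]` down to `b`: the increment becomes `(b - a) ^ α + (d - b) ^ α - (d - a) ^ α`,
and the last two terms have a nonpositive sum. -/
lemma rectIncr_rpow_le_left (h0 : 0 < α) {a b c d : ℝ} (hab : a ≤ b) (hbc : b ≤ c)
    (hcd : c ≤ d) (h1 : α ≤ 1) : rectIncr (· ^ α) a b c d ≤ (b - a) ^ α := by
  have := rectIncr_rpow_mono h0.le h1 (le_refl a) hab (le_refl b) (le_refl b) hbc hcd (le_refl d)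
  refine this.trans ?_
  have h : (d - b) ^ α ≤ (d - a) ^ α := by
    apply Real.rpow_le_rpow <;> linarith
  simp only [rectIncr, sub_self, rpow_zero_exp h0]
  linarith

lemma rectIncr_rpow_le_right (h0 : 0 < α) {a b c d : ℝ} (hab : a ≤ b) (hbc : b ≤ c)
    (hcd : c ≤ d) (h1 : α ≤ 1) : rectIncr (· ^ α) a b c d ≤ (d - c) ^ α := by
  have := rectIncr_rpow_mono h0.le h1 (le_refl a) hab hbc (le_refl c) (le_refl c) hcd (le_refl d)
  refine this.trans ?_
  have h : (c - a) ^ α ≤ (d - a) ^ α := by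
    apply Real.rpow_le_rpow <;> linarith
  simp only [rectIncr, sub_self, rpow_zero_exp h0]
  linarith

/-- With `u = z / y` both sides are compared with `(1 - α) log u`, using `log t ≤ t - 1` for `t = u
^ (α - 1)` and for `t = u ^ (2α - 1)`. This is the differentiated form of the next inequality. -/
lemma rpow_mul_sub_le (h0 : 1 / 2 < α) (h1 : α < 1) {y z : ℝ} (hy : 0 < y) (hyz : y ≤ z) :
    y ^ α * (y ^ (α - 1) - z ^ (α - 1)) ≤
      (1 - α) / (2 * α - 1) * (z ^ (2 * α - 1) - y ^ (2 * α - 1)) := by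
  have hz := hy.trans_le hyz
  set u := z / y with hu
  have hu1 : 1 ≤ u := by rw [hu, le_div_iff₀ hy]; linarith
  have hu0 : 0 < u := by linarith
  have hzu : z = u * y := by rw [hu]; field_simp
  have hlog : 0 ≤ Real.log u := Real.log_nonneg hu1
  have e1 : (α - 1) * Real.log u ≤ u ^ (α - 1) - 1 := by
    rw [← Real.log_rpow hu0]; exact Real.log_le_sub_one_of_pos (by positivity)
  have e2 : (2 * α - 1) * Real.log u ≤ u ^ (2 * α - 1) - 1 := by
    rw [← Real.log_rpow hu0]; exact Real.log_le_sub_one_of_pos (by positivity)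
  have hd : 0 < 2 * α - 1 := by linarith
  have key : 1 - u ^ (α - 1) ≤ (1 - α) / (2 * α - 1) * (u ^ (2 * α - 1) - 1) := by
    have : (1 - α) * Real.log u ≤ (1 - α) / (2 * α - 1) * (u ^ (2 * α - 1) - 1) := by
      have := mul_le_mul_of_nonneg_left e2 (div_nonneg (sub_nonneg.2 h1.le) hd.le)
      refine le_trans (le_of_eq ?_) this
      rw [← mul_assoc, div_mul_cancel₀ _ hd.ne']
    linarith
  rw [hzu, Real.mul_rpow hu0.le hy.le, Real.mul_rpow hu0.le hy.le]
  have hy2 : y ^ (2 * α - 1) = y ^ α * y ^ (α - 1) := by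
    rw [← Real.rpow_add hy]; congr 1; ring
  have := mul_le_mul_of_nonneg_left key (show 0 ≤ y ^ (2 * α - 1) by positivity)
  rw [hy2] at this ⊢
  nlinarith [this]

/-- The weight `x^α` turns second differences of `t^α` into second differences of `t^{2α}`. -/
lemma rpow_mul_second_diff_le (h0 : 1 / 2 < α) (h1 : α < 1) {x a b : ℝ} (hx : 0 ≤ x) (ha : 0 ≤ a)
    (hb : 0 ≤ b) :
    x ^ α * ((x + a) ^ α + (x + b) ^ α - x ^ α - (x + a + b) ^ α) ≤
      (1 - α) / (2 * (2 * α - 1)) * ((x + a + b) ^ (2 * α) + x ^ (2 * α) - (x + a) ^ (2 * α)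
        - (x + b) ^ (2 * α)) := by
  set K := (1 - α) / (2 * (2 * α - 1)) with hK
  -- `F` is the right side minus the left as a function of `a`. It vanishes at `0` and is
  -- nondecreasing: in its derivative the weight `x ^ α` is enlarged to `(x + t) ^ α`, and
  -- `rpow_mul_sub_le` applies.
  set F : ℝ → ℝ := fun a => K * ((x + a + b) ^ (2 * α) + x ^ (2 * α) - (x + a) ^ (2 * α)
        - (x + b) ^ (2 * α)) - x ^ α * ((x + a) ^ α + (x + b) ^ α - x ^ α - (x + a + b) ^ α) with hF
  have hd : ∀ t ∈ interior (Set.Ici (0 : ℝ)), HasDerivAt F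
      (K * ((2 * α) * (x + t + b) ^ (2 * α - 1) - (2 * α) * (x + t) ^ (2 * α - 1)) -
        x ^ α * (α * (x + t) ^ (α - 1) - α * (x + t + b) ^ (α - 1))) t := by
    intro t ht
    rw [interior_Ici, Set.mem_Ioi] at ht
    have d1 : HasDerivAt (fun t : ℝ => x + t) 1 t := (hasDerivAt_id t).const_add x
    have d2 : HasDerivAt (fun t : ℝ => x + t + b) 1 t := d1.add_const b
    have p1 : x + t ≠ 0 := by positivity
    have p2 : x + t + b ≠ 0 := by positivity
    have r1 := d1.rpow_const (p := 2 * α) (Or.inl p1)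
    have r2 := d2.rpow_const (p := 2 * α) (Or.inl p2)
    have r3 := d1.rpow_const (p := α) (Or.inl p1)
    have r4 := d2.rpow_const (p := α) (Or.inl p2)
    have := ((((r2.add_const (x ^ (2 * α))).sub r1).sub_const ((x + b) ^ (2 * α))).const_mul K).sub
      ((((r3.add_const ((x + b) ^ α)).sub_const (x ^ α)).sub r4).const_mul (x ^ α))
    refine this.congr_deriv ?_
    ring
  have hmono : MonotoneOn F (Set.Ici 0) := by
    refine monotoneOn_of_deriv_nonneg (convex_Ici 0) ?_ ?_ ?_
    · refine Continuous.continuousOn ?_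
      have c1 : Continuous fun t : ℝ => t ^ α := Real.continuous_rpow_const (by linarith)
      have c2 : Continuous fun t : ℝ => t ^ (2 * α) := Real.continuous_rpow_const (by linarith)
      have a1 : Continuous fun t : ℝ => x + t := by fun_prop
      have a2 : Continuous fun t : ℝ => x + t + b := by fun_prop
      have := c1.comp a1
      have := c1.comp a2
      have := c2.comp a1
      have := c2.comp a2
      simp only [Function.comp_def] at *
      fun_prop
    · intro t ht; exact (hd t ht).differentiableAt.differentiableWithinAt
    · intro t ht
      rw [(hd t ht).deriv]
      rw [interior_Ici, Set.mem_Ioi] at ht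
      have k1 := rpow_mul_sub_le h0 h1 (y := x + t) (z := x + t + b) (by linarith) (by linarith)
      have k2 : x ^ α ≤ (x + t) ^ α := Real.rpow_le_rpow hx (by linarith) (by linarith)
      have k3 : (x + t + b) ^ (α - 1) ≤ (x + t) ^ (α - 1) :=
        Real.rpow_le_rpow_of_nonpos (by linarith) (by linarith) (by linarith)
      have k4 : x ^ α * ((x + t) ^ (α - 1) - (x + t + b) ^ (α - 1)) ≤
        (1 - α) / (2 * α - 1) * ((x + t + b) ^ (2 * α - 1) - (x + t) ^ (2 * α - 1)) :=
        (mul_le_mul_of_nonneg_right k2 (by linarith)).trans k1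
      -- `K` is half the constant of `rpow_mul_sub_le`, since differentiating `t ^ (2α)` produces
      -- `2α` where `t ^ α` produces `α`.
      have hK2 : (1 - α) / (2 * α - 1) = K * 2 := by
        rw [hK]; have : 2 * α - 1 ≠ 0 := by linarith
        field_simp
      rw [hK2] at k4
      nlinarith [k4]
  have hF0 : F 0 = 0 := by simp [hF]
  have := hmono (Set.self_mem_Ici) (Set.mem_Ici.2 ha) ha
  rw [hF0, hF] at this
  simp only at this
  linarith

/-- The point of the right side is that it is additive over rectangles, so a sum of weighted
increments over many pairs of cells can be telescoped. -/
lemma rpow_gap_mul_rectIncr_le (h0 : 1 / 2 < α) (h1 : α < 1) {a b c d : ℝ} (hab : a ≤ b)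
    (hbc : b ≤ c) (hcd : c ≤ d) : (c - b) ^ α * rectIncr (· ^ α) a b c d ≤
      (1 - α) / (2 * (2 * α - 1)) * -rectIncr (· ^ (2 * α)) a b c d := by
  have := rpow_mul_second_diff_le h0 h1 (x := c - b) (a := b - a) (b := d - c) (by linarith)
    (by linarith) (by linarith)
  rw [show c - b + (b - a) = c - a by ring, show c - b + (d - c) = d - b by ring,
    show c - a + (d - c) = d - a by ring] at this
  simp only [rectIncr]
  refine le_trans (le_of_eq ?_) (this.trans (le_of_eq ?_)) <;> ring

end

lemma sum_sum_symm (g : ℕ → ℕ → ℝ) (hg : ∀ p q, g p q = g q p) {l m : ℕ} (h : l ≤ m) :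
    ∑ p ∈ Finset.Ico l m, ∑ q ∈ Finset.Ico l m, g p q =
      ∑ p ∈ Finset.Ico l m, g p p + 2 * ∑ p ∈ Finset.Ico l m, ∑ q ∈ Finset.Ico (p + 1) m, g p q := by
  induction m, h using Nat.le_induction with
  | base => simp
  | succ n hn ih =>
    have e : ∀ p ∈ Finset.Ico l n, ∑ q ∈ Finset.Ico (p + 1) (n + 1), g p q =
        ∑ q ∈ Finset.Ico (p + 1) n, g p q + g p n := fun p hp => by
      rw [Finset.sum_Ico_succ_top (Finset.mem_Ico.1 hp).2]
    simp only [Finset.sum_Ico_succ_top hn, Finset.sum_add_distrib]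
    rw [ih, Finset.sum_congr rfl e, Finset.sum_add_distrib, Finset.sum_congr rfl fun p _ => hg n p]
    simp only [Finset.Ico_self, Finset.sum_empty]
    ring

/-- Superadditivity of `t ↦ t^β`, `β ≥ 1`, along a subdivision. -/
lemma sum_rpow_le {β : ℝ} (hβ : 1 ≤ β) {s : ℕ → ℝ} (hs : Monotone s) {l m : ℕ} (h : l ≤ m) {δ : ℝ}
    (hδ : ∀ p ∈ Finset.Ico l m, s (p + 1) - s p ≤ δ) :
    ∑ p ∈ Finset.Ico l m, (s (p + 1) - s p) ^ β ≤ δ ^ (β - 1) * (s m - s l) := by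
  rw [← sum_Ico_telescope s h, Finset.mul_sum]
  refine Finset.sum_le_sum fun p hp => ?_
  have h0 : 0 ≤ s (p + 1) - s p := sub_nonneg.2 (hs p.le_succ)
  rcases h0.eq_or_lt with h1 | h1
  · rw [← h1, Real.zero_rpow (by linarith)]; simp
  · have : (s (p + 1) - s p) ^ β = (s (p + 1) - s p) ^ (β - 1) * (s (p + 1) - s p) := by
      rw [← Real.rpow_add_one h1.ne']; congr 1; ring
    rw [this]
    exact mul_le_mul_of_nonneg_right (Real.rpow_le_rpow h0 (hδ p hp) (by linarith)) h0

end

noncomputable section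

/-! ### The area estimate on a grid -/

/-- The increments of `x` along the nodes `s` have a covariance dominated by the one of a
fractional Brownian motion with Hurst index `α / 2`. -/
structure RoughGrid {E : Type*} [NormedAddCommGroup E] [InnerProductSpace ℝ E] (x : ℕ → E)
    (s : ℕ → ℝ) (α C : ℝ) : Prop where
  inner_le : ∀ ⦃p q p' q' : ℕ⦄, p ≤ q → q ≤ p' → p' ≤ q' →
    |inner ℝ (x q - x p) (x q' - x p')| ≤ C * rectIncr (· ^ α) (s p) (s q) (s p') (s q')
  -- An increment against one over a containing interval, which `inner_le` does not cover. For `l =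
  -- p` and `q = m` it bounds the variance.
  inner_total_le : ∀ ⦃l p q m : ℕ⦄, l ≤ p → p ≤ q → q ≤ m →
    |inner ℝ (x q - x p) (x m - x l)| ≤ C * ((s q - s l) ^ α - (s p - s l) ^ α +
      ((s m - s p) ^ α - (s m - s q) ^ α))

section
variable {E F : Type*} [NormedAddCommGroup E] [InnerProductSpace ℝ E]
  [NormedAddCommGroup F] [InnerProductSpace ℝ F]
  {x : ℕ → E} {y : ℕ → F} {s : ℕ → ℝ} {α C : ℝ}

/-- Increment of `y` from `p + 1` to `m` minus the one from `l` to `p`. -/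
def skewIncr (y : ℕ → F) (l m p : ℕ) : F := (y m - y (p + 1)) - (y p - y l)

lemma norm_sub_sq_le (a b : F) : ‖a - b‖ ^ 2 ≤ 2 * ‖a‖ ^ 2 + 2 * ‖b‖ ^ 2 := by
  have := parallelogram_law_with_norm ℝ a b
  nlinarith [mul_self_nonneg ‖a + b‖]

lemma RoughGrid.norm_sq_le (hx : RoughGrid x s α C) (h0 : 0 < α) {p q : ℕ} (h : p ≤ q) :
    ‖x q - x p‖ ^ 2 ≤ 2 * C * (s q - s p) ^ α := by
  have := hx.inner_total_le le_rfl h le_rfl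
  rw [real_inner_self_eq_norm_sq, sub_self, sub_self, rpow_zero_exp h0] at this
  linarith [le_abs_self (‖x q - x p‖ ^ 2)]

lemma sum_telescope {E : Type*} [AddCommGroup E] (f : ℕ → E) {a b : ℕ} (h : a ≤ b) :
    ∑ i ∈ Finset.Ico a b, (f (i + 1) - f i) = f b - f a := by
  induction b, h using Nat.le_induction with
  | base => simp
  | succ n hn ih => rw [Finset.sum_Ico_succ_top hn, ih]; abel

/-- Area of one cell. -/
lemma RoughGrid.cell_le (hx : RoughGrid x s α C) (hy : RoughGrid y s α C) (hC : 0 ≤ C)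
    (h0 : 1 / 2 < α) (h1 : α < 1) (hs : Monotone s) {l m : ℕ} (h : l ≤ m) :
    |∑ p ∈ Finset.Ico l m, ∑ q ∈ Finset.Ico l m, inner ℝ (x (p + 1) - x p) (x (q + 1) - x q) *
      inner ℝ (skewIncr y l m p) (skewIncr y l m q)| ≤
      (24 + 8 * ((1 - α) / (2 * (2 * α - 1)))) * C ^ 2 * (s m - s l) ^ (2 * α) := by
  set K := (1 - α) / (2 * (2 * α - 1)) with hKd
  have hK : 0 ≤ K := div_nonneg (by linarith) (by linarith)
  have hα : 0 < α := by linarith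
  set z := skewIncr y l m with hz
  set r : ℕ → ℕ → ℝ := fun p q => inner ℝ (x (p + 1) - x p) (x (q + 1) - x q) with hr
  set φ : ℝ → ℝ := (· ^ α) with hφ
  have hsl : 0 ≤ s m - s l := sub_nonneg.2 (hs h)
  set Φ := (s m - s l) ^ α with hΦ
  have hΦ0 : 0 ≤ Φ := Real.rpow_nonneg hsl _
  have hΦ2 : (s m - s l) ^ (2 * α) = Φ * Φ := by
    rw [two_mul, Real.rpow_add' hsl (by linarith)]
  -- norms
  have hzn : ∀ p ∈ Finset.Ico l m, ‖z p‖ ^ 2 ≤ 8 * C * Φ := by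
    intro p hp
    obtain ⟨hp1, hp2⟩ := Finset.mem_Ico.1 hp
    have e1 := hy.norm_sq_le hα (p := p + 1) (q := m) hp2
    have e2 := hy.norm_sq_le hα hp1
    have e3 : (s m - s (p + 1)) ^ α ≤ Φ := Real.rpow_le_rpow (sub_nonneg.2 (hs hp2))
      (by linarith [hs (hp1.trans p.le_succ)]) hα.le
    have e4 : (s p - s l) ^ α ≤ Φ := Real.rpow_le_rpow (sub_nonneg.2 (hs hp1))
      (by linarith [hs hp2.le]) hα.le
    have := norm_sub_sq_le (y m - y (p + 1)) (y p - y l)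
    rw [hz, skewIncr]
    nlinarith
  -- The endpoint values at `l` and `m` cancel in `z p - z q`, which leaves two increments. Each
  -- spans the gap between cells `p` and `q` plus one of these cells, and `t ^ α` is subadditive.
  have hzd : ∀ p ∈ Finset.Ico l m, ∀ q ∈ Finset.Ico (p + 1) m, ‖z p - z q‖ ^ 2 ≤
      4 * C * (2 * (s q - s (p + 1)) ^ α + (s (p + 1) - s p) ^ α + (s (q + 1) - s q) ^ α) := by
    intro p hp q hq
    obtain ⟨hq1, hq2⟩ := Finset.mem_Ico.1 hq
    have e0 : z p - z q = (y q - y p) - -(y (q + 1) - y (p + 1)) := by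
      rw [hz, skewIncr, skewIncr]; abel
    have e1 := hy.norm_sq_le hα (p := p) (q := q) (by omega)
    have e2 := hy.norm_sq_le hα (p := p + 1) (q := q + 1) (by omega)
    have g1 := sub_nonneg.2 (hs hq1)
    have g2 := sub_nonneg.2 (hs p.le_succ)
    have g3 := sub_nonneg.2 (hs q.le_succ)
    have e3 := Real.rpow_add_le_add_rpow g1 g2 hα.le h1.le
    have e4 := Real.rpow_add_le_add_rpow g1 g3 hα.le h1.le
    rw [show s q - s (p + 1) + (s p.succ - s p) = s q - s p by simp] at e3
    rw [show s q - s (p + 1) + (s q.succ - s q) = s (q + 1) - s (p + 1) by simp] at e4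
    simp only [Nat.succ_eq_add_one] at e3 e4
    have := norm_sub_sq_le (y q - y p) (-(y (q + 1) - y (p + 1)))
    rw [norm_neg] at this
    rw [e0]
    nlinarith
  -- polarization
  have hsplit : ∀ p q, r p q * inner ℝ (z p) (z q) =
      (r p q * ‖z p‖ ^ 2 + r q p * ‖z q‖ ^ 2) / 2 - r p q * ‖z p - z q‖ ^ 2 / 2 := by
    intro p q
    have h2 : r q p = r p q := real_inner_comm _ _
    rw [h2, norm_sub_sq_real]; ring
  -- As `‖z p‖` does not depend on `q`, the row sum of `r` is the increment over cell `p` against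
  -- the total increment. The bound from `inner_total_le` then telescopes in `p`.
  have hA : |∑ p ∈ Finset.Ico l m, ∑ q ∈ Finset.Ico l m, r p q * ‖z p‖ ^ 2| ≤
      16 * C ^ 2 * (Φ * Φ) := by
    have hrow : ∀ p ∈ Finset.Ico l m, |∑ q ∈ Finset.Ico l m, r p q * ‖z p‖ ^ 2| ≤
        8 * C * Φ * (C * (((s (p + 1) - s l) ^ α - (s (m) - s (p + 1)) ^ α) -
          ((s p - s l) ^ α - (s m - s p) ^ α))) := by
      intro p hp
      obtain ⟨hp1, hp2⟩ := Finset.mem_Ico.1 hp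
      rw [← Finset.sum_mul, hr]
      simp only
      rw [← inner_sum, sum_telescope x h, abs_mul, abs_of_nonneg (sq_nonneg ‖z p‖), mul_comm]
      refine mul_le_mul (hzn p hp) ?_ (abs_nonneg _) (by positivity)
      refine (hx.inner_total_le hp1 p.le_succ hp2).trans (le_of_eq ?_)
      simp only [Nat.succ_eq_add_one]; ring
    refine (Finset.abs_sum_le_sum_abs _ _).trans ((Finset.sum_le_sum hrow).trans (le_of_eq ?_))
    rw [← Finset.mul_sum, ← Finset.mul_sum,
      sum_Ico_telescope (fun p => (s p - s l) ^ α - (s m - s p) ^ α) h, sub_self, sub_self,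
      rpow_zero_exp hα]
    ring
  have hB : |∑ p ∈ Finset.Ico l m, ∑ q ∈ Finset.Ico l m, r q p * ‖z q‖ ^ 2| ≤
      16 * C ^ 2 * (Φ * Φ) := by
    rw [Finset.sum_comm]; exact hA
  -- The diagonal vanishes, leaving twice the sum over `p < q`. The gap part of `hzd` is absorbed by
  -- `rpow_gap_mul_rectIncr_le`; the two cell-length parts are summed by additivity in `q`,
  -- respectively in `p`.
  have hD : |∑ p ∈ Finset.Ico l m, ∑ q ∈ Finset.Ico l m, r p q * ‖z p - z q‖ ^ 2| ≤
      2 * (4 * C ^ 2 * ((2 * K + 2) * (Φ * Φ))) := by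
    rw [sum_sum_symm (fun p q => r p q * ‖z p - z q‖ ^ 2) (fun p q => by
      simp only [hr]; rw [norm_sub_rev, real_inner_comm]) h]
    simp only [sub_self, norm_zero, ne_eq, OfNat.ofNat_ne_zero, not_false_eq_true, zero_pow,
      mul_zero, Finset.sum_const_zero, zero_add, abs_mul, abs_two]
    refine mul_le_mul_of_nonneg_left ?_ zero_le_two
    have hterm : ∀ p ∈ Finset.Ico l m, ∀ q ∈ Finset.Ico (p + 1) m,
        |r p q * ‖z p - z q‖ ^ 2| ≤ 4 * C ^ 2 * (2 * K *
          -rectIncr (· ^ (2 * α)) (s p) (s (p + 1)) (s q) (s (q + 1)) +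
          rectIncr φ (s p) (s (p + 1)) (s q) (s (q + 1)) * (s (p + 1) - s p) ^ α +
          rectIncr φ (s p) (s (p + 1)) (s q) (s (q + 1)) * (s (q + 1) - s q) ^ α) := by
      intro p hp q hq
      obtain ⟨hq1, hq2⟩ := Finset.mem_Ico.1 hq
      have e1 := hx.inner_le p.le_succ hq1 q.le_succ
      simp only [Nat.succ_eq_add_one] at e1
      have e2 := hzd p hp q hq
      have e3 := rpow_gap_mul_rectIncr_le h0 h1 (hs p.le_succ) (hs hq1) (hs q.le_succ)
      simp only [Nat.succ_eq_add_one] at e3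
      rw [← hKd, ← hφ] at e3
      have e4 := mul_le_mul e1 e2 (sq_nonneg _) ((abs_nonneg _).trans e1)
      rw [abs_mul, abs_of_nonneg (sq_nonneg ‖z p - z q‖)]
      refine e4.trans ?_
      have e5 := mul_le_mul_of_nonneg_left e3 (show 0 ≤ 8 * C ^ 2 by positivity)
      nlinarith [e5]
    have hsum : ∑ p ∈ Finset.Ico l m, ∑ q ∈ Finset.Ico (p + 1) m, 4 * C ^ 2 * (2 * K *
          -rectIncr (· ^ (2 * α)) (s p) (s (p + 1)) (s q) (s (q + 1)) +
          rectIncr φ (s p) (s (p + 1)) (s q) (s (q + 1)) * (s (p + 1) - s p) ^ α +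
          rectIncr φ (s p) (s (p + 1)) (s q) (s (q + 1)) * (s (q + 1) - s q) ^ α) ≤
        4 * C ^ 2 * ((2 * K + 2) * (Φ * Φ)) := by
      simp only [← Finset.mul_sum, Finset.sum_add_distrib]
      refine mul_le_mul_of_nonneg_left ?_ (by positivity)
      have hpow : ∑ p ∈ Finset.Ico l m, (s (p + 1) - s p) ^ (2 * α) ≤ Φ * Φ := by
        refine (sum_rpow_le (by linarith) hs h (δ := s m - s l) fun p hp => ?_).trans ?_
        · obtain ⟨hp1, hp2⟩ := Finset.mem_Ico.1 hp
          linarith [hs hp1, hs (show p + 1 ≤ m from hp2)]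
        · rw [← hΦ2]
          rcases hsl.eq_or_lt with h' | h'
          · rw [← h', Real.zero_rpow (by linarith : 2 * α ≠ 0)]; simp
          · rw [← Real.rpow_add_one h'.ne']; apply le_of_eq; congr 1; ring
      have hsq : ∀ p, (s (p + 1) - s p) ^ (2 * α) =
          (s (p + 1) - s p) ^ α * (s (p + 1) - s p) ^ α := fun p => by
        rw [two_mul, Real.rpow_add' (sub_nonneg.2 (hs p.le_succ)) (by linarith)]
      -- Summing over `q` leaves one rectangle adjacent to cell `p`; after dropping the power of the
      -- cell length, what remains telescopes in `p`.
      have t1 : ∑ p ∈ Finset.Ico l m, ∑ q ∈ Finset.Ico (p + 1) m,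
          -rectIncr (· ^ (2 * α)) (s p) (s (p + 1)) (s q) (s (q + 1)) ≤ Φ * Φ := by
        have : ∀ p ∈ Finset.Ico l m, ∑ q ∈ Finset.Ico (p + 1) m,
            -rectIncr (· ^ (2 * α)) (s p) (s (p + 1)) (s q) (s (q + 1)) ≤
            (-(s m - s (p + 1)) ^ (2 * α)) - (-(s m - s p) ^ (2 * α)) := by
          intro p hp
          rw [Finset.sum_neg_distrib, sum_rectIncr_right _ s _ _ (Finset.mem_Ico.1 hp).2]
          have : 0 ≤ (s (p + 1) - s p) ^ (2 * α) :=
            Real.rpow_nonneg (sub_nonneg.2 (hs p.le_succ)) _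
          simp only [rectIncr, sub_self]
          rw [Real.zero_rpow (by linarith : 2 * α ≠ 0)]
          linarith
        refine (Finset.sum_le_sum this).trans (le_of_eq ?_)
        rw [sum_Ico_telescope (fun p => -(s m - s p) ^ (2 * α)) h, ← hΦ2, sub_self,
          Real.zero_rpow (by linarith : 2 * α ≠ 0)]
        ring
      have t2 : ∑ p ∈ Finset.Ico l m, ∑ q ∈ Finset.Ico (p + 1) m,
          rectIncr φ (s p) (s (p + 1)) (s q) (s (q + 1)) * (s (p + 1) - s p) ^ α ≤ Φ * Φ := by
        refine (Finset.sum_le_sum fun p hp => ?_).trans hpow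
        rw [← Finset.sum_mul, sum_rectIncr_right _ s _ _ (Finset.mem_Ico.1 hp).2, hsq]
        refine mul_le_mul_of_nonneg_right ?_ (Real.rpow_nonneg (sub_nonneg.2 (hs p.le_succ)) _)
        exact rectIncr_rpow_le_left hα (hs p.le_succ) le_rfl (hs (Finset.mem_Ico.1 hp).2) h1.le
      have t3 : ∑ p ∈ Finset.Ico l m, ∑ q ∈ Finset.Ico (p + 1) m,
          rectIncr φ (s p) (s (p + 1)) (s q) (s (q + 1)) * (s (q + 1) - s q) ^ α ≤ Φ * Φ := by
        rw [Finset.sum_comm' (t' := Finset.Ico l m) (s' := fun q => Finset.Ico l q) (by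
          intro p q; simp only [Finset.mem_Ico]; omega)]
        refine (Finset.sum_le_sum fun q hq => ?_).trans hpow
        rw [← Finset.sum_mul, sum_rectIncr_left _ s _ _ (Finset.mem_Ico.1 hq).1, hsq]
        refine mul_le_mul_of_nonneg_right ?_ (Real.rpow_nonneg (sub_nonneg.2 (hs q.le_succ)) _)
        exact rectIncr_rpow_le_right hα (hs (Finset.mem_Ico.1 hq).1) le_rfl (hs q.le_succ) h1.le
      have := mul_le_mul_of_nonneg_left t1 (show 0 ≤ 2 * K by positivity)
      linarith
    refine (Finset.abs_sum_le_sum_abs _ _).trans (le_trans (Finset.sum_le_sum fun p hp => ?_) hsum)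
    exact (Finset.abs_sum_le_sum_abs _ _).trans (Finset.sum_le_sum (hterm p hp))
  have hfin : ∑ p ∈ Finset.Ico l m, ∑ q ∈ Finset.Ico l m, r p q * inner ℝ (z p) (z q) =
      (∑ p ∈ Finset.Ico l m, ∑ q ∈ Finset.Ico l m, r p q * ‖z p‖ ^ 2 +
      ∑ p ∈ Finset.Ico l m, ∑ q ∈ Finset.Ico l m, r q p * ‖z q‖ ^ 2) / 2 -
      (∑ p ∈ Finset.Ico l m, ∑ q ∈ Finset.Ico l m, r p q * ‖z p - z q‖ ^ 2) / 2 := by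
    simp only [hsplit, Finset.sum_sub_distrib, ← Finset.sum_div, Finset.sum_add_distrib]
  -- The constants add up as `(16 + 16) / 2 + 8 (2K + 2) / 2 = 24 + 8K`.
  rw [hfin, hΦ2]
  rw [abs_le] at hA hB hD ⊢
  constructor <;> nlinarith [hA.1, hA.2, hB.1, hB.2, hD.1, hD.2]

/-- Interaction of the areas of two cells. -/
lemma RoughGrid.two_cells_le (hx : RoughGrid x s α C) (hy : RoughGrid y s α C) (hC : 0 ≤ C)
    (h0 : 0 < α) (h1 : α ≤ 1) (hs : Monotone s) {l m l' m' : ℕ} (h : l ≤ m) (hm : m ≤ l')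
    (h' : l' ≤ m') :
    |∑ p ∈ Finset.Ico l m, ∑ q ∈ Finset.Ico l' m', inner ℝ (x (p + 1) - x p) (x (q + 1) - x q) *
      inner ℝ (skewIncr y l m p) (skewIncr y l' m' q)| ≤
      4 * C ^ 2 * rectIncr (· ^ α) (s l) (s m) (s l') (s m') ^ 2 := by
  set ρ := rectIncr (· ^ α) (s l) (s m) (s l') (s m') with hρ
  have hterm : ∀ p ∈ Finset.Ico l m, ∀ q ∈ Finset.Ico l' m',
      |inner ℝ (x (p + 1) - x p) (x (q + 1) - x q) *
        inner ℝ (skewIncr y l m p) (skewIncr y l' m' q)| ≤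
      C * rectIncr (· ^ α) (s p) (s (p + 1)) (s q) (s (q + 1)) * (4 * C * ρ) := by
    intro p hp q hq
    obtain ⟨hp1, hp2⟩ := Finset.mem_Ico.1 hp
    obtain ⟨hq1, hq2⟩ := Finset.mem_Ico.1 hq
    rw [abs_mul]
    have hp3 : p + 1 ≤ m := hp2
    have hq3 : q + 1 ≤ m' := hq2
    have e1 := hx.inner_le p.le_succ (show p + 1 ≤ q by omega) q.le_succ
    refine mul_le_mul e1 ?_ (abs_nonneg _) ((abs_nonneg _).trans e1)
    -- By monotonicity any increment of `y` inside the first cell pairs with any inside the second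
    -- to at most `C ρ`. Expanding the two skew increments gives four such pairs, while the bounds
    -- on the pairings of `x` sum to `C ρ` by additivity; hence the square of `ρ`.
    have key : ∀ {a b c d : ℕ}, l ≤ a → a ≤ b → b ≤ m → l' ≤ c → c ≤ d → d ≤ m' →
        |inner ℝ (y b - y a) (y d - y c)| ≤ C * ρ := by
      intro a b c d h1' h2 h3 h4 h5 h6
      refine (hy.inner_le h2 (h3.trans (hm.trans h4)) h5).trans (mul_le_mul_of_nonneg_left ?_ hC)
      exact rectIncr_rpow_mono h0.le h1 (hs h1') (hs h2) (hs h3) (hs hm) (hs h4) (hs h5) (hs h6)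
    have k1 := abs_le.1 (key (a := p + 1) (b := m) (c := q + 1) (d := m') (by omega) (by omega)
      (by omega) (by omega) (by omega) le_rfl)
    have k2 := abs_le.1 (key (a := p + 1) (b := m) (c := l') (d := q) (by omega) (by omega)
      (by omega) (by omega) (by omega) (by omega))
    have k3 := abs_le.1 (key (a := l) (b := p) (c := q + 1) (d := m') (by omega) (by omega)
      (by omega) (by omega) (by omega) le_rfl)
    have k4 := abs_le.1 (key (a := l) (b := p) (c := l') (d := q) (by omega) (by omega)
      (by omega) (by omega) (by omega) (by omega))
    have hexp : ∀ a b c d : F, inner ℝ (a - b) (c - d) =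
        inner ℝ a c - inner ℝ a d - (inner ℝ b c - inner ℝ b d) := fun a b c d => by
      rw [inner_sub_left, inner_sub_right, inner_sub_right]
    rw [skewIncr, skewIncr, hexp (y m - y (p + 1))]
    rw [abs_le]
    constructor <;> linarith [k1.1, k1.2, k2.1, k2.2, k3.1, k3.2, k4.1, k4.2]
  refine (Finset.abs_sum_le_sum_abs _ _).trans ((Finset.sum_le_sum fun p hp =>
    (Finset.abs_sum_le_sum_abs _ _).trans (Finset.sum_le_sum (hterm p hp))).trans (le_of_eq ?_))
  simp only [← Finset.sum_mul, ← Finset.mul_sum]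
  simp only [sum_rectIncr_right _ s _ _ h', sum_rectIncr_left _ s _ _ h]
  rw [← hρ]; ring

/-- The sum of the areas of the cells of a coarse grid `κ`. -/
lemma RoughGrid.sum_cells_le (hx : RoughGrid x s α C) (hy : RoughGrid y s α C) (hC : 0 ≤ C)
    (h0 : 1 / 2 < α) (h1 : α < 1) (hs : Monotone s) {κ : ℕ → ℕ} (hκ : Monotone κ) (n : ℕ) {δ : ℝ}
    (hδ : ∀ k < n, s (κ (k + 1)) - s (κ k) ≤ δ) :
    ∑ k ∈ Finset.range n, ∑ j ∈ Finset.range n, ∑ p ∈ Finset.Ico (κ k) (κ (k + 1)),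
      ∑ q ∈ Finset.Ico (κ j) (κ (j + 1)), inner ℝ (x (p + 1) - x p) (x (q + 1) - x q) *
      inner ℝ (skewIncr y (κ k) (κ (k + 1)) p) (skewIncr y (κ j) (κ (j + 1)) q) ≤
      (32 + 8 * ((1 - α) / (2 * (2 * α - 1)))) * C ^ 2 *
        (δ ^ (2 * α - 1) * (s (κ n) - s (κ 0))) := by
  set K := (1 - α) / (2 * (2 * α - 1)) with hKd
  have hK : 0 ≤ K := div_nonneg (by linarith) (by linarith)
  have hα : 0 < α := by linarith
  set G : ℕ → ℕ → ℝ := fun k j => ∑ p ∈ Finset.Ico (κ k) (κ (k + 1)),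
      ∑ q ∈ Finset.Ico (κ j) (κ (j + 1)), inner ℝ (x (p + 1) - x p) (x (q + 1) - x q) *
      inner ℝ (skewIncr y (κ k) (κ (k + 1)) p) (skewIncr y (κ j) (κ (j + 1)) q) with hG
  set t : ℕ → ℝ := fun k => s (κ k) with ht
  have htm : Monotone t := hs.comp hκ
  have hsym : ∀ k j, G k j = G j k := by
    intro k j
    simp only [hG]
    rw [Finset.sum_comm]
    refine Finset.sum_congr rfl fun p _ => Finset.sum_congr rfl fun q _ => ?_
    rw [real_inner_comm, real_inner_comm (skewIncr y (κ j) (κ (j + 1)) p)]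
  have hdiag : ∀ k, G k k ≤ (24 + 8 * K) * C ^ 2 * (t (k + 1) - t k) ^ (2 * α) := fun k =>
    (le_abs_self _).trans (hx.cell_le hy hC h0 h1 hs (hκ k.le_succ))
  -- One factor of the squared increment is bounded by the power of the length of cell `k`. The
  -- other is first summed over `j`, where it telescopes, and is then bounded in the same way.
  have hoff : ∀ k, k < n → ∑ j ∈ Finset.Ico (k + 1) n, G k j ≤
      4 * C ^ 2 * (t (k + 1) - t k) ^ (2 * α) := by
    intro k hk
    have hsq : (t (k + 1) - t k) ^ (2 * α) = (t (k + 1) - t k) ^ α * (t (k + 1) - t k) ^ α := by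
      rw [two_mul, Real.rpow_add' (sub_nonneg.2 (htm k.le_succ)) (by linarith)]
    have hpos := Real.rpow_nonneg (sub_nonneg.2 (htm k.le_succ)) α
    have : ∀ j ∈ Finset.Ico (k + 1) n, G k j ≤ 4 * C ^ 2 * ((t (k + 1) - t k) ^ α *
        rectIncr (· ^ α) (t k) (t (k + 1)) (t j) (t (j + 1))) := by
      intro j hj
      have hkj : k + 1 ≤ j := (Finset.mem_Ico.1 hj).1
      refine (le_abs_self _).trans ((hx.two_cells_le hy hC hα h1.le hs (hκ k.le_succ) (hκ hkj)
        (hκ j.le_succ)).trans (mul_le_mul_of_nonneg_left ?_ (by positivity)))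
      rw [sq]
      exact mul_le_mul_of_nonneg_right (rectIncr_rpow_le_left hα (htm k.le_succ) (htm hkj)
        (htm j.le_succ) h1.le) (rectIncr_rpow_nonneg hα.le h1.le (htm k.le_succ) (htm hkj)
        (htm j.le_succ))
    refine (Finset.sum_le_sum this).trans ?_
    rw [← Finset.mul_sum, ← Finset.mul_sum, sum_rectIncr_right _ t _ _ hk, hsq]
    refine mul_le_mul_of_nonneg_left (mul_le_mul_of_nonneg_left ?_ hpos) (by positivity)
    exact rectIncr_rpow_le_left hα (htm k.le_succ) le_rfl (htm hk) h1.le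
  rw [Finset.range_eq_Ico]
  change ∑ k ∈ Finset.Ico 0 n, ∑ j ∈ Finset.Ico 0 n, G k j ≤ _
  rw [sum_sum_symm G hsym n.zero_le]
  have e1 := Finset.sum_le_sum fun k (hk : k ∈ Finset.Ico 0 n) => hdiag k
  have e2 := Finset.sum_le_sum fun k (hk : k ∈ Finset.Ico 0 n) => hoff k (Finset.mem_Ico.1 hk).2
  rw [← Finset.mul_sum] at e1 e2
  have e3 := sum_rpow_le (β := 2 * α) (by linarith) htm n.zero_le (δ := δ) fun k hk =>
    hδ k (Finset.mem_Ico.1 hk).2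
  -- The diagonal gives `24 + 8K`, and the pairs `k < j`, counted twice, give `2 · 4`.
  have e4 := mul_le_mul_of_nonneg_left e3 (show 0 ≤ (32 + 8 * K) * C ^ 2 by positivity)
  refine le_trans ?_ e4
  linarith

/-- The difference of the trapezoidal sums on a fine grid and on a coarse grid `κ`. -/
lemma trapezoid_sub_eq {R : Type*} [Field R] [CharZero R] (a b : ℕ → R) (c : R) {κ : ℕ → ℕ}
    (hκ : Monotone κ) (n : ℕ) :
    ∑ p ∈ Finset.Ico (κ 0) (κ n), (a (p + 1) - a p) * (c - (b p + b (p + 1)) / 2) -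
      ∑ k ∈ Finset.range n, (a (κ (k + 1)) - a (κ k)) * (c - (b (κ k) + b (κ (k + 1))) / 2) =
    2⁻¹ * ∑ k ∈ Finset.range n, ∑ p ∈ Finset.Ico (κ k) (κ (k + 1)), (a (p + 1) - a p) *
      ((b (κ (k + 1)) - b (p + 1)) - (b p - b (κ k))) := by
  induction n with
  | zero => simp
  | succ n ih =>
    rw [Finset.sum_range_succ, Finset.sum_range_succ, mul_add, ← ih,
      ← Finset.sum_Ico_consecutive _ (hκ n.zero_le) (hκ n.le_succ), ← sum_telescope a (hκ n.le_succ),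
      Finset.sum_mul, Finset.mul_sum]
    simp only [Nat.succ_eq_add_one]
    have : ∀ (A B S T U : R), S - T = U → (A + S) - (B + T) = A - B + U := by
      intro A B S T U h; rw [← h]; ring
    apply this
    -- The coarse increment of `a` has been split along the fine grid, so `c` cancels and only the
    -- difference of the two averages of `b` survives.
    rw [← Finset.sum_sub_distrib]
    refine Finset.sum_congr rfl fun p _ => ?_
    ring

end

end

noncomputable section

/-! ### Level-2 integrals of piecewise-linear paths -/

namespace Dissection
variable {T : ℝ} (D : Dissection T)

/-- The nodes of a dissection, as a sequence that is eventually constant. -/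
def node (k : ℕ) : ℝ := D.pt ⟨min k D.n, by omega⟩

lemma node_mono : Monotone D.node := fun a b h => D.strictMono.monotone (by
  rw [Fin.le_def]; simp only; omega)

lemma node_lt {k : ℕ} (hk : k < D.n) : D.node k < D.node (k + 1) := D.strictMono (by
  rw [Fin.lt_def]; simp only; omega)

@[simp] lemma node_zero : D.node 0 = 0 := by
  rw [node, ← D.first]; congr 1

@[simp] lemma node_n : D.node D.n = T := by
  conv_rhs => rw [← D.last]
  rw [node]; congr 1; ext; simp

lemma pt_castSucc (k : Fin D.n) : D.pt k.castSucc = D.node k := by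
  rw [node]; congr 1; ext; simp

lemma pt_succ (k : Fin D.n) : D.pt k.succ = D.node (k + 1) := by
  rw [node]; congr 1; ext; simp

lemma node_le (k : ℕ) : D.node k ≤ T := by
  rcases le_total k D.n with h | h
  · simpa using D.node_mono h
  · conv_rhs => rw [← D.node_n]
    rw [node, node]; simp [h]

lemma node_nonneg (k : ℕ) : 0 ≤ D.node k := by simpa using D.node_mono k.zero_le

lemma node_sub_le_mesh {k : ℕ} (hk : k < D.n) : D.node (k + 1) - D.node k ≤ D.mesh := by
  have := le_ciSup (f := fun k : Fin D.n => D.pt k.succ - D.pt k.castSucc)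
    (Set.finite_range _).bddAbove ⟨k, hk⟩
  rwa [pt_succ, pt_castSucc] at this

lemma mesh_nonneg : 0 ≤ D.mesh := Real.iSup_nonneg fun k => by
  rw [pt_succ, pt_castSucc]; exact sub_nonneg.2 (D.node_mono (Nat.le_succ _))

lemma exists_cell {u : ℝ} (h0 : 0 ≤ u) (hu : u < T) :
    ∃ k < D.n, D.node k ≤ u ∧ u < D.node (k + 1) := by
  have : ∀ m, u < D.node m → ∃ k < m, D.node k ≤ u ∧ u < D.node (k + 1) := by
    intro m
    induction m with
    | zero => intro h; rw [node_zero] at h; linarith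
    | succ m ih =>
      intro h
      rcases lt_or_ge u (D.node m) with h' | h'
      · obtain ⟨k, hk, hk'⟩ := ih h'
        exact ⟨k, hk.trans m.lt_succ_self, hk'⟩
      · exact ⟨m, m.lt_succ_self, h', h⟩
  exact this D.n (by rwa [node_n])

/-- Two dissections have a common refinement. -/
lemma exists_refinement (D D' : Dissection T) : ∃ (s : ℕ → ℝ) (κ κ' : ℕ → ℕ), Monotone s ∧
    (∀ n, s n ∈ Set.Icc 0 T) ∧ Monotone κ ∧ Monotone κ' ∧ κ 0 = κ' 0 ∧ κ D.n = κ' D'.n ∧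
    (∀ k, s (κ k) = D.node k) ∧ ∀ k, s (κ' k) = D'.node k := by
  classical
  set F : Finset ℝ := (Finset.range (D.n + 1)).image D.node ∪ (Finset.range (D'.n + 1)).image D'.node
    with hF
  have hmem : ∀ k, D.node k ∈ F := fun k => by
    refine Finset.mem_union_left _ (Finset.mem_image.2 ⟨min k D.n, by simp, ?_⟩)
    rw [node, node]; simp
  have hmem' : ∀ k, D'.node k ∈ F := fun k => by
    refine Finset.mem_union_right _ (Finset.mem_image.2 ⟨min k D'.n, by simp, ?_⟩)
    rw [node, node]; simp
  have hFI : ∀ u ∈ F, u ∈ Set.Icc 0 T := by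
    intro u hu
    rcases Finset.mem_union.1 hu with h | h
    · obtain ⟨k, -, rfl⟩ := Finset.mem_image.1 h
      exact ⟨D.node_nonneg k, D.node_le k⟩
    · obtain ⟨k, -, rfl⟩ := Finset.mem_image.1 h
      exact ⟨D'.node_nonneg k, D'.node_le k⟩
  have hc : 0 < F.card := Finset.card_pos.2 ⟨_, hmem 0⟩
  set e := F.orderIsoOfFin rfl with he
  -- `s` lists the union of the nodes in increasing order and stays at the largest one afterwards;
  -- `κ` and `κ'` send a node to its rank in the union.
  refine ⟨fun n => e ⟨min n (F.card - 1), by omega⟩, fun k => e.symm ⟨D.node k, hmem k⟩,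
    fun k => e.symm ⟨D'.node k, hmem' k⟩, ?_, fun n => hFI _ (e _).2, ?_, ?_, ?_, ?_, ?_, ?_⟩
  · intro a b h
    exact e.monotone (by rw [Fin.le_def]; simp only; omega)
  · intro a b h
    exact e.symm.monotone (Subtype.mk_le_mk.2 (D.node_mono h))
  · intro a b h
    exact e.symm.monotone (Subtype.mk_le_mk.2 (D'.node_mono h))
  · simp only [node_zero]
  · simp only [node_n]
  · intro k
    have : (⟨min (e.symm ⟨D.node k, hmem k⟩ : ℕ) (F.card - 1), by omega⟩ : Fin F.card) =
      e.symm ⟨D.node k, hmem k⟩ := by ext; simp only; omega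
    simp only [this, OrderIso.apply_symm_apply]
  · intro k
    have : (⟨min (e.symm ⟨D'.node k, hmem' k⟩ : ℕ) (F.card - 1), by omega⟩ : Fin F.card) =
      e.symm ⟨D'.node k, hmem' k⟩ := by ext; simp only; omega
    simp only [this, OrderIso.apply_symm_apply]

/-- The slope of the interpolation on a cell. -/
def slope (x : ℝ → ℝ) (k : ℕ) : ℝ := (x (D.node (k + 1)) - x (D.node k)) / (D.node (k + 1) - D.node k)

lemma plInterp_eq (x : ℝ → ℝ) (u : ℝ) : plInterp D x u = x 0 + ∑ k ∈ Finset.range D.n,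
    (x (D.node (k + 1)) - x (D.node k)) *
      max 0 (min 1 ((u - D.node k) / (D.node (k + 1) - D.node k))) := by
  rw [plInterp, ← Fin.sum_univ_eq_sum_range (fun k => (x (D.node (k + 1)) - x (D.node k)) *
      max 0 (min 1 ((u - D.node k) / (D.node (k + 1) - D.node k))))]
  simp only [pt_succ, pt_castSucc]

lemma continuous_plInterp (x : ℝ → ℝ) : Continuous (plInterp D x) := by
  unfold plInterp; fun_prop

/-- The clamp equals `1` on the cells before `k` and `0` on those after, so the earlier increments
telescope and only cell `k` is fractional. -/
lemma plInterp_cell (x : ℝ → ℝ) {k : ℕ} (hk : k < D.n) {u : ℝ}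
    (hu : u ∈ Set.Icc (D.node k) (D.node (k + 1))) :
    plInterp D x u = x (D.node k) + D.slope x k * (u - D.node k) := by
  have hsum : ∀ m, k < m → m ≤ D.n → x 0 + ∑ j ∈ Finset.range m, (x (D.node (j + 1)) - x (D.node j)) *
      max 0 (min 1 ((u - D.node j) / (D.node (j + 1) - D.node j))) =
      x (D.node k) + D.slope x k * (u - D.node k) := by
    intro m hm
    have hk1 : 0 < D.node (k + 1) - D.node k := sub_pos.2 (D.node_lt hk)
    induction m, hm using Nat.le_induction with
    | base =>
      intro _
      rw [Finset.sum_range_succ]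
      have h1 : ∀ j ∈ Finset.range k, (x (D.node (j + 1)) - x (D.node j)) *
          max 0 (min 1 ((u - D.node j) / (D.node (j + 1) - D.node j))) =
          x (D.node (j + 1)) - x (D.node j) := by
        intro j hj
        have hjk := Finset.mem_range.1 hj
        have hj1 : 0 < D.node (j + 1) - D.node j := sub_pos.2 (D.node_lt (hjk.trans hk))
        have : 1 ≤ (u - D.node j) / (D.node (j + 1) - D.node j) := by
          rw [le_div_iff₀ hj1]; linarith [D.node_mono (show j + 1 ≤ k from hjk), hu.1]
        rw [min_eq_left this]; simp
      rw [Finset.sum_congr rfl h1, Finset.sum_range_sub (fun j => x (D.node j)), node_zero]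
      have h2 : (u - D.node k) / (D.node (k + 1) - D.node k) ≤ 1 := by
        rw [div_le_iff₀ hk1]; linarith [hu.2]
      have h3 : 0 ≤ (u - D.node k) / (D.node (k + 1) - D.node k) :=
        div_nonneg (by linarith [hu.1]) hk1.le
      rw [min_eq_right h2, max_eq_right h3, slope]
      ring
    | succ m hm ih =>
      intro hmn
      have hj1 : 0 < D.node (m + 1) - D.node m := sub_pos.2 (D.node_lt hmn)
      have : (u - D.node m) / (D.node (m + 1) - D.node m) ≤ 0 :=
        div_nonpos_of_nonpos_of_nonneg (by linarith [D.node_mono hm, hu.2]) hj1.le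
      rw [Finset.sum_range_succ, ← add_assoc, ih (by omega), max_eq_left (min_le_of_right_le this)]
      simp
  rw [plInterp_eq]; exact hsum D.n hk le_rfl

lemma plInterp_node (x : ℝ → ℝ) {k : ℕ} (hk : k < D.n) : plInterp D x (D.node (k + 1)) =
    x (D.node (k + 1)) := by
  rw [D.plInterp_cell x hk ⟨D.node_mono k.le_succ, le_rfl⟩, slope,
    div_mul_cancel₀ _ (sub_pos.2 (D.node_lt hk)).ne']
  ring

lemma hasDerivAt_plInterp (x : ℝ → ℝ) {k : ℕ} (hk : k < D.n) {u : ℝ}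
    (hu : u ∈ Set.Ioo (D.node k) (D.node (k + 1))) :
    HasDerivAt (plInterp D x) (D.slope x k) u := by
  have h : HasDerivAt (fun u => x (D.node k) + D.slope x k * (u - D.node k)) (D.slope x k) u := by
    simpa using (((hasDerivAt_id u).sub_const (D.node k)).const_mul (D.slope x k)).const_add
      (x (D.node k))
  refine h.congr_of_eventuallyEq ?_
  filter_upwards [Ioo_mem_nhds hu.1 hu.2] with w hw
  exact D.plInterp_cell x hk ⟨hw.1.le, hw.2.le⟩

lemma ae_cell_of_Ioo {p : ℝ → Prop} {a b : ℝ} (hab : a ≤ b) (h : ∀ u ∈ Set.Ioo a b, p u) :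
    ∀ᵐ u ∂volume, u ∈ Set.uIoc a b → p u := by
  have : ∀ᵐ u ∂(volume : Measure ℝ), u ≠ b := by simp [ae_iff]
  filter_upwards [this] with u hu hu'
  rw [Set.uIoc_of_le hab] at hu'
  exact h u ⟨hu'.1, lt_of_le_of_ne hu'.2 hu⟩

lemma intervalIntegrable_deriv_plInterp (x : ℝ → ℝ) :
    IntervalIntegrable (deriv (plInterp D x)) volume 0 T := by
  have : ∀ k < D.n, IntervalIntegrable (deriv (plInterp D x)) volume (D.node k) (D.node (k + 1)) := by
    intro k hk
    refine (intervalIntegrable_const (c := D.slope x k)).congr_ae ?_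
    rw [EventuallyEq, ae_restrict_iff' measurableSet_uIoc]
    refine ae_cell_of_Ioo (D.node_mono k.le_succ) fun u hu => ?_
    exact (D.hasDerivAt_plInterp x hk hu).deriv.symm
  have := IntervalIntegrable.trans_iterate this
  simpa using this

/-- The interpolation is continuous and differentiable off the countable set of nodes, which is
enough for the fundamental theorem of calculus. -/
lemma integral_deriv_plInterp (x : ℝ → ℝ) {u : ℝ} (h0 : 0 ≤ u) (hu : u ≤ T) :
    ∫ v in u..T, deriv (plInterp D x) v = plInterp D x T - plInterp D x u := by
  refine integral_eq_of_hasDerivAt_off_countable _ _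
    (s := Set.range D.node) (Set.countable_range _) (D.continuous_plInterp x).continuousOn ?_ ?_
  · rintro v ⟨hv, hvn⟩
    rw [min_eq_left hu, max_eq_right hu] at hv
    obtain ⟨k, hk, hk1, hk2⟩ := D.exists_cell (h0.trans hv.1.le) hv.2
    have hd := D.hasDerivAt_plInterp x hk (u := v)
      ⟨lt_of_le_of_ne hk1 fun h => hvn ⟨k, h⟩, hk2⟩
    exact hd.differentiableAt.hasDerivAt
  · refine (D.intervalIntegrable_deriv_plInterp x).mono_set ?_
    rw [Set.uIcc_of_le hu, Set.uIcc_of_le (h0.trans hu)]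
    exact Set.Icc_subset_Icc_left h0

end Dissection

/-- The level-2 integral of the piecewise-linear interpolation is a trapezoidal sum. -/
lemma plSig_two {d : ℕ} {T : ℝ} (hT : 0 < T) (D : Dissection T) (x : Fin d → ℝ → ℝ) (i j : Fin d) :
    plSig D x 0 T [i, j] = ∑ k ∈ Finset.range D.n, (x i (D.node (k + 1)) - x i (D.node k)) *
      (x j T - (x j (D.node k) + x j (D.node (k + 1))) / 2) := by
  have hn : ∃ m, D.n = m + 1 := Nat.exists_eq_succ_of_ne_zero fun h => by
    have := D.node_n; rw [h, D.node_zero] at this; exact hT.ne this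
  have hend : plInterp D (x j) T = x j T := by
    obtain ⟨m, hm⟩ := hn
    have := D.plInterp_node (x j) (k := m) (by omega)
    rwa [← hm, D.node_n] at this
  simp only [plSig, iterInt, mul_one]
  have h1 : ∫ u in (0 : ℝ)..T, deriv (plInterp D (x i)) u * ∫ v in u..T, deriv (plInterp D (x j)) v =
      ∫ u in (0 : ℝ)..T, deriv (plInterp D (x i)) u * (x j T - plInterp D (x j) u) := by
    refine intervalIntegral.integral_congr fun u hu => ?_
    rw [Set.uIcc_of_le hT.le] at hu
    rw [D.integral_deriv_plInterp _ hu.1 hu.2, hend]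
  rw [h1]
  -- The integrand is affine inside each cell; its integral there produces the average of the two
  -- endpoint values of `x j`.
  have hcell : ∀ k < D.n, ∀ᵐ u ∂volume, u ∈ Set.uIoc (D.node k) (D.node (k + 1)) →
      D.slope (x i) k * (x j T - x j (D.node k) - D.slope (x j) k * (u - D.node k)) =
      deriv (plInterp D (x i)) u * (x j T - plInterp D (x j) u) := by
    intro k hk
    refine Dissection.ae_cell_of_Ioo (D.node_mono k.le_succ) fun u hu => ?_
    rw [(D.hasDerivAt_plInterp (x i) hk hu).deriv, D.plInterp_cell (x j) hk ⟨hu.1.le, hu.2.le⟩]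
    ring
  have hint : ∀ k < D.n, IntervalIntegrable (fun u => deriv (plInterp D (x i)) u *
      (x j T - plInterp D (x j) u)) volume (D.node k) (D.node (k + 1)) := by
    intro k hk
    have hc : Continuous fun u => D.slope (x i) k *
      (x j T - x j (D.node k) - D.slope (x j) k * (u - D.node k)) := by fun_prop
    refine (hc.intervalIntegrable _ _).congr_ae ?_
    rw [EventuallyEq, ae_restrict_iff' measurableSet_uIoc]
    exact hcell k hk
  have hsum := intervalIntegral.sum_integral_adjacent_intervals hint
  rw [D.node_zero, D.node_n] at hsum
  rw [← hsum]
  refine Finset.sum_congr rfl fun k hk => ?_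
  have hkn := Finset.mem_range.1 hk
  have hpos : D.node (k + 1) - D.node k ≠ 0 := (sub_pos.2 (D.node_lt hkn)).ne'
  have hi : ∀ a b : ℝ, ∫ u in a..b, (u - a) = (b - a) ^ 2 / 2 := fun a b => by
    rw [intervalIntegral.integral_comp_sub_right (fun u => u), integral_id]; simp
  rw [← intervalIntegral.integral_congr_ae (hcell k hkn), intervalIntegral.integral_const_mul,
    intervalIntegral.integral_sub (by simp) (Continuous.intervalIntegrable (by fun_prop) _ _),
    intervalIntegral.integral_const_mul, hi, intervalIntegral.integral_const, Dissection.slope,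
    Dissection.slope]
  simp only [smul_eq_mul]
  field_simp
  ring

end

noncomputable section

/-! ### `L²` estimates for trapezoidal sums of independent processes -/

/-- First and second differences of `v` on `[0, T]` are dominated by those of `t ↦ t ^ α`. -/
structure IsRoughVariance (v : ℝ → ℝ) (T α C : ℝ) : Prop where
  diff_le : ∀ ⦃a b : ℝ⦄, 0 ≤ a → a ≤ b → b ≤ T → |v b - v a| ≤ C * (b ^ α - a ^ α)
  second_diff_le : ∀ ⦃x a b : ℝ⦄, 0 ≤ x → 0 ≤ a → 0 ≤ b → x + a + b ≤ T →
    |v (x + a) + v (x + b) - v x - v (x + a + b)| ≤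
      C * ((x + a) ^ α + (x + b) ^ α - x ^ α - (x + a + b) ^ α)

lemma inner_sub_sub_eq {E : Type*} [NormedAddCommGroup E] [InnerProductSpace ℝ E] (a b c d : E) :
    inner ℝ (b - a) (d - c) =
      (‖c - b‖ ^ 2 + ‖d - a‖ ^ 2 - ‖d - b‖ ^ 2 - ‖c - a‖ ^ 2) / 2 := by
  simp only [norm_sub_sq_real, inner_sub_left, inner_sub_right, real_inner_comm b c,
    real_inner_comm d a, real_inner_comm d b, real_inner_comm c a]
  ring

/-- By polarization, inner products of increments depend only on squared norms of increments.
Disjoint intervals give a second difference of `v`, nested ones a sum of two first differences. -/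
lemma IsRoughVariance.roughGrid {E : Type*} [NormedAddCommGroup E] [InnerProductSpace ℝ E]
    {v : ℝ → ℝ} {T α C : ℝ} (hv : IsRoughVariance v T α C) {s : ℕ → ℝ} (hs : Monotone s)
    (hsT : ∀ n, s n ∈ Set.Icc 0 T) {x : ℕ → E}
    (hx : ∀ p q, p ≤ q → ‖x q - x p‖ ^ 2 = 2 * v (s q - s p)) : RoughGrid x s α C where
  inner_le p q p' q' h1 h2 h3 := by
    rw [inner_sub_sub_eq, hx _ _ h2, hx _ _ (h1.trans (h2.trans h3)), hx _ _ (h2.trans h3),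
      hx _ _ (h1.trans h2)]
    have := hv.second_diff_le (x := s p' - s q) (a := s q - s p) (b := s q' - s p')
      (sub_nonneg.2 (hs h2)) (sub_nonneg.2 (hs h1)) (sub_nonneg.2 (hs h3))
      (by linarith [(hsT q').2, (hsT p).1])
    rw [show s p' - s q + (s q - s p) = s p' - s p by ring,
      show s p' - s q + (s q' - s p') = s q' - s q by ring,
      show s p' - s p + (s q' - s p') = s q' - s p by ring] at this
    rw [← abs_neg, rectIncr]
    refine le_trans (le_of_eq ?_) (this.trans (le_of_eq ?_))
    · congr 1; ring
    · ring
  inner_total_le l p q m h1 h2 h3 := by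
    have e : inner ℝ (x q - x p) (x m - x l) = v (s m - s p) - v (s m - s q) +
        (v (s q - s l) - v (s p - s l)) := by
      rw [inner_sub_sub_eq, norm_sub_rev (x l) (x q), norm_sub_rev (x l) (x p),
        hx _ _ (h1.trans h2), hx _ _ (h2.trans h3), hx _ _ h3, hx _ _ h1]
      ring
    rw [e]
    have e1 := hv.diff_le (a := s m - s q) (b := s m - s p) (sub_nonneg.2 (hs h3))
      (by linarith [hs h2]) (by linarith [(hsT m).2, (hsT p).1])
    have e2 := hv.diff_le (a := s p - s l) (b := s q - s l) (sub_nonneg.2 (hs h1))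
      (by linarith [hs h2]) (by linarith [(hsT q).2, (hsT l).1])
    refine (abs_add_le _ _).trans ((add_le_add e1 e2).trans (le_of_eq ?_))
    ring

section
variable {Ω : Type*} [MeasurableSpace Ω] {P : Measure Ω}

/-- The square of the product is a product of independent integrable variables, so second moments
suffice. -/
lemma memLp_two_mul_of_indep {f g : Ω → ℝ} (hf : MemLp f 2 P) (hg : MemLp g 2 P)
    (h : IndepFun (fun ω => f ω * f ω) (fun ω => g ω * g ω) P) :
    MemLp (fun ω => f ω * g ω) 2 P := by
  have hm : AEStronglyMeasurable (fun ω => f ω * g ω) P :=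
    hf.aestronglyMeasurable.mul hg.aestronglyMeasurable
  rw [memLp_two_iff_integrable_sq hm]
  have := h.integrable_mul (hf.integrable_mul hf) (hg.integrable_mul hg)
  refine this.congr (Eventually.of_forall fun ω => ?_)
  simp only [Pi.mul_apply]; ring

lemma integral_sq_sum_mul_of_indep {ι : Type*} (S : Finset ι) {a w : ι → Ω → ℝ}
    (ha : ∀ i, MemLp (a i) 2 P) (hw : ∀ i, MemLp (w i) 2 P)
    (hind : ∀ i j, IndepFun (fun ω => a i ω * a j ω) (fun ω => w i ω * w j ω) P) :
    ∫ ω, (∑ i ∈ S, a i ω * w i ω) ^ 2 ∂P =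
      ∑ i ∈ S, ∑ j ∈ S, (∫ ω, a i ω * a j ω ∂P) * ∫ ω, w i ω * w j ω ∂P := by
  have hint : ∀ i j, Integrable (fun ω => (a i ω * a j ω) * (w i ω * w j ω)) P := fun i j =>
    (hind i j).integrable_mul ((ha i).integrable_mul (ha j)) ((hw i).integrable_mul (hw j))
  have hexp : ∀ ω, (∑ i ∈ S, a i ω * w i ω) ^ 2 =
      ∑ i ∈ S, ∑ j ∈ S, (a i ω * a j ω) * (w i ω * w j ω) := fun ω => by
    rw [sq, Finset.sum_mul_sum]
    exact Finset.sum_congr rfl fun i _ => Finset.sum_congr rfl fun j _ => by ring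
  simp only [hexp]
  rw [integral_finsetSum _ fun i _ => integrable_finsetSum _ fun j _ => hint i j]
  refine Finset.sum_congr rfl fun i _ => ?_
  rw [integral_finsetSum _ fun j _ => hint i j]
  refine Finset.sum_congr rfl fun j _ => ?_
  exact (hind i j).integral_fun_mul_eq_mul_integral
    ((ha i).integrable_mul (ha j)).aestronglyMeasurable
    ((hw i).integrable_mul (hw j)).aestronglyMeasurable

lemma memLp_two_sum_mul_of_indep {ι : Type*} (S : Finset ι) {a w : ι → Ω → ℝ}
    (ha : ∀ i, MemLp (a i) 2 P) (hw : ∀ i, MemLp (w i) 2 P)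
    (hind : ∀ i j, IndepFun (fun ω => a i ω * a j ω) (fun ω => w i ω * w j ω) P) :
    MemLp (fun ω => ∑ i ∈ S, a i ω * w i ω) 2 P :=
  memLp_finsetSum S fun i _ => memLp_two_mul_of_indep (ha i) (hw i) (hind i i)

/-- The trapezoidal sum `∑ (x_{p+1} - x_p) (y_T - (y_p + y_{p+1}) / 2)`. -/
def trapezoid {T : ℝ} (D : Dissection T) (x y : ℝ → ℝ) : ℝ :=
  ∑ k ∈ Finset.range D.n, (x (D.node (k + 1)) - x (D.node k)) *
      (y T - (y (D.node k) + y (D.node (k + 1))) / 2)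

/-- The constant of the area estimate. -/
def areaConst (α C : ℝ) : ℝ := (32 + 8 * ((1 - α) / (2 * (2 * α - 1)))) * C ^ 2

lemma areaConst_nonneg {α C : ℝ} (h0 : 1 / 2 < α) (h1 : α < 1) : 0 ≤ areaConst α C := by
  have : 0 ≤ (1 - α) / (2 * (2 * α - 1)) := div_nonneg (by linarith) (by linarith)
  unfold areaConst; positivity

lemma eLpNorm_two_le_of_integral_sq_le {f : Ω → ℝ} (hf : MemLp f 2 P) {c : ℝ}
    (h : ∫ ω, f ω ^ 2 ∂P ≤ c) : eLpNorm f 2 P ≤ ENNReal.ofReal (Real.sqrt c) := by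
  rw [hf.eLpNorm_eq_integral_rpow_norm two_ne_zero ENNReal.ofNat_ne_top]
  refine ENNReal.ofReal_le_ofReal ?_
  rw [Real.sqrt_eq_rpow]
  simp only [ENNReal.toReal_ofNat, Real.rpow_ofNat, Real.norm_eq_abs, sq_abs, one_div]
  exact Real.rpow_le_rpow (integral_nonneg fun ω => sq_nonneg _) h (by norm_num)

/-- The marginals are read as vectors of `L²(P)`, so that the variance hypotheses become `RoughGrid`
bounds. By independence the second moment of the difference is a quarter of the double sum in
`RoughGrid.sum_cells_le`. -/
lemma eLpNorm_trapezoid_sub_grid_le {X Y : ℝ → Ω → ℝ} (hX : ∀ t, MemLp (X t) 2 P)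
    (hY : ∀ t, MemLp (Y t) 2 P) (hind : IndepFun (fun ω t => X t ω) (fun ω t => Y t ω) P)
    {T α C : ℝ} (hC : 0 ≤ C) (h0 : 1 / 2 < α) (h1 : α < 1) {v v' : ℝ → ℝ}
    (hv : IsRoughVariance v T α C) (hv' : IsRoughVariance v' T α C)
    (hXv : ∀ s t, 0 ≤ s → s ≤ t → t ≤ T → ∫ ω, (X t ω - X s ω) ^ 2 ∂P = 2 * v (t - s))
    (hYv : ∀ s t, 0 ≤ s → s ≤ t → t ≤ T → ∫ ω, (Y t ω - Y s ω) ^ 2 ∂P = 2 * v' (t - s))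
    {s : ℕ → ℝ} (hs : Monotone s) (hsT : ∀ n, s n ∈ Set.Icc 0 T) (D : Dissection T) {κ : ℕ → ℕ}
    (hκ : Monotone κ) (hsκ : ∀ k, s (κ k) = D.node k) :
    eLpNorm (fun ω => ∑ p ∈ Finset.Ico (κ 0) (κ D.n), (X (s (p + 1)) ω - X (s p) ω) *
      (Y T ω - (Y (s p) ω + Y (s (p + 1)) ω) / 2) - trapezoid D (X · ω) (Y · ω)) 2 P ≤
      ENNReal.ofReal (Real.sqrt (areaConst α C * (D.mesh ^ (2 * α - 1) * T))) := by
  set x : ℕ → Lp ℝ 2 P := fun n => (hX (s n)).toLp with hxdef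
  set y : ℕ → Lp ℝ 2 P := fun n => (hY (s n)).toLp with hydef
  have hinner : ∀ {f g : Ω → ℝ} (hf : MemLp f 2 P) (hg : MemLp g 2 P),
      inner ℝ hf.toLp hg.toLp = ∫ ω, f ω * g ω ∂P := by
    intro f g hf hg
    rw [L2.inner_def]
    refine integral_congr_ae ?_
    filter_upwards [hf.coeFn_toLp, hg.coeFn_toLp] with ω h1 h2
    rw [h1, h2]; simp [mul_comm]
  have hnorm : ∀ {f : Ω → ℝ} (hf : MemLp f 2 P), ‖hf.toLp‖ ^ 2 = ∫ ω, f ω ^ 2 ∂P := by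
    intro f hf
    rw [← real_inner_self_eq_norm_sq, hinner]
    simp only [sq]
  have gx : RoughGrid x s α C := hv.roughGrid hs hsT fun p q hpq => by
    rw [hxdef]; simp only
    rw [← MemLp.toLp_sub, hnorm]
    exact hXv _ _ (hsT p).1 (hs hpq) (hsT q).2
  have gy : RoughGrid y s α C := hv'.roughGrid hs hsT fun p q hpq => by
    rw [hydef]; simp only
    rw [← MemLp.toLp_sub, hnorm]
    exact hYv _ _ (hsT p).1 (hs hpq) (hsT q).2
  -- An index is a pair of a coarse cell and a fine cell: the weight `w` depends on both, the
  -- increment `a` only on the fine one.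
  set a : (Σ _ : ℕ, ℕ) → Ω → ℝ := fun i ω => X (s (i.2 + 1)) ω - X (s i.2) ω with ha
  set w : (Σ _ : ℕ, ℕ) → Ω → ℝ := fun i ω => (Y (s (κ (i.1 + 1))) ω - Y (s (i.2 + 1)) ω) -
    (Y (s i.2) ω - Y (s (κ i.1)) ω) with hw
  have haL : ∀ i, MemLp (a i) 2 P := fun i => (hX _).sub (hX _)
  have hwL : ∀ i, MemLp (w i) 2 P := fun i => ((hY _).sub (hY _)).sub ((hY _).sub (hY _))
  have hindij : ∀ i j, IndepFun (fun ω => a i ω * a j ω) (fun ω => w i ω * w j ω) P := by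
    intro i j
    refine hind.comp (φ := fun f : ℝ → ℝ => (f (s (i.2 + 1)) - f (s i.2)) *
        (f (s (j.2 + 1)) - f (s j.2)))
      (ψ := fun f : ℝ → ℝ => ((f (s (κ (i.1 + 1))) - f (s (i.2 + 1))) - (f (s i.2) - f (s (κ i.1))))
        * ((f (s (κ (j.1 + 1))) - f (s (j.2 + 1))) - (f (s j.2) - f (s (κ j.1))))) ?_ ?_
    · fun_prop
    · fun_prop
  set S := (Finset.range D.n).sigma fun k => Finset.Ico (κ k) (κ (k + 1)) with hS
  have hfun : (fun ω => ∑ p ∈ Finset.Ico (κ 0) (κ D.n), (X (s (p + 1)) ω - X (s p) ω) *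
      (Y T ω - (Y (s p) ω + Y (s (p + 1)) ω) / 2) - trapezoid D (X · ω) (Y · ω)) =
      fun ω => 2⁻¹ * ∑ i ∈ S, a i ω * w i ω := by
    funext ω
    have := trapezoid_sub_eq (fun n => X (s n) ω) (fun n => Y (s n) ω) (Y T ω) hκ D.n
    rw [hS, Finset.sum_sigma, trapezoid, ← this]
    simp only [hsκ]
  rw [hfun]
  have hL : MemLp (fun ω => 2⁻¹ * ∑ i ∈ S, a i ω * w i ω) 2 P :=
    (memLp_two_sum_mul_of_indep S haL hwL hindij).const_mul _
  refine eLpNorm_two_le_of_integral_sq_le hL ?_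
  simp only [mul_pow]
  rw [integral_const_mul, integral_sq_sum_mul_of_indep S haL hwL hindij]
  have hδ : ∀ k < D.n, s (κ (k + 1)) - s (κ k) ≤ D.mesh := fun k hk => by
    rw [hsκ, hsκ]; exact D.node_sub_le_mesh hk
  have key := gx.sum_cells_le gy hC h0 h1 hs hκ D.n hδ
  rw [hsκ, hsκ, D.node_n, D.node_zero, sub_zero] at key
  have hA : ∀ i j : (Σ _ : ℕ, ℕ), (∫ ω, a i ω * a j ω ∂P) =
      inner ℝ (x (i.2 + 1) - x i.2) (x (j.2 + 1) - x j.2) := fun i j => by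
    rw [hxdef]; simp only
    rw [← MemLp.toLp_sub, ← MemLp.toLp_sub, hinner]
    rfl
  have hW : ∀ i j : (Σ _ : ℕ, ℕ), (∫ ω, w i ω * w j ω ∂P) =
      inner ℝ (skewIncr y (κ i.1) (κ (i.1 + 1)) i.2) (skewIncr y (κ j.1) (κ (j.1 + 1)) j.2) :=
    fun i j => by
    rw [skewIncr, skewIncr, hydef]; simp only
    rw [← MemLp.toLp_sub, ← MemLp.toLp_sub, ← MemLp.toLp_sub, ← MemLp.toLp_sub, ← MemLp.toLp_sub,
      ← MemLp.toLp_sub, hinner]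
    rfl
  simp only [hA, hW]
  have hre : ∑ i ∈ S, ∑ j ∈ S, inner ℝ (x (i.2 + 1) - x i.2) (x (j.2 + 1) - x j.2) *
      inner ℝ (skewIncr y (κ i.1) (κ (i.1 + 1)) i.2) (skewIncr y (κ j.1) (κ (j.1 + 1)) j.2) =
    ∑ k ∈ Finset.range D.n, ∑ j ∈ Finset.range D.n, ∑ p ∈ Finset.Ico (κ k) (κ (k + 1)),
      ∑ q ∈ Finset.Ico (κ j) (κ (j + 1)), inner ℝ (x (p + 1) - x p) (x (q + 1) - x q) *
      inner ℝ (skewIncr y (κ k) (κ (k + 1)) p) (skewIncr y (κ j) (κ (j + 1)) q) := by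
    rw [hS, Finset.sum_sigma]
    refine Finset.sum_congr rfl fun k _ => ?_
    simp only [Finset.sum_sigma]
    rw [Finset.sum_comm]
  rw [hre]
  change _ ≤ areaConst α C * (D.mesh ^ (2 * α - 1) * T) at key
  have hT : 0 ≤ T := (hsT 0).1.trans (hsT 0).2
  have hn : 0 ≤ areaConst α C * (D.mesh ^ (2 * α - 1) * T) :=
    mul_nonneg (areaConst_nonneg h0 h1) (mul_nonneg (Real.rpow_nonneg D.mesh_nonneg _) hT)
  linarith

lemma eLpNorm_trapezoid_sub_le {X Y : ℝ → Ω → ℝ} (hX : ∀ t, MemLp (X t) 2 P)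
    (hY : ∀ t, MemLp (Y t) 2 P) (hind : IndepFun (fun ω t => X t ω) (fun ω t => Y t ω) P)
    {T α C : ℝ} (hC : 0 ≤ C) (h0 : 1 / 2 < α) (h1 : α < 1) {v v' : ℝ → ℝ}
    (hv : IsRoughVariance v T α C) (hv' : IsRoughVariance v' T α C)
    (hXv : ∀ s t, 0 ≤ s → s ≤ t → t ≤ T → ∫ ω, (X t ω - X s ω) ^ 2 ∂P = 2 * v (t - s))
    (hYv : ∀ s t, 0 ≤ s → s ≤ t → t ≤ T → ∫ ω, (Y t ω - Y s ω) ^ 2 ∂P = 2 * v' (t - s))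
    (D D' : Dissection T) (hm : ∀ D : Dissection T,
      AEStronglyMeasurable (fun ω => trapezoid D (X · ω) (Y · ω)) P) :
    eLpNorm (fun ω => trapezoid D (X · ω) (Y · ω) - trapezoid D' (X · ω) (Y · ω)) 2 P ≤
      ENNReal.ofReal (Real.sqrt (areaConst α C * (D.mesh ^ (2 * α - 1) * T))) +
      ENNReal.ofReal (Real.sqrt (areaConst α C * (D'.mesh ^ (2 * α - 1) * T))) := by
  obtain ⟨s, κ, κ', hs, hsT, hκ, hκ', e0, en, hsκ, hsκ'⟩ := Dissection.exists_refinement D D'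
  have b1 := eLpNorm_trapezoid_sub_grid_le hX hY hind hC h0 h1 hv hv' hXv hYv hs hsT D hκ hsκ
  have b2 := eLpNorm_trapezoid_sub_grid_le hX hY hind hC h0 h1 hv hv' hXv hYv hs hsT D' hκ' hsκ'
  rw [← e0, ← en] at b2
  set Z : Ω → ℝ := fun ω => ∑ p ∈ Finset.Ico (κ 0) (κ D.n), (X (s (p + 1)) ω - X (s p) ω) *
      (Y T ω - (Y (s p) ω + Y (s (p + 1)) ω) / 2) with hZ
  have hZm : AEStronglyMeasurable Z P := by
    refine Finset.aestronglyMeasurable_fun_sum _ fun p _ => ?_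
    have m1 := fun t => (hX t).aestronglyMeasurable.aemeasurable
    have m2 := fun t => (hY t).aestronglyMeasurable.aemeasurable
    exact (((m1 _).sub (m1 _)).mul ((m2 _).sub (((m2 _).add (m2 _)).div_const _))).aestronglyMeasurable
  have e : (fun ω => trapezoid D (X · ω) (Y · ω) - trapezoid D' (X · ω) (Y · ω)) =
      (fun ω => Z ω - trapezoid D' (X · ω) (Y · ω)) - fun ω => Z ω - trapezoid D (X · ω) (Y · ω) := by
    funext ω; simp only [Pi.sub_apply]; ring
  rw [e, add_comm]
  exact (eLpNorm_sub_le (hZm.sub (hm D')) (hZm.sub (hm D)) one_le_two).trans (add_le_add b2 b1)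

end

end

noncomputable section

/-! ### The spectral integrals -/

/-- The first bound is used on `(0, 1]`, the second on `(1, ∞)`. -/
lemma integrableOn_Ioi_of_rpow_bounds {g : ℝ → ℝ} (hg : Measurable g) {A B a b : ℝ} (ha : -1 < a)
    (hb : b < -1) (h1 : ∀ l, 0 < l → |g l| ≤ A * l ^ a) (h2 : ∀ l, 0 < l → |g l| ≤ B * l ^ b) :
    IntegrableOn g (Set.Ioi 0) := by
  rw [← Set.Ioc_union_Ioi_eq_Ioi zero_le_one]
  refine IntegrableOn.union ?_ ?_
  · have hi : IntegrableOn (fun l : ℝ => A * l ^ a) (Set.Ioc 0 1) :=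
      ((intervalIntegrable_iff_integrableOn_Ioc_of_le zero_le_one).1
        (intervalIntegral.intervalIntegrable_rpow' ha)).const_mul A
    refine Integrable.mono' hi hg.aestronglyMeasurable ?_
    filter_upwards [ae_restrict_mem measurableSet_Ioc] with l hl using h1 l hl.1
  · have hi : IntegrableOn (fun l : ℝ => B * l ^ b) (Set.Ioi 1) :=
      (integrableOn_Ioi_rpow_of_lt hb one_pos).const_mul B
    refine Integrable.mono' hi hg.aestronglyMeasurable ?_
    filter_upwards [ae_restrict_mem measurableSet_Ioi] with l hl
      using h2 l (one_pos.trans hl)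

section
variable {H : ℝ}

lemma measurable_fouSpectral (θ : ℝ) : Measurable (fouSpectral H θ) := by
  unfold fouSpectral; fun_prop

lemma fouSpectral_pos {θ l : ℝ} (hl : 0 < l) : 0 < fouSpectral H θ l := by
  unfold fouSpectral; positivity

lemma integrableOn_fouSpectral (h0 : 0 < H) (h1 : H < 1) {θ : ℝ} (hθ : 0 < θ) :
    IntegrableOn (fouSpectral H θ) (Set.Ioi 0) := by
  refine integrableOn_Ioi_of_rpow_bounds (measurable_fouSpectral θ) (A := 1 / θ ^ 2) (B := 1)
    (a := 1 - 2 * H) (b := -1 - 2 * H) (by linarith) (by linarith) ?_ ?_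
  · intro l hl
    rw [abs_of_pos (fouSpectral_pos hl), fouSpectral, one_div_mul_eq_div]
    gcongr
    nlinarith [sq_nonneg l]
  · intro l hl
    rw [abs_of_pos (fouSpectral_pos hl), fouSpectral, one_mul, div_le_iff₀ (by positivity)]
    have : l ^ (1 - 2 * H) = l ^ (-1 - 2 * H) * l ^ 2 := by
      rw [← Real.rpow_natCast l 2, ← Real.rpow_add hl]; congr 1; push_cast; ring
    rw [this]
    gcongr
    nlinarith [sq_nonneg θ]

lemma integrableOn_mul_fouSpectral (h0 : 0 < H) (h1 : H < 1) {θ : ℝ} (hθ : 0 < θ) {g : ℝ → ℝ}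
    (hg : Measurable g) {c : ℝ} (hc : ∀ l, 0 < l → |g l| ≤ c) :
    IntegrableOn (fun l => g l * fouSpectral H θ l) (Set.Ioi 0) := by
  refine Integrable.bdd_mul (integrableOn_fouSpectral h0 h1 hθ) hg.aestronglyMeasurable (c := c) ?_
  filter_upwards [ae_restrict_mem measurableSet_Ioi] with l hl using hc l hl

lemma integrableOn_one_sub_cos (h0 : 0 < H) (h1 : H < 1) (t : ℝ) :
    IntegrableOn (fun l : ℝ => (1 - Real.cos (l * t)) * l ^ (-1 - 2 * H)) (Set.Ioi 0) := by
  refine integrableOn_Ioi_of_rpow_bounds (by fun_prop) (A := t ^ 2 / 2) (B := 2)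
    (a := 1 - 2 * H) (b := -1 - 2 * H) (by linarith) (by linarith) ?_ ?_
  · intro l hl
    have e1 := Real.one_sub_sq_div_two_le_cos (x := l * t)
    have e2 := Real.cos_le_one (l * t)
    rw [abs_of_nonneg (mul_nonneg (by linarith) (by positivity))]
    have : l ^ (1 - 2 * H) = l ^ (-1 - 2 * H) * l ^ 2 := by
      rw [← Real.rpow_natCast l 2, ← Real.rpow_add hl]; congr 1; push_cast; ring
    rw [this]
    have h3 : 0 < l ^ (-1 - 2 * H) := by positivity
    have : 1 - Real.cos (l * t) ≤ t ^ 2 / 2 * l ^ 2 := by nlinarith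
    calc _ ≤ t ^ 2 / 2 * l ^ 2 * l ^ (-1 - 2 * H) := mul_le_mul_of_nonneg_right this h3.le
      _ = _ := by ring
  · intro l hl
    have e2 := Real.cos_le_one (l * t)
    have e3 := Real.neg_one_le_cos (l * t)
    rw [abs_of_nonneg (mul_nonneg (by linarith) (by positivity))]
    gcongr
    linarith

lemma integral_exp_mul_one_sub_cos {x : ℝ} (hx : 0 < x) :
    ∫ u in Set.Ioi (0 : ℝ), Real.exp (-(u * x)) * (1 - Real.cos u) = 1 / (x * (1 + x ^ 2)) := by
  -- An explicit antiderivative that vanishes at infinity, with `F 0 = -1 / x + x / (1 + x²) = -1 /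
  -- (x (1 + x²))`.
  set F : ℝ → ℝ := fun u => Real.exp (-(u * x)) *
    (-(1 / x) - (Real.sin u - x * Real.cos u) / (1 + x ^ 2)) with hF
  have hd : ∀ u ∈ Set.Ici (0 : ℝ), HasDerivAt F (Real.exp (-(u * x)) * (1 - Real.cos u)) u := by
    intro u _
    have e1 : HasDerivAt (fun u => Real.exp (-(u * x))) (Real.exp (-(u * x)) * (-x)) u := by
      have := ((hasDerivAt_id u).mul_const x).neg.exp
      simpa using this
    have e2 := (((Real.hasDerivAt_sin u).sub ((Real.hasDerivAt_cos u).const_mul x)).div_const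
      (1 + x ^ 2)).const_sub (-(1 / x))
    refine (e1.mul e2).congr_deriv ?_
    have : 1 + x ^ 2 ≠ 0 := by positivity
    field_simp
    simp only [Pi.sub_apply]
    ring
  have hlim : Tendsto F atTop (𝓝 0) := by
    have h1 : Tendsto (fun u : ℝ => Real.exp (-(u * x))) atTop (𝓝 0) :=
      Real.tendsto_exp_neg_atTop_nhds_zero.comp (tendsto_id.atTop_mul_const hx)
    refine h1.zero_mul_isBoundedUnder_le (isBoundedUnder_of ⟨1 / x + (1 + x) / (1 + x ^ 2), ?_⟩)
    intro u
    simp only [Function.comp_apply, Real.norm_eq_abs]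
    have hp : 0 < 1 + x ^ 2 := by positivity
    refine (abs_sub _ _).trans ?_
    rw [abs_neg, abs_of_pos (by positivity : 0 < 1 / x), abs_div, abs_of_pos hp]
    gcongr
    refine (abs_sub _ _).trans ?_
    rw [abs_mul, abs_of_pos hx]
    have := Real.abs_sin_le_one u
    have := Real.abs_cos_le_one u
    nlinarith
  rw [integral_Ioi_of_hasDerivAt_of_nonneg' hd (fun u _ => mul_nonneg (Real.exp_pos _).le
    (by linarith [Real.cos_le_one u])) hlim]
  have : 1 + x ^ 2 ≠ 0 := by positivity
  simp only [hF]
  simp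
  field_simp
  ring

/-- `Γ(2H+1) ∫ (1 - cos u) u^{-1-2H} du = ∫ u^{1-2H} / (1 + u²) du`. -/
lemma gamma_mul_integral_one_sub_cos (h0 : 0 < H) (h1 : H < 1) :
    Real.Gamma (2 * H + 1) * ∫ u in Set.Ioi (0 : ℝ), (1 - Real.cos u) * u ^ (-1 - 2 * H) =
      ∫ u in Set.Ioi (0 : ℝ), fouSpectral H 1 u := by
  -- `Γ(2H+1) u^{-1-2H}` is the Laplace transform of `x^{2H}`. Inserting this and exchanging the two
  -- integrals of the nonnegative `f` makes the inner one elementary.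
  set f : ℝ → ℝ → ℝ := fun u x => (1 - Real.cos u) * (x ^ (2 * H) * Real.exp (-(u * x))) with hf
  have hin : ∀ u : ℝ, 0 < u → ∫ x in Set.Ioi (0 : ℝ), x ^ (2 * H) * Real.exp (-(u * x)) =
      u ^ (-1 - 2 * H) * Real.Gamma (2 * H + 1) := by
    intro u hu
    have := Real.integral_rpow_mul_exp_neg_mul_Ioi (a := 2 * H + 1) (by linarith) hu
    rw [add_sub_cancel_right] at this
    rw [this, one_div, Real.inv_rpow hu.le, ← Real.rpow_neg hu.le]
    congr 2; ring
  have hin' : ∀ u : ℝ, 0 < u → ∫ x in Set.Ioi (0 : ℝ), f u x =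
      Real.Gamma (2 * H + 1) * ((1 - Real.cos u) * u ^ (-1 - 2 * H)) := by
    intro u hu
    simp only [hf]
    rw [integral_const_mul, hin u hu]; ring
  have hpos : ∀ u x : ℝ, 0 < x → 0 ≤ f u x := fun u x hx =>
    mul_nonneg (by linarith [Real.cos_le_one u]) (mul_nonneg (by positivity) (Real.exp_pos _).le)
  have hi0 : ∀ u : ℝ, 0 < u → Integrable (fun x : ℝ => x ^ (2 * H) * Real.exp (-(u * x)))
      (volume.restrict (Set.Ioi 0)) := fun u hu => by
    -- The integral of a nonintegrable function is `0` by convention, so the known positive value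
    -- proves integrability.
    refine .of_integral_ne_zero ?_
    rw [hin u hu]
    have : 0 < Real.Gamma (2 * H + 1) := Real.Gamma_pos_of_pos (by linarith)
    positivity
  have hint : Integrable (Function.uncurry f)
      ((volume.restrict (Set.Ioi 0)).prod (volume.restrict (Set.Ioi 0))) := by
    have hm : Measurable (Function.uncurry f) := by
      simp only [hf, Function.uncurry_def]; fun_prop
    rw [integrable_prod_iff hm.aestronglyMeasurable]
    constructor
    · filter_upwards [ae_restrict_mem measurableSet_Ioi] with u hu
      exact (hi0 u hu).const_mul (1 - Real.cos u)
    · refine ((integrableOn_one_sub_cos h0 h1 1).const_mul (Real.Gamma (2 * H + 1))).congr ?_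
      filter_upwards [ae_restrict_mem measurableSet_Ioi] with u hu
      rw [mul_one, ← hin' u hu]
      refine setIntegral_congr_fun measurableSet_Ioi fun x hx => ?_
      simp only [Function.uncurry, Real.norm_eq_abs]
      rw [abs_of_nonneg (hpos u x hx)]
  have hswap := integral_integral_swap hint
  have e1 : ∫ u in Set.Ioi (0 : ℝ), ∫ x in Set.Ioi (0 : ℝ), f u x =
      Real.Gamma (2 * H + 1) * ∫ u in Set.Ioi (0 : ℝ), (1 - Real.cos u) * u ^ (-1 - 2 * H) := by
    rw [← integral_const_mul]
    exact setIntegral_congr_fun measurableSet_Ioi fun u hu => hin' u hu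
  have e2 : ∫ x in Set.Ioi (0 : ℝ), ∫ u in Set.Ioi (0 : ℝ), f u x =
      ∫ x in Set.Ioi (0 : ℝ), x ^ (2 * H) * (1 / (x * (1 + x ^ 2))) := by
    refine setIntegral_congr_fun measurableSet_Ioi fun x hx => ?_
    rw [← integral_exp_mul_one_sub_cos hx, ← integral_const_mul]
    refine setIntegral_congr_fun measurableSet_Ioi fun u _ => ?_
    simp only [hf]; ring
  -- The substitution `x ↦ 1 / x` turns `x^{2H-1} / (1 + x²)` into the spectral density with `θ =
  -- 1`.
  rw [← e1, hswap, e2, ← integral_comp_rpow_Ioi _ (show (-1 : ℝ) ≠ 0 by norm_num)]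
  refine setIntegral_congr_fun measurableSet_Ioi fun x hx => ?_
  have hx : 0 < x := hx
  simp only [smul_eq_mul, fouSpectral, abs_neg, abs_one, one_mul, Real.rpow_neg_one, one_pow]
  rw [Real.inv_rpow hx.le, ← Real.rpow_neg hx.le]
  have e3 : x ^ (1 - 2 * H) = x * x ^ (-(2 * H)) := by
    rw [sub_eq_add_neg, Real.rpow_add hx, Real.rpow_one]
  have e4 : x ^ (-1 - 1 : ℝ) = (x ^ 2)⁻¹ := by
    rw [show (-1 - 1 : ℝ) = -(2 : ℕ) by norm_num, Real.rpow_neg hx.le, Real.rpow_natCast]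
  rw [e3, e4]
  field_simp
  ring

lemma integral_fouSpectral_pos (h0 : 0 < H) (h1 : H < 1) {θ : ℝ} (hθ : 0 < θ) :
    0 < ∫ l in Set.Ioi (0 : ℝ), fouSpectral H θ l := by
  rw [setIntegral_pos_iff_support_of_nonneg_ae _ (integrableOn_fouSpectral h0 h1 hθ)]
  · refine lt_of_lt_of_le ?_ (measure_mono (show Set.Ioi (0 : ℝ) ⊆
      Function.support (fouSpectral H θ) ∩ Set.Ioi 0 from
      fun l hl => ⟨(fouSpectral_pos hl).ne', hl⟩))
    simp
  · filter_upwards [ae_restrict_mem measurableSet_Ioi] with l hl using (fouSpectral_pos hl).le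

lemma integral_fouSpectral_scale {θ : ℝ} (hθ : 0 < θ) :
    θ ^ (2 * H) * ∫ l in Set.Ioi (0 : ℝ), fouSpectral H θ l =
      ∫ u in Set.Ioi (0 : ℝ), fouSpectral H 1 u := by
  have := integral_comp_mul_left_Ioi' (fouSpectral H θ) 0 hθ
  rw [mul_zero] at this
  rw [← this, smul_eq_mul, ← integral_const_mul, ← integral_const_mul]
  refine setIntegral_congr_fun measurableSet_Ioi fun x hx => ?_
  have hx : 0 < x := hx
  simp only [fouSpectral]
  rw [Real.mul_rpow hθ.le hx.le, Real.rpow_sub hθ, Real.rpow_one, mul_pow, one_pow]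
  have : θ ^ (2 * H) ≠ 0 := by positivity
  have : θ ^ 2 + θ ^ 2 * x ^ 2 ≠ 0 := by positivity
  field_simp

lemma integral_one_sub_cos_scale (h0 : 0 < H) {t : ℝ} (ht : 0 ≤ t) :
    ∫ l in Set.Ioi (0 : ℝ), (1 - Real.cos (l * t)) * l ^ (-1 - 2 * H) =
      t ^ (2 * H) * ∫ u in Set.Ioi (0 : ℝ), (1 - Real.cos u) * u ^ (-1 - 2 * H) := by
  rcases ht.eq_or_lt with rfl | ht
  · simp [Real.zero_rpow (by linarith : 2 * H ≠ 0)]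
  · have := integral_comp_mul_left_Ioi' (fun u => (1 - Real.cos u) * u ^ (-1 - 2 * H)) 0 ht
    rw [mul_zero] at this
    rw [← this, smul_eq_mul, ← integral_const_mul, ← integral_const_mul]
    refine setIntegral_congr_fun measurableSet_Ioi fun x hx => ?_
    have hx : 0 < x := hx
    have e : t ^ (2 * H) * (t * (t ^ (-1 - 2 * H))) = 1 := by
      rw [← Real.rpow_one_add' ht.le (by linarith), ← Real.rpow_add ht]
      ring_nf; simp
    rw [Real.mul_rpow ht.le hx.le, mul_comm x t]
    linear_combination (1 - Real.cos (t * x)) * x ^ (-1 - 2 * H) * (-e)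

/-! ### The spectral covariance as the bounded solution of the variance equation -/

/-- The spectral covariance. -/
def spectralCov (H θ σ t : ℝ) : ℝ :=
  2 * fouZeta H θ σ * ∫ l in Set.Ioi (0 : ℝ), Real.cos (l * t) * fouSpectral H θ l

lemma integral_swap_fouSpectral (h0 : 0 < H) (h1 : H < 1) {θ : ℝ} (hθ : 0 < θ) {k : ℝ → ℝ → ℝ}
    (hk : Measurable (Function.uncurry k)) {c : ℝ} {t : ℝ} (ht : 0 ≤ t)
    (hc : ∀ s ∈ Set.Ioc 0 t, ∀ l, 0 < l → |k s l| ≤ c) :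
    ∫ s in (0 : ℝ)..t, ∫ l in Set.Ioi (0 : ℝ), k s l * fouSpectral H θ l =
      ∫ l in Set.Ioi (0 : ℝ), (∫ s in (0 : ℝ)..t, k s l) * fouSpectral H θ l := by
  rw [intervalIntegral_integral_swap]
  · simp only [intervalIntegral.integral_mul_const]
  · rw [Set.uIoc_of_le ht]
    have hi : Integrable (fun z : ℝ × ℝ => fouSpectral H θ z.2)
        ((volume.restrict (Set.Ioc 0 t)).prod (volume.restrict (Set.Ioi 0))) :=
      (integrableOn_fouSpectral h0 h1 hθ).comp_snd _
    have : Integrable (fun z : ℝ × ℝ => Function.uncurry k z * fouSpectral H θ z.2)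
        ((volume.restrict (Set.Ioc 0 t)).prod (volume.restrict (Set.Ioi 0))) := by
      refine hi.bdd_mul hk.aestronglyMeasurable (c := c) ?_
      rw [Measure.prod_restrict]
      filter_upwards [ae_restrict_mem (measurableSet_Ioc.prod measurableSet_Ioi)] with z hz
      exact hc z.1 hz.1 z.2 hz.2
    exact this

lemma integral_cos_mul (l s : ℝ) (hl : l ≠ 0) :
    ∫ u in (0 : ℝ)..s, Real.cos (l * u) = Real.sin (l * s) / l := by
  rw [intervalIntegral.integral_comp_mul_left (fun u => Real.cos u) hl]
  simp [div_eq_inv_mul]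

lemma integral_sin_mul_div (l t : ℝ) (hl : l ≠ 0) :
    ∫ s in (0 : ℝ)..t, Real.sin (l * s) / l = (1 - Real.cos (l * t)) / l ^ 2 := by
  rw [intervalIntegral.integral_div,
    intervalIntegral.integral_comp_mul_left (fun u => Real.sin u) hl]
  simp
  field_simp

/-- The variance equation satisfied by the spectral covariance. -/
lemma spectralCov_equation (h0 : 0 < H) (h1 : H < 1) {θ : ℝ} (hθ : 0 < θ) (σ : ℝ) {t : ℝ}
    (ht : 0 ≤ t) : σ ^ 2 * t ^ (2 * H) = 2 * (spectralCov H θ σ 0 - spectralCov H θ σ t) +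
      2 * θ ^ 2 * ∫ s in (0 : ℝ)..t, ∫ u in (0 : ℝ)..s, spectralCov H θ σ u := by
  set c := 2 * fouZeta H θ σ with hc
  have e1 : ∀ s, 0 ≤ s → ∫ u in (0 : ℝ)..s, spectralCov H θ σ u =
      c * ∫ l in Set.Ioi (0 : ℝ), (Real.sin (l * s) / l) * fouSpectral H θ l := by
    intro s hs
    simp only [spectralCov]
    rw [intervalIntegral.integral_const_mul, integral_swap_fouSpectral h0 h1 hθ
      (k := fun u l => Real.cos (l * u)) (c := 1) (by simp only [Function.uncurry_def]; fun_prop) hs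
      fun u _ l _ => Real.abs_cos_le_one _]
    congr 1
    refine setIntegral_congr_fun measurableSet_Ioi fun l hl => ?_
    rw [integral_cos_mul l s (ne_of_gt hl)]
  have e2 : ∫ s in (0 : ℝ)..t, ∫ u in (0 : ℝ)..s, spectralCov H θ σ u =
      c * ∫ l in Set.Ioi (0 : ℝ), ((1 - Real.cos (l * t)) / l ^ 2) * fouSpectral H θ l := by
    rw [intervalIntegral.integral_congr (g := fun s => c * ∫ l in Set.Ioi (0 : ℝ),
      (Real.sin (l * s) / l) * fouSpectral H θ l) (fun s hs => by
        rw [Set.uIcc_of_le ht] at hs; exact e1 s hs.1)]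
    rw [intervalIntegral.integral_const_mul, integral_swap_fouSpectral h0 h1 hθ
      (k := fun s l => Real.sin (l * s) / l) (c := t)
      (by simp only [Function.uncurry_def]; fun_prop) ht]
    · congr 1
      refine setIntegral_congr_fun measurableSet_Ioi fun l hl => ?_
      rw [integral_sin_mul_div l t (ne_of_gt hl)]
    · intro s hs l hl
      rw [abs_div, abs_of_pos hl, div_le_iff₀ hl]
      refine (Real.abs_sin_le_abs).trans ?_
      rw [abs_mul, abs_of_pos hl, abs_of_pos hs.1, mul_comm]
      exact mul_le_mul_of_nonneg_right hs.2 hl.le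
  have hcosI : ∀ t : ℝ, IntegrableOn (fun l => Real.cos (l * t) * fouSpectral H θ l) (Set.Ioi 0) :=
    fun t => integrableOn_mul_fouSpectral h0 h1 hθ (by fun_prop) fun l _ => Real.abs_cos_le_one _
  have hdivI : IntegrableOn (fun l => ((1 - Real.cos (l * t)) / l ^ 2) * fouSpectral H θ l)
      (Set.Ioi 0) := by
    refine integrableOn_mul_fouSpectral h0 h1 hθ (by fun_prop) (c := t ^ 2 / 2) fun l hl => ?_
    have e1 := Real.one_sub_sq_div_two_le_cos (x := l * t)
    have e2 := Real.cos_le_one (l * t)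
    rw [abs_of_nonneg (div_nonneg (by linarith) (by positivity)), div_le_iff₀ (by positivity)]
    nlinarith
  -- The two integrands combine with the factor `1 + θ² / l²`, which cancels the denominator `θ² +
  -- l²` and leaves the kernel of fractional Brownian motion. The value of `fouZeta` is what makes
  -- the resulting constant equal to `σ²`.
  have e3 : 2 * (spectralCov H θ σ 0 - spectralCov H θ σ t) +
      2 * θ ^ 2 * ∫ s in (0 : ℝ)..t, ∫ u in (0 : ℝ)..s, spectralCov H θ σ u =
      2 * c * ∫ l in Set.Ioi (0 : ℝ), (1 - Real.cos (l * t)) * l ^ (-1 - 2 * H) := by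
    rw [e2, spectralCov, spectralCov, ← hc, ← mul_sub, ← integral_sub (hcosI 0) (hcosI t)]
    have : ∀ A B C : ℝ, A + θ ^ 2 * B = C → 2 * (c * A) + 2 * θ ^ 2 * (c * B) = 2 * c * C := by
      intro A B C h; rw [← h]; ring
    apply this
    rw [← integral_const_mul, ← integral_add (f := fun l => Real.cos (l * 0) *
      fouSpectral H θ l - Real.cos (l * t) * fouSpectral H θ l) ((hcosI 0).sub (hcosI t))
      (hdivI.const_mul _)]
    refine setIntegral_congr_fun measurableSet_Ioi fun l hl => ?_
    have hl : 0 < l := hl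
    simp only [mul_zero, Real.cos_zero, fouSpectral]
    have : l ^ (1 - 2 * H) = l ^ (-1 - 2 * H) * l ^ 2 := by
      rw [← Real.rpow_natCast l 2, ← Real.rpow_add hl]; congr 1; push_cast; ring
    rw [this]
    have : θ ^ 2 + l ^ 2 ≠ 0 := by positivity
    field_simp
    ring
  rw [e3, integral_one_sub_cos_scale h0 ht]
  have hJ := integral_fouSpectral_pos h0 h1 hθ
  have hs := integral_fouSpectral_scale (H := H) hθ
  have hG := gamma_mul_integral_one_sub_cos h0 h1
  have hp : 0 < θ ^ (2 * H) := by positivity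
  rw [hc, fouZeta]
  set J := ∫ l in Set.Ioi (0 : ℝ), fouSpectral H θ l
  rw [← hs] at hG
  set I := ∫ u in Set.Ioi (0 : ℝ), (1 - Real.cos u) * u ^ (-1 - 2 * H)
  have hJ' := hJ.ne'
  field_simp
  linear_combination (-σ ^ 2 * t ^ (2 * H)) * hG

/-- Bounded solutions of the variance equation are unique. -/
lemma eq_zero_of_bounded_of_integral_eq {D : ℝ → ℝ} (hD : Continuous D) {M θ : ℝ} (hθ : 0 < θ)
    (hM : ∀ t, 0 ≤ t → |D t| ≤ M)
    (heq : ∀ t, 0 ≤ t → D t = D 0 + θ ^ 2 * ∫ s in (0 : ℝ)..t, ∫ u in (0 : ℝ)..s, D u) {t : ℝ}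
    (ht : 0 ≤ t) : D t = 0 := by
  set J : ℝ → ℝ := fun s => ∫ u in (0 : ℝ)..s, D u with hJ
  set E : ℝ → ℝ := fun t => D 0 + θ ^ 2 * ∫ s in (0 : ℝ)..t, J s with hE
  have dJ : ∀ s, HasDerivAt J (D s) s := fun s =>
    intervalIntegral.integral_hasDerivAt_right (hD.intervalIntegrable _ _)
      (hD.stronglyMeasurableAtFilter _ _) hD.continuousAt
  have cJ : Continuous J := continuous_iff_continuousAt.2 fun s => (dJ s).continuousAt
  have dE : ∀ s, HasDerivAt E (θ ^ 2 * J s) s := fun s =>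
    ((intervalIntegral.integral_hasDerivAt_right (cJ.intervalIntegrable _ _)
      (cJ.stronglyMeasurableAtFilter _ _) cJ.continuousAt).const_mul _).const_add _
  have cE : Continuous E := continuous_iff_continuousAt.2 fun s => (dE s).continuousAt
  -- On `t ≥ 0` the function solves `D'' = θ² D` with `D'(0) = 0`, and `θ² J` is its derivative, so
  -- `exp (-c t) (D' + c D)` is constant for `c = ±θ`. Combining both signs gives `D t = D 0 cosh (θ
  -- t)`. `E` replaces `D` because it is differentiable on the whole line.
  have key : ∀ c : ℝ, c ^ 2 = θ ^ 2 → ∀ t, 0 ≤ t →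
      Real.exp (-(c * t)) * (θ ^ 2 * J t + c * E t) = c * D 0 := by
    intro c hc t ht
    have hd : ∀ x ∈ Set.Ico 0 t, HasDerivWithinAt
        (fun t => Real.exp (-(c * t)) * (θ ^ 2 * J t + c * E t)) 0 (Set.Ici x) x := by
      intro x hx
      have e1 : HasDerivAt (fun u => Real.exp (-(c * u))) (Real.exp (-(c * x)) * (-c)) x := by
        have := ((hasDerivAt_id x).const_mul c).neg.exp
        simpa using this
      have e2 := e1.mul (((dJ x).const_mul (θ ^ 2)).add ((dE x).const_mul c))
      refine (e2.congr_deriv ?_).hasDerivWithinAt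
      have e3 : D x = E x := heq x hx.1
      simp only [Pi.add_apply]
      rw [e3]
      linear_combination (-Real.exp (-(c * x)) * E x) * hc
    have := constant_of_has_deriv_right_zero (a := 0) (b := t) (by fun_prop) hd t ⟨ht, le_rfl⟩
    rw [this]
    simp [hE, hJ]
  have hcosh : ∀ t, 0 ≤ t → 2 * D t = D 0 * (Real.exp (θ * t) + Real.exp (-(θ * t))) := by
    intro t ht
    have k1 := key θ rfl t ht
    have k2 := key (-θ) (by ring) t ht
    have e3 : D t = E t := heq t ht
    have m1 : Real.exp (θ * t) * Real.exp (-(θ * t)) = 1 := by rw [← Real.exp_add]; simp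
    have n2 : -(-θ * t) = θ * t := by ring
    rw [n2] at k2
    rw [e3]
    have : θ * (2 * E t) = θ * (D 0 * (Real.exp (θ * t) + Real.exp (-(θ * t)))) := by
      linear_combination Real.exp (θ * t) * k1 - Real.exp (-(θ * t)) * k2 - 2 * θ * E t * m1
    exact mul_left_cancel₀ hθ.ne' this
  have hD0 : D 0 = 0 := by
    by_contra hne
    have hlim : Tendsto (fun t => |D 0| * Real.exp (θ * t)) atTop atTop :=
      (Real.tendsto_exp_atTop.comp (tendsto_id.const_mul_atTop hθ)).const_mul_atTop (abs_pos.2 hne)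
    obtain ⟨t, ht1, ht2⟩ := ((hlim.eventually_gt_atTop (2 * M)).and (eventually_ge_atTop 0)).exists
    have := hcosh t ht2
    have hle := hM t ht2
    have : 2 * |D t| = |D 0| * (Real.exp (θ * t) + Real.exp (-(θ * t))) := by
      rw [← abs_of_pos (add_pos (Real.exp_pos (θ * t)) (Real.exp_pos (-(θ * t)))), ← abs_mul, ← this,
        abs_mul, abs_two]
    have := mul_pos (abs_pos.2 hne) (Real.exp_pos (-(θ * t)))
    linarith
  have := hcosh t ht
  rw [hD0] at this
  linarith

lemma abs_spectralCov_le (h0 : 0 < H) (h1 : H < 1) {θ : ℝ} (hθ : 0 < θ) (σ t : ℝ) :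
    |spectralCov H θ σ t| ≤ |2 * fouZeta H θ σ| * ∫ l in Set.Ioi (0 : ℝ), fouSpectral H θ l := by
  rw [spectralCov, abs_mul]
  refine mul_le_mul_of_nonneg_left ?_ (abs_nonneg _)
  refine norm_integral_le_of_norm_le (f := fun l => Real.cos (l * t) * fouSpectral H θ l)
    (integrableOn_fouSpectral h0 h1 hθ) ?_
  filter_upwards [ae_restrict_mem measurableSet_Ioi] with l hl
  rw [norm_mul, Real.norm_eq_abs, Real.norm_eq_abs, abs_of_pos (fouSpectral_pos hl)]
  exact mul_le_of_le_one_left (fouSpectral_pos hl).le (Real.abs_cos_le_one _)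

lemma continuous_spectralCov (h0 : 0 < H) (h1 : H < 1) {θ : ℝ} (hθ : 0 < θ) (σ : ℝ) :
    Continuous (spectralCov H θ σ) := by
  unfold spectralCov
  refine continuous_const.mul ?_
  refine continuous_of_dominated (bound := fouSpectral H θ) (fun t => ?_) (fun t => ?_)
    (integrableOn_fouSpectral h0 h1 hθ) ?_
  · exact ((by fun_prop : Measurable fun l => Real.cos (l * t)).mul
      (measurable_fouSpectral θ)).aestronglyMeasurable
  · filter_upwards [ae_restrict_mem measurableSet_Ioi] with l hl
    rw [norm_mul, Real.norm_eq_abs, Real.norm_eq_abs, abs_of_pos (fouSpectral_pos hl)]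
    exact mul_le_of_le_one_left (fouSpectral_pos hl).le (Real.abs_cos_le_one _)
  · exact Eventually.of_forall fun l => by fun_prop

/-- A bounded continuous solution of the variance equation is the spectral covariance. -/
lemma variance_eq_spectral (h0 : 0 < H) (h1 : H < 1) {θ : ℝ} (hθ : 0 < θ) (σ : ℝ) {R : ℝ → ℝ}
    (hR : Continuous R) {M : ℝ} (hM : ∀ t, 0 ≤ t → |R t| ≤ M)
    (heq : ∀ t, 0 ≤ t → σ ^ 2 * t ^ (2 * H) = 2 * (R 0 - R t) +
      2 * θ ^ 2 * ∫ s in (0 : ℝ)..t, ∫ u in (0 : ℝ)..s, R u) {t : ℝ} (ht : 0 ≤ t) :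
    R 0 - R t = 2 * fouZeta H θ σ *
      ∫ l in Set.Ioi (0 : ℝ), (1 - Real.cos (l * t)) * fouSpectral H θ l := by
  set ρ := spectralCov H θ σ with hρ
  have hρc : Continuous ρ := continuous_spectralCov h0 h1 hθ σ
  have hz : ∀ t, 0 ≤ t → R t - ρ t = 0 := by
    intro t ht
    refine eq_zero_of_bounded_of_integral_eq (D := fun t => R t - ρ t) (hR.sub hρc) hθ
      (M := M + |2 * fouZeta H θ σ| * ∫ l in Set.Ioi (0 : ℝ), fouSpectral H θ l) ?_ ?_ ht
    · intro t ht
      exact (abs_sub _ _).trans (add_le_add (hM t ht) (abs_spectralCov_le h0 h1 hθ σ t))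
    · intro t ht
      have a1 := heq t ht
      have a2 := spectralCov_equation h0 h1 hθ σ ht
      have cJ : ∀ {f : ℝ → ℝ}, Continuous f → Continuous fun s => ∫ u in (0 : ℝ)..s, f u :=
        fun {f} hf => intervalIntegral.continuous_primitive (fun a b => hf.intervalIntegrable a b) 0
      have a3 : ∫ s in (0 : ℝ)..t, ∫ u in (0 : ℝ)..s, (R u - ρ u) =
          (∫ s in (0 : ℝ)..t, ∫ u in (0 : ℝ)..s, R u) -
          ∫ s in (0 : ℝ)..t, ∫ u in (0 : ℝ)..s, ρ u := by
        rw [← intervalIntegral.integral_sub ((cJ hR).intervalIntegrable _ _)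
          ((cJ hρc).intervalIntegrable _ _)]
        refine intervalIntegral.integral_congr fun s _ => ?_
        exact intervalIntegral.integral_sub (hR.intervalIntegrable _ _) (hρc.intervalIntegrable _ _)
      rw [a3]
      rw [← hρ] at a2
      linear_combination (a1 - a2) / 2
  have hcosI : ∀ t : ℝ, IntegrableOn (fun l => Real.cos (l * t) * fouSpectral H θ l) (Set.Ioi 0) :=
    fun t => integrableOn_mul_fouSpectral h0 h1 hθ (by fun_prop) fun l _ => Real.abs_cos_le_one _
  have : R 0 - R t = ρ 0 - ρ t := by linarith [hz 0 le_rfl, hz t ht]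
  rw [this, hρ, spectralCov, spectralCov, ← mul_sub, ← integral_sub (hcosI 0) (hcosI t)]
  congr 1
  refine setIntegral_congr_fun measurableSet_Ioi fun l _ => ?_
  simp only [mul_zero, Real.cos_zero]
  ring

end

end

noncomputable section

/-! ### Regularity of the variance function -/

/-- For `C` with `C α ≥ C₁` and `C α (1 - α) ≥ C₂`, both functions `C t ^ α ± V` are nondecreasing
and both `-C t ^ α ± V` are convex; the two signs give the absolute values. -/
lemma isRoughVariance_of_deriv_bounds {V V' V'' : ℝ → ℝ} {T α C₁ C₂ : ℝ} (h0 : 0 < α) (h1 : α < 1)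
    (hV : Continuous V) (hd : ∀ t ∈ Set.Ioo 0 T, HasDerivAt V (V' t) t)
    (hd' : ∀ t ∈ Set.Ioo 0 T, HasDerivAt V' (V'' t) t) (hC₁ : 0 ≤ C₁) (hC₂ : 0 ≤ C₂)
    (hb : ∀ t ∈ Set.Ioo 0 T, |V' t| ≤ C₁ * t ^ (α - 1))
    (hb' : ∀ t ∈ Set.Ioo 0 T, |V'' t| ≤ C₂ * t ^ (α - 2)) :
    ∃ C, 0 ≤ C ∧ IsRoughVariance V T α C := by
  have hα1 : 0 < 1 - α := by linarith
  set C := C₁ / α + C₂ / (α * (1 - α)) with hC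
  have hCα : C₁ ≤ C * α := by
    rw [hC, add_mul, div_mul_cancel₀ _ h0.ne']
    have : 0 ≤ C₂ / (α * (1 - α)) * α := by positivity
    linarith
  have hCα' : C₂ ≤ C * (α * (1 - α)) := by
    rw [hC, add_mul, div_mul_cancel₀ _ (by positivity)]
    have : 0 ≤ C₁ / α * (α * (1 - α)) := by positivity
    linarith
  have hφ : Continuous fun t : ℝ => t ^ α := Real.continuous_rpow_const h0.le
  have dφ : ∀ t ∈ Set.Ioo 0 T, HasDerivAt (fun t : ℝ => t ^ α) (α * t ^ (α - 1)) t :=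
    fun t ht => Real.hasDerivAt_rpow_const (Or.inl ht.1.ne')
  have dφ' : ∀ t ∈ Set.Ioo 0 T, HasDerivAt (fun t : ℝ => α * t ^ (α - 1))
      (-(α * (1 - α)) * t ^ (α - 2)) t := fun t ht => by
    refine ((Real.hasDerivAt_rpow_const (p := α - 1) (Or.inl ht.1.ne')).const_mul α).congr_deriv ?_
    rw [show α - 1 - 1 = α - 2 by ring]; ring
  have hmono : ∀ ε : ℝ, |ε| ≤ 1 → MonotoneOn (fun t => C * t ^ α + ε * V t) (Set.Icc 0 T) := by
    intro ε hε
    refine monotoneOn_of_hasDerivWithinAt_nonneg (f' := fun t => C * (α * t ^ (α - 1)) + ε * V' t)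
      (convex_Icc 0 T) (by fun_prop) (fun t ht => ?_) fun t ht => ?_
    · rw [interior_Icc] at ht
      exact (((dφ t ht).const_mul C).add ((hd t ht).const_mul ε)).hasDerivWithinAt
    · rw [interior_Icc] at ht
      have p : 0 < t ^ (α - 1) := Real.rpow_pos_of_pos ht.1 _
      have e1 : |ε * V' t| ≤ C * α * t ^ (α - 1) := by
        rw [abs_mul]
        calc |ε| * |V' t| ≤ 1 * (C₁ * t ^ (α - 1)) := by
              gcongr
              exact hb t ht
          _ ≤ _ := by rw [one_mul]; gcongr
      linarith [(abs_le.1 e1).1]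
  have hconv : ∀ ε : ℝ, |ε| ≤ 1 → ConvexOn ℝ (Set.Icc 0 T) (fun t => -C * t ^ α + ε * V t) := by
    intro ε hε
    refine convexOn_of_hasDerivWithinAt2_nonneg (f' := fun t => -C * (α * t ^ (α - 1)) + ε * V' t)
      (f'' := fun t => -C * (-(α * (1 - α)) * t ^ (α - 2)) + ε * V'' t)
      (convex_Icc 0 T) (by fun_prop) (fun t ht => ?_) (fun t ht => ?_) fun t ht => ?_
    · rw [interior_Icc] at ht
      exact (((dφ t ht).const_mul (-C)).add ((hd t ht).const_mul ε)).hasDerivWithinAt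
    · rw [interior_Icc] at ht
      exact (((dφ' t ht).const_mul (-C)).add ((hd' t ht).const_mul ε)).hasDerivWithinAt
    · rw [interior_Icc] at ht
      have p : 0 < t ^ (α - 2) := Real.rpow_pos_of_pos ht.1 _
      have e1 : |ε * V'' t| ≤ C * (α * (1 - α)) * t ^ (α - 2) := by
        rw [abs_mul]
        calc |ε| * |V'' t| ≤ 1 * (C₂ * t ^ (α - 2)) := by
              gcongr
              exact hb' t ht
          _ ≤ _ := by rw [one_mul]; gcongr
      linarith [(abs_le.1 e1).1]
  refine ⟨C, by positivity, ⟨fun a b ha hab hb => ?_, fun x a b hx ha hb hT => ?_⟩⟩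
  · have i1 : a ∈ Set.Icc 0 T := ⟨ha, hab.trans hb⟩
    have i2 : b ∈ Set.Icc 0 T := ⟨ha.trans hab, hb⟩
    have m1 := hmono 1 (by simp) i1 i2 hab
    have m2 := hmono (-1) (by simp) i1 i2 hab
    simp only at m1 m2
    rw [abs_le]; constructor <;> linarith
  · have i1 : x ∈ Set.Icc 0 T := ⟨hx, by linarith⟩
    have i2 : x + a + b ∈ Set.Icc 0 T := ⟨by linarith, hT⟩
    have m1 := (hconv 1 (by simp)).second_diff_nonneg ha hb i1 i2
    have m2 := (hconv (-1) (by simp)).second_diff_nonneg ha hb i1 i2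
    rw [abs_le]; constructor <;> linarith

lemma rpow_le_mul_rpow {t T a b : ℝ} (ht : 0 < t) (htT : t ≤ T) (hab : a ≤ b) :
    t ^ b ≤ T ^ (b - a) * t ^ a := by
  have : t ^ b = t ^ (b - a) * t ^ a := by rw [← Real.rpow_add ht]; congr 1; ring
  rw [this]
  gcongr

/-- The variance function of a stationary solution has rough increments of order `α ≤ 2H`. -/
lemma isRoughVariance_of_equation {H θ σ M T α : ℝ} {R : ℝ → ℝ} (hH : 0 < H) (h0 : 0 < α)
    (h1 : α < 1) (hα : α ≤ 2 * H) (hT : 0 < T) (hR : Continuous R) (hM : ∀ t, 0 ≤ t → |R t| ≤ M)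
    (heq : ∀ t, 0 ≤ t → σ ^ 2 * t ^ (2 * H) = 2 * (R 0 - R t) +
      2 * θ ^ 2 * ∫ s in (0 : ℝ)..t, ∫ u in (0 : ℝ)..s, R u) :
    ∃ C, 0 ≤ C ∧ IsRoughVariance (fun t => R 0 - R t) T α C := by
  have hM0 : 0 ≤ M := (abs_nonneg _).trans (hM 0 le_rfl)
  set J : ℝ → ℝ := fun s => ∫ u in (0 : ℝ)..s, R u with hJ
  have dJ : ∀ s, HasDerivAt J (R s) s := fun s =>
    intervalIntegral.integral_hasDerivAt_right (hR.intervalIntegrable _ _)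
      (hR.stronglyMeasurableAtFilter _ _) hR.continuousAt
  have cJ : Continuous J := continuous_iff_continuousAt.2 fun s => (dJ s).continuousAt
  have dJJ : ∀ s, HasDerivAt (fun t => ∫ s in (0 : ℝ)..t, J s) (J s) s := fun s =>
    intervalIntegral.integral_hasDerivAt_right (cJ.intervalIntegrable _ _)
      (cJ.stronglyMeasurableAtFilter _ _) cJ.continuousAt
  have cJJ : Continuous (fun t => ∫ s in (0 : ℝ)..t, J s) :=
    continuous_iff_continuousAt.2 fun s => (dJJ s).continuousAt
  have bJ : ∀ t, 0 ≤ t → |J t| ≤ M * t := by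
    intro t ht
    have := intervalIntegral.norm_integral_le_of_norm_le_const (a := 0) (b := t) (C := M) (f := R)
      fun x hx => by rw [Set.uIoc_of_le ht] at hx; exact hM x hx.1.le
    simpa [abs_of_nonneg ht] using this
  -- The variance equation solved for `R 0 - R t`. The only singularity at `0` is that of `t ^
  -- (2H)`; since `α ≤ 2H`, on a bounded interval every term is dominated by the derivatives of `t ^
  -- α`.
  set V : ℝ → ℝ := fun t => σ ^ 2 / 2 * t ^ (2 * H) - θ ^ 2 * ∫ s in (0 : ℝ)..t, J s with hV
  have hVR : ∀ t, 0 ≤ t → V t = R 0 - R t := fun t ht => by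
    have := heq t ht
    simp only [hV]; linarith
  obtain ⟨C, hC, hCV⟩ : ∃ C, 0 ≤ C ∧ IsRoughVariance V T α C := by
    refine isRoughVariance_of_deriv_bounds (V := V) (T := T) (α := α)
      (V' := fun t => σ ^ 2 / 2 * (2 * H * t ^ (2 * H - 1)) - θ ^ 2 * J t)
      (V'' := fun t => σ ^ 2 / 2 * (2 * H * ((2 * H - 1) * t ^ (2 * H - 2))) - θ ^ 2 * R t)
      (C₁ := σ ^ 2 / 2 * (2 * H * T ^ (2 * H - α)) + θ ^ 2 * (M * T ^ (2 - α)))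
      (C₂ := σ ^ 2 / 2 * (2 * H * (|2 * H - 1| * T ^ (2 * H - α))) + θ ^ 2 * (M * T ^ (2 - α)))
      h0 h1 (by
      have : Continuous fun t : ℝ => t ^ (2 * H) := Real.continuous_rpow_const (by linarith)
      fun_prop)
      (fun t ht => ((Real.hasDerivAt_rpow_const (Or.inl ht.1.ne')).const_mul _).sub
      ((dJJ t).const_mul _))
      (fun t ht => by
      have := ((((Real.hasDerivAt_rpow_const (p := 2 * H - 1) (Or.inl ht.1.ne')).const_mul
        (2 * H)).const_mul (σ ^ 2 / 2))).sub ((dJ t).const_mul (θ ^ 2))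
      rw [show 2 * H - 1 - 1 = 2 * H - 2 by ring] at this
      exact this)
      (by positivity) (by positivity) ?_ ?_
    · rintro t ⟨ht, htT⟩
      have p1 : t ^ (2 * H - 1) ≤ T ^ (2 * H - α) * t ^ (α - 1) := by
        have := rpow_le_mul_rpow ht htT.le (show α - 1 ≤ 2 * H - 1 by linarith)
        rwa [show 2 * H - 1 - (α - 1) = 2 * H - α by ring] at this
      have p2 : t ≤ T ^ (2 - α) * t ^ (α - 1) := by
        have := rpow_le_mul_rpow ht htT.le (show α - 1 ≤ 1 by linarith)
        rwa [show 1 - (α - 1) = 2 - α by ring, Real.rpow_one] at this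
      refine (abs_sub _ _).trans ?_
      rw [abs_mul, abs_mul (θ ^ 2), abs_of_pos (by positivity : 0 < 2 * H * t ^ (2 * H - 1)),
        abs_of_nonneg (by positivity : 0 ≤ σ ^ 2 / 2), abs_of_nonneg (sq_nonneg θ), add_mul]
      have q := bJ t ht.le
      calc _ ≤ σ ^ 2 / 2 * (2 * H * (T ^ (2 * H - α) * t ^ (α - 1))) +
            θ ^ 2 * (M * (T ^ (2 - α) * t ^ (α - 1))) := by
            gcongr
            exact q.trans (by gcongr)
        _ = _ := by ring
    · rintro t ⟨ht, htT⟩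
      have p1 : t ^ (2 * H - 2) ≤ T ^ (2 * H - α) * t ^ (α - 2) := by
        have := rpow_le_mul_rpow ht htT.le (show α - 2 ≤ 2 * H - 2 by linarith)
        rwa [show 2 * H - 2 - (α - 2) = 2 * H - α by ring] at this
      have p2 : 1 ≤ T ^ (2 - α) * t ^ (α - 2) := by
        have := rpow_le_mul_rpow ht htT.le (show α - 2 ≤ 0 by linarith)
        rwa [show 0 - (α - 2) = 2 - α by ring, Real.rpow_zero] at this
      refine (abs_sub _ _).trans ?_
      rw [abs_mul, abs_mul (2 * H), abs_mul (2 * H - 1), abs_mul (θ ^ 2),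
        abs_of_pos (by positivity : 0 < 2 * H), abs_of_pos (by positivity : 0 < t ^ (2 * H - 2)),
        abs_of_nonneg (by positivity : 0 ≤ σ ^ 2 / 2), abs_of_nonneg (sq_nonneg θ), add_mul]
      have q := hM t ht.le
      calc _ ≤ σ ^ 2 / 2 * (2 * H * (|2 * H - 1| * (T ^ (2 * H - α) * t ^ (α - 2)))) +
            θ ^ 2 * (M * (T ^ (2 - α) * t ^ (α - 2))) := by
            gcongr
            exact q.trans (le_mul_of_one_le_right hM0 p2)
        _ = _ := by ring
  refine ⟨C, hC, ⟨fun a b ha hab hb => ?_, fun x a b hx ha hb hT => ?_⟩⟩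
  · have := hCV.diff_le ha hab hb
    rwa [hVR a ha, hVR b (ha.trans hab)] at this
  · have := hCV.second_diff_le hx ha hb hT
    rwa [hVR _ (by positivity), hVR _ (by positivity), hVR _ hx, hVR _ (by positivity)] at this

end

noncomputable section

/-! ### Moments of the stationary fractional Ornstein-Uhlenbeck process -/

/-- Variation of constants for `dy = -θ y dt + σ db`. -/
lemma ou_solution {θ σ : ℝ} {y b : ℝ → ℝ} (hy : Continuous y) (hb : Continuous b)
    (heq : ∀ t, 0 ≤ t → y t = y 0 - θ * (∫ s in (0 : ℝ)..t, y s) + σ * b t) {t : ℝ} (ht : 0 ≤ t) :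
    y t = Real.exp (-(θ * t)) * y 0 + σ * (Real.exp (-(θ * t)) * b t +
      ∫ s in (0 : ℝ)..t, θ * Real.exp (-(θ * (t - s))) * (b t - b s)) := by
  set Y : ℝ → ℝ := fun t => ∫ s in (0 : ℝ)..t, y s with hY
  have dY : ∀ s, HasDerivAt Y (y s) s := fun s =>
    intervalIntegral.integral_hasDerivAt_right (hy.intervalIntegrable _ _)
      (hy.stronglyMeasurableAtFilter _ _) hy.continuousAt
  have dexp : ∀ s, HasDerivAt (fun s => Real.exp (-(θ * (t - s))))
      (θ * Real.exp (-(θ * (t - s)))) s := fun s => by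
    have := ((((hasDerivAt_id s).const_sub t).const_mul θ).neg).exp
    refine this.congr_deriv ?_
    simp; ring
  have cw : Continuous fun s : ℝ => θ * Real.exp (-(θ * (t - s))) := by fun_prop
  have e1 : ∫ s in (0 : ℝ)..t, θ * Real.exp (-(θ * (t - s))) = 1 - Real.exp (-(θ * t)) := by
    rw [intervalIntegral.integral_eq_sub_of_hasDerivAt (fun s _ => dexp s)
      (cw.intervalIntegrable _ _)]
    simp
  -- This integrates the derivative of `θ exp (-θ (t - s)) Y s`, where the equation gives `θ Y + y =
  -- y 0 + σ b`.
  have e2 : ∫ s in (0 : ℝ)..t, (y 0 * (θ * Real.exp (-(θ * (t - s)))) +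
      σ * (θ * Real.exp (-(θ * (t - s))) * b s)) = θ * Y t := by
    rw [intervalIntegral.integral_eq_sub_of_hasDerivAt
      (f := fun s => θ * (Real.exp (-(θ * (t - s))) * Y s))]
    · simp [hY]
    · intro s hs
      rw [Set.uIcc_of_le ht] at hs
      refine (((dexp s).mul (dY s)).const_mul θ).congr_deriv ?_
      have := heq s hs.1
      linear_combination θ * Real.exp (-(θ * (t - s))) * this
    · exact Continuous.intervalIntegrable (by fun_prop) _ _
  have e3 : ∫ s in (0 : ℝ)..t, θ * Real.exp (-(θ * (t - s))) * (b t - b s) =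
      b t * (1 - Real.exp (-(θ * t))) - ∫ s in (0 : ℝ)..t, θ * Real.exp (-(θ * (t - s))) * b s := by
    rw [← e1, ← intervalIntegral.integral_const_mul, ← intervalIntegral.integral_sub
      (Continuous.intervalIntegrable (by fun_prop) _ _)
      (Continuous.intervalIntegrable (by fun_prop) _ _)]
    refine intervalIntegral.integral_congr fun s _ => ?_
    ring
  rw [intervalIntegral.integral_add (Continuous.intervalIntegrable (by fun_prop) _ _)
    (Continuous.intervalIntegrable (by fun_prop) _ _), intervalIntegral.integral_const_mul (y 0),
    intervalIntegral.integral_const_mul σ, e1] at e2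
  rw [e3, heq t ht]
  change y 0 - θ * Y t + σ * b t = _
  linear_combination e2

lemma add_pow_four_le (a b : ℝ) : (a + b) ^ 4 ≤ 8 * a ^ 4 + 8 * b ^ 4 := by
  nlinarith [sq_nonneg (a - b), sq_nonneg (a + b), sq_nonneg (a ^ 2 - b ^ 2),
    mul_nonneg (sq_nonneg (a - b)) (sq_nonneg (a + b)), sq_nonneg ((a - b) ^ 2),
    mul_nonneg (sq_nonneg (a - b)) (sq_nonneg (a - b)), mul_nonneg (sq_nonneg (a - b)) (sq_nonneg a),
    mul_nonneg (sq_nonneg (a - b)) (sq_nonneg b)]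

/-- Jensen's inequality for the fourth power and a sub-probability weight. -/
lemma integral_weight_pow_four_le {w φ : ℝ → ℝ} (hw : Continuous w) (hφ : Continuous φ) {t : ℝ}
    (ht : 0 ≤ t) (hw0 : ∀ s, 0 ≤ w s) (hw1 : ∫ s in (0 : ℝ)..t, w s ≤ 1) :
    (∫ s in (0 : ℝ)..t, w s * φ s) ^ 4 ≤ ∫ s in (0 : ℝ)..t, w s * φ s ^ 4 := by
  set m := ∫ s in (0 : ℝ)..t, w s * φ s with hm
  -- The tangent of the fourth power at `m`. The missing mass costs `3 m⁴ (1 - ∫ w)`, which has the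
  -- right sign.
  have h : ∫ s in (0 : ℝ)..t, (4 * m ^ 3 * (w s * φ s) - 3 * m ^ 4 * w s) ≤
      ∫ s in (0 : ℝ)..t, w s * φ s ^ 4 := by
    refine intervalIntegral.integral_mono_on ht (Continuous.intervalIntegrable (by fun_prop) _ _)
      (Continuous.intervalIntegrable (by fun_prop) _ _) fun s _ => ?_
    have : 0 ≤ φ s ^ 4 - 4 * m ^ 3 * φ s + 3 * m ^ 4 := by
      have e : φ s ^ 4 - 4 * m ^ 3 * φ s + 3 * m ^ 4 =
        (φ s - m) ^ 2 * ((φ s + m) ^ 2 + 2 * m ^ 2) := by ring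
      rw [e]; positivity
    nlinarith [mul_nonneg (hw0 s) this]
  rw [intervalIntegral.integral_sub (Continuous.intervalIntegrable (by fun_prop) _ _)
    (Continuous.intervalIntegrable (by fun_prop) _ _), intervalIntegral.integral_const_mul,
    intervalIntegral.integral_const_mul, ← hm] at h
  nlinarith [mul_nonneg (show 0 ≤ 3 * m ^ 4 by positivity) (sub_nonneg.2 hw1)]

/-! ### Finite fourth moments from stationarity -/

section
variable {Ω : Type*} [MeasurableSpace Ω] {P : Measure Ω}

/-- The fourth moment of the standard Gaussian. -/
def gaussFour : ℝ≥0∞ := ∫⁻ x, ENNReal.ofReal (x ^ 4) ∂(gaussianReal 0 1)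

lemma gaussFour_lt_top : gaussFour < ∞ := by
  have h : MemLp id 4 (gaussianReal 0 1) := memLp_id_gaussianReal 4
  have := h.integrable_norm_pow (p := 4) (by norm_num)
  refine (lintegral_congr fun x => ?_).trans_lt this.lintegral_lt_top
  congr 1
  simp only [id, Real.norm_eq_abs]
  rw [Even.pow_abs (by decide)]

lemma lintegral_pow_four_of_gaussian {Z : Ω → ℝ} (hZ : HasGaussianLaw Z P)
    (h0 : ∫ ω, Z ω ∂P = 0) :
    ∫⁻ ω, ENNReal.ofReal (Z ω ^ 4) ∂P = ENNReal.ofReal (Var[Z; P] ^ 2) * gaussFour := by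
  set v := Var[Z; P] with hv
  have hv0 : 0 ≤ v := variance_nonneg _ _
  have hlaw : P.map Z = (gaussianReal 0 1).map (Real.sqrt v * ·) := by
    rw [hZ.map_eq_gaussianReal, h0, gaussianReal_map_const_mul, mul_zero]
    congr 1
    ext
    simp [← hv, hv0, Real.sq_sqrt hv0]
  have e1 : ∫⁻ ω, ENNReal.ofReal (Z ω ^ 4) ∂P = ∫⁻ x, ENNReal.ofReal (x ^ 4) ∂(P.map Z) := by
    rw [lintegral_map' (by fun_prop) hZ.aemeasurable]
  rw [e1, hlaw, lintegral_map (by fun_prop) (by fun_prop), gaussFour,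
    ← lintegral_const_mul _ (by fun_prop)]
  refine lintegral_congr fun x => ?_
  rw [← ENNReal.ofReal_mul (by positivity), mul_pow]
  congr 2
  calc Real.sqrt v ^ 4 = (Real.sqrt v ^ 2) ^ 2 := by ring
    _ = v ^ 2 := by rw [Real.sq_sqrt hv0]

/-- The process is set to zero on a measurable null set containing the bad paths. The exceptional
set does not depend on `t`, so pathwise equations carry over. -/
lemma exists_continuous_modification {X : ℝ≥0 → Ω → ℝ} (hm : ∀ t, Measurable (X t))
    (hc : ∀ᵐ ω ∂P, Continuous fun t => X t ω) : ∃ X' : ℝ≥0 → Ω → ℝ, (∀ t, Measurable (X' t)) ∧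
      (∀ ω, Continuous fun t => X' t ω) ∧ ∀ᵐ ω ∂P, ∀ t, X' t ω = X t ω := by
  classical
  set N := toMeasurable P {ω | ¬ Continuous fun t => X t ω} with hN
  have hN0 : P N = 0 := by rw [hN, measure_toMeasurable]; exact ae_iff.1 hc
  refine ⟨fun t => Nᶜ.indicator (X t), fun t =>
    (hm t).indicator (measurableSet_toMeasurable _ _).compl, fun ω => ?_, ?_⟩
  · by_cases h : ω ∈ N
    · have : (fun t => Nᶜ.indicator (X t) ω) = fun _ => 0 := by
        funext t; simp [h]
      rw [this]; exact continuous_const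
    · have : (fun t => Nᶜ.indicator (X t) ω) = fun t => X t ω := by
        funext t; simp [h]
      rw [this]
      by_contra hcon
      exact h (subset_toMeasurable _ _ hcon)
  · have : ∀ᵐ ω ∂P, ω ∉ N := measure_eq_zero_iff_ae_notMem.1 hN0
    filter_upwards [this] with ω hω t
    simp [hω]

/-- A real-indexed, everywhere continuous version of a one-dimensional stationary fractional
Ornstein-Uhlenbeck process. -/
structure ContFOU (P : Measure Ω) (H θ μ σ : ℝ) (b x : ℝ → Ω → ℝ) : Prop where
  cont_b : ∀ ω, Continuous fun t => b t ω
  cont_x : ∀ ω, Continuous fun t => x t ω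
  meas_b : ∀ t, Measurable (b t)
  meas_x : ∀ t, Measurable (x t)
  equation : ∀ᵐ ω ∂P, ∀ t, 0 ≤ t →
    x t ω = x 0 ω - θ * (∫ s in (0 : ℝ)..t, (x s ω - μ)) + σ * b t ω
  stationary : ∀ τ s t, 0 ≤ τ → 0 ≤ s → 0 ≤ t →
    IdentDistrib (fun ω => (x (τ + s) ω, x (τ + t) ω)) (fun ω => (x s ω, x t ω)) P P
  gaussian : ∀ s t, HasGaussianLaw (fun ω => b t ω - b s ω) P
  mean_zero : ∀ t, ∫ ω, b t ω ∂P = 0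
  variance_eq : ∀ s t, 0 ≤ s → s ≤ t → Var[fun ω => b t ω - b s ω; P] = (t - s) ^ (2 * H)

namespace ContFOU
variable {H θ μ σ : ℝ} {b x : ℝ → Ω → ℝ}

lemma identDistrib (h : ContFOU P H θ μ σ b x) {t : ℝ} (ht : 0 ≤ t) :
    IdentDistrib (x t) (x 0) P P := by
  have := (h.stationary t 0 0 ht le_rfl le_rfl).comp measurable_fst
  simpa [Function.comp_def] using this

lemma b_zero (h : ContFOU P H θ μ σ b x) (hσ : σ ≠ 0) : ∀ᵐ ω ∂P, b 0 ω = 0 := by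
  filter_upwards [h.equation] with ω hω
  have := hω 0 le_rfl
  simp at this
  exact this.resolve_left hσ

lemma memLp_b [IsProbabilityMeasure P] (h : ContFOU P H θ μ σ b x) (hσ : σ ≠ 0) (t : ℝ) :
    MemLp (b t) 2 P := by
  refine ((h.gaussian 0 t).memLp_two).ae_eq ?_
  filter_upwards [h.b_zero hσ] with ω hω
  rw [hω, sub_zero]

lemma variance_b (h : ContFOU P H θ μ σ b x) (hσ : σ ≠ 0) {t : ℝ} (ht : 0 ≤ t) :
    Var[b t; P] = t ^ (2 * H) := by
  have := h.variance_eq 0 t le_rfl ht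
  rw [sub_zero] at this
  rw [← this]
  refine variance_congr ?_
  filter_upwards [h.b_zero hσ] with ω hω
  rw [hω, sub_zero]

lemma lintegral_incr_pow_four [IsProbabilityMeasure P] (h : ContFOU P H θ μ σ b x) (hσ : σ ≠ 0)
    {s t : ℝ} (hs : 0 ≤ s) (hst : s ≤ t) :
    ∫⁻ ω, ENNReal.ofReal ((b t ω - b s ω) ^ 4) ∂P =
      ENNReal.ofReal ((t - s) ^ (4 * H)) * gaussFour := by
  rw [lintegral_pow_four_of_gaussian (h.gaussian s t), h.variance_eq s t hs hst]
  · congr 2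
    rw [← Real.rpow_natCast, ← Real.rpow_mul (sub_nonneg.2 hst)]
    congr 1; push_cast; ring
  · rw [integral_sub ((h.memLp_b hσ t).integrable one_le_two)
      ((h.memLp_b hσ s).integrable one_le_two), h.mean_zero, h.mean_zero, sub_zero]

/-- The noise part of the stationary solution. -/
def noise (θ : ℝ) (b : ℝ → Ω → ℝ) (t : ℝ) (ω : Ω) : ℝ :=
  Real.exp (-(θ * t)) * b t ω +
    ∫ s in (0 : ℝ)..t, θ * Real.exp (-(θ * (t - s))) * (b t ω - b s ω)

lemma eq_noise (h : ContFOU P H θ μ σ b x) : ∀ᵐ ω ∂P, ∀ t, 0 ≤ t →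
    x t ω - μ = Real.exp (-(θ * t)) * (x 0 ω - μ) + σ * noise θ b t ω := by
  filter_upwards [h.equation] with ω hω t ht
  refine ou_solution (y := fun t => x t ω - μ) ((h.cont_x ω).sub continuous_const) (h.cont_b ω)
    (fun t ht => ?_) ht
  rw [hω t ht]; ring

lemma noise_pow_four_le (h : ContFOU P H θ μ σ b x) (hθ : 0 < θ) {t : ℝ} (ht : 0 ≤ t) (ω : Ω) :
    noise θ b t ω ^ 4 ≤ 8 * (Real.exp (-(θ * t)) * b t ω) ^ 4 +
      8 * ∫ s in (0 : ℝ)..t, θ * Real.exp (-(θ * (t - s))) * (b t ω - b s ω) ^ 4 := by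
  have hc := h.cont_b ω
  refine (add_pow_four_le _ _).trans ?_
  gcongr
  refine integral_weight_pow_four_le (w := fun s => θ * Real.exp (-(θ * (t - s))))
    (φ := fun s => b t ω - b s ω) (by fun_prop) (by fun_prop) ht (fun s => by positivity) ?_
  have dexp : ∀ s, HasDerivAt (fun s => Real.exp (-(θ * (t - s))))
      (θ * Real.exp (-(θ * (t - s)))) s := fun s => by
    have := ((((hasDerivAt_id s).const_sub t).const_mul θ).neg).exp
    refine this.congr_deriv ?_
    simp; ring
  rw [intervalIntegral.integral_eq_sub_of_hasDerivAt (fun s _ => dexp s)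
    (Continuous.intervalIntegrable (by fun_prop) _ _)]
  simp [Real.exp_nonneg]

lemma measurable_uncurry_b (h : ContFOU P H θ μ σ b x) : Measurable (Function.uncurry b) :=
  measurable_uncurry_of_continuous_of_measurable h.cont_b h.meas_b

lemma measurable_uncurry_x (h : ContFOU P H θ μ σ b x) : Measurable (Function.uncurry x) :=
  measurable_uncurry_of_continuous_of_measurable h.cont_x h.meas_x

/-- This is `u ≤ exp u` at `u = c r / a`, raised to the power `a`. -/
lemma rpow_mul_exp_le {a c r : ℝ} (ha : 0 < a) (hc : 0 < c) (hr : 0 ≤ r) :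
    r ^ a * Real.exp (-(c * r)) ≤ (a / c) ^ a := by
  have h1 : c * r / a ≤ Real.exp (c * r / a) := by linarith [Real.add_one_le_exp (c * r / a)]
  have h2 : (c * r / a) ^ a ≤ Real.exp (c * r) := by
    refine (Real.rpow_le_rpow (by positivity) h1 ha.le).trans (le_of_eq ?_)
    rw [← Real.exp_mul]; congr 1; field_simp
  have h3 : r ^ a = (a / c) ^ a * (c * r / a) ^ a := by
    rw [← Real.mul_rpow (by positivity) (by positivity)]; congr 1; field_simp
  rw [h3, mul_assoc]
  refine mul_le_of_le_one_right (by positivity) ?_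
  rw [Real.exp_neg, ← div_eq_mul_inv, div_le_one (Real.exp_pos _)]
  exact h2

/-- Fourth moments of the increments grow like `(t - s) ^ (4H)` while the weights decay
exponentially. Half of the decay rate absorbs the power, at the cost `c2`; the remaining exponential
has integral at most `2`, uniformly in `t`. -/
lemma lintegral_noise_pow_four_le [IsProbabilityMeasure P] (h : ContFOU P H θ μ σ b x) (hH : 0 < H)
    (hθ : 0 < θ) (hσ : σ ≠ 0) : ∃ K : ℝ≥0∞, K < ∞ ∧ ∀ t, 0 ≤ t →
      ∫⁻ ω, ENNReal.ofReal (noise θ b t ω ^ 4) ∂P ≤ K := by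
  set c1 : ℝ := (4 * H / (4 * θ)) ^ (4 * H) with hc1
  set c2 : ℝ := (4 * H / (θ / 2)) ^ (4 * H) with hc2
  refine ⟨8 * (ENNReal.ofReal c1 * gaussFour) + 8 * (ENNReal.ofReal (2 * c2) * gaussFour), ?_, ?_⟩
  · have := gaussFour_lt_top
    refine ENNReal.add_lt_top.2 ⟨?_, ?_⟩ <;>
    exact ENNReal.mul_lt_top (by simp) (ENNReal.mul_lt_top ENNReal.ofReal_lt_top this)
  intro t ht
  have hmb : Measurable fun z : Ω × ℝ => b z.2 z.1 :=
    h.measurable_uncurry_b.comp measurable_swap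
  have hmb' := h.meas_b t
  have hm2 : Measurable (Function.uncurry fun (ω : Ω) (s : ℝ) => ENNReal.ofReal
      (θ * Real.exp (-(θ * (t - s))) * (b t ω - b s ω) ^ 4)) :=
    ((by fun_prop : Measurable fun z : Ω × ℝ => θ * Real.exp (-(θ * (t - z.2)))).mul
      (((hmb'.comp measurable_fst).sub hmb).pow_const 4)).ennreal_ofReal
  have e1 : ∫⁻ ω, ENNReal.ofReal ((Real.exp (-(θ * t)) * b t ω) ^ 4) ∂P ≤
      ENNReal.ofReal c1 * gaussFour := by
    have : ∀ᵐ ω ∂P, ENNReal.ofReal ((Real.exp (-(θ * t)) * b t ω) ^ 4) =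
        ENNReal.ofReal (Real.exp (-(4 * θ * t))) * ENNReal.ofReal ((b t ω - b 0 ω) ^ 4) := by
      filter_upwards [h.b_zero hσ] with ω hω
      rw [hω, sub_zero, mul_pow, ← ENNReal.ofReal_mul (Real.exp_nonneg _), ← Real.exp_nat_mul]
      congr 3; push_cast; ring
    rw [lintegral_congr_ae this, lintegral_const_mul' _ _ ENNReal.ofReal_ne_top,
      h.lintegral_incr_pow_four hσ le_rfl ht, ← mul_assoc, ← ENNReal.ofReal_mul (Real.exp_nonneg _)]
    gcongr
    rw [sub_zero, mul_comm]
    exact rpow_mul_exp_le (by linarith) (by linarith) ht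
  have e2 : ∫⁻ ω, ENNReal.ofReal (∫ s in (0 : ℝ)..t, θ * Real.exp (-(θ * (t - s))) *
      (b t ω - b s ω) ^ 4) ∂P ≤ ENNReal.ofReal (2 * c2) * gaussFour := by
    have i1 : ∀ ω, ENNReal.ofReal (∫ s in (0 : ℝ)..t, θ * Real.exp (-(θ * (t - s))) *
        (b t ω - b s ω) ^ 4) = ∫⁻ s in Set.Ioc 0 t, ENNReal.ofReal (θ * Real.exp (-(θ * (t - s))) *
        (b t ω - b s ω) ^ 4) := by
      intro ω
      have hc := h.cont_b ω
      rw [intervalIntegral.integral_of_le ht, ofReal_integral_eq_lintegral_ofReal]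
      · exact (Continuous.intervalIntegrable (by fun_prop) 0 t).1
      · exact Eventually.of_forall fun s => by positivity
    simp only [i1]
    rw [lintegral_lintegral_swap hm2.aemeasurable]
    have i2 : ∀ s ∈ Set.Ioc 0 t, ∫⁻ ω, ENNReal.ofReal (θ * Real.exp (-(θ * (t - s))) *
        (b t ω - b s ω) ^ 4) ∂P ≤
        ENNReal.ofReal (c2 * (θ * Real.exp (-(θ / 2 * (t - s))))) * gaussFour := by
      intro s hs
      have : ∀ ω, ENNReal.ofReal (θ * Real.exp (-(θ * (t - s))) * (b t ω - b s ω) ^ 4) =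
          ENNReal.ofReal (θ * Real.exp (-(θ * (t - s)))) * ENNReal.ofReal ((b t ω - b s ω) ^ 4) :=
        fun ω => ENNReal.ofReal_mul (by positivity)
      simp only [this]
      rw [lintegral_const_mul' _ _ ENNReal.ofReal_ne_top,
        h.lintegral_incr_pow_four hσ hs.1.le hs.2, ← mul_assoc, ← ENNReal.ofReal_mul (by positivity)]
      gcongr ENNReal.ofReal ?_ * _
      have k := rpow_mul_exp_le (a := 4 * H) (c := θ / 2) (r := t - s) (by linarith) (by linarith)
        (sub_nonneg.2 hs.2)
      have k2 : Real.exp (-(θ * (t - s))) =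
          Real.exp (-(θ / 2 * (t - s))) * Real.exp (-(θ / 2 * (t - s))) := by
        rw [← Real.exp_add]; congr 1; ring
      rw [k2]
      calc _ = ((t - s) ^ (4 * H) * Real.exp (-(θ / 2 * (t - s)))) *
            (θ * Real.exp (-(θ / 2 * (t - s)))) := by ring
        _ ≤ _ := by gcongr
    refine (setLIntegral_mono' measurableSet_Ioc i2).trans ?_
    rw [lintegral_mul_const' _ _ gaussFour_lt_top.ne]
    gcongr
    have dexp : ∀ s, HasDerivAt (fun s => c2 * (2 * Real.exp (-(θ / 2 * (t - s)))))
        (c2 * (θ * Real.exp (-(θ / 2 * (t - s))))) s := fun s => by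
      have := (((((hasDerivAt_id s).const_sub t).const_mul (θ / 2)).neg).exp.const_mul 2).const_mul c2
      refine this.congr_deriv ?_
      simp only [Pi.neg_apply, id]; ring
    have hcont : Continuous fun s : ℝ => c2 * (θ * Real.exp (-(θ / 2 * (t - s)))) := by fun_prop
    have hc2' : 0 ≤ c2 := by positivity
    rw [← ofReal_integral_eq_lintegral_ofReal (hcont.intervalIntegrable 0 t).1
      (Eventually.of_forall fun s => by positivity), ← intervalIntegral.integral_of_le ht,
      intervalIntegral.integral_eq_sub_of_hasDerivAt (fun s _ => dexp s)
      (hcont.intervalIntegrable _ _)]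
    refine ENNReal.ofReal_le_ofReal ?_
    simp only [sub_self, mul_zero, neg_zero, Real.exp_zero, sub_zero]
    have : 0 ≤ c2 * (2 * Real.exp (-(θ / 2 * t))) := by positivity
    linarith
  calc ∫⁻ ω, ENNReal.ofReal (noise θ b t ω ^ 4) ∂P
      ≤ ∫⁻ ω, (8 * ENNReal.ofReal ((Real.exp (-(θ * t)) * b t ω) ^ 4) +
        8 * ENNReal.ofReal (∫ s in (0 : ℝ)..t, θ * Real.exp (-(θ * (t - s))) *
          (b t ω - b s ω) ^ 4)) ∂P := by
        refine lintegral_mono fun ω => ?_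
        have h8 : (8 : ℝ≥0∞) = ENNReal.ofReal 8 := by simp
        have p2 : 0 ≤ ∫ s in (0 : ℝ)..t, θ * Real.exp (-(θ * (t - s))) * (b t ω - b s ω) ^ 4 :=
          intervalIntegral.integral_nonneg ht fun s _ => by positivity
        rw [h8, ← ENNReal.ofReal_mul (by norm_num), ← ENNReal.ofReal_mul (by norm_num),
          ← ENNReal.ofReal_add (by positivity) (by positivity)]
        exact ENNReal.ofReal_le_ofReal (h.noise_pow_four_le hθ ht ω)
    _ = 8 * ∫⁻ ω, ENNReal.ofReal ((Real.exp (-(θ * t)) * b t ω) ^ 4) ∂P +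
        8 * ∫⁻ ω, ENNReal.ofReal (∫ s in (0 : ℝ)..t, θ * Real.exp (-(θ * (t - s))) *
          (b t ω - b s ω) ^ 4) ∂P := by
        rw [lintegral_add_left (by fun_prop), lintegral_const_mul' _ _ (by simp),
          lintegral_const_mul' _ _ (by simp)]
    _ ≤ _ := by gcongr

/-- Stationarity forces a finite fourth moment. -/
lemma lintegral_pow_four_lt_top [IsProbabilityMeasure P] (h : ContFOU P H θ μ σ b x) (hH : 0 < H)
    (hθ : 0 < θ) (hσ : σ ≠ 0) : ∫⁻ ω, ENNReal.ofReal ((x 0 ω - μ) ^ 4) ∂P < ∞ := by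
  obtain ⟨K, hK, hKt⟩ := h.lintegral_noise_pow_four_le hH hθ hσ
  set L : ℝ≥0∞ := 8 * (ENNReal.ofReal (σ ^ 4) * K) with hL
  have hLt : L < ∞ := ENNReal.mul_lt_top (by simp) (ENNReal.mul_lt_top ENNReal.ofReal_lt_top hK)
  have hm0 := h.meas_x 0
  -- Truncation makes the expectation finite, and stationarity lets it be computed at time `n`.
  -- There the contribution of the initial value tends to `0` by dominated convergence, leaving the
  -- noise bound `L`, which does not depend on `N`.
  have hbound : ∀ N : ℕ, ∫⁻ ω, min (ENNReal.ofReal ((x 0 ω - μ) ^ 4)) N ∂P ≤ L := by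
    intro N
    have step : ∀ n : ℕ, ∫⁻ ω, min (ENNReal.ofReal ((x 0 ω - μ) ^ 4)) N ∂P ≤
        ∫⁻ ω, min (ENNReal.ofReal (8 * (Real.exp (-(θ * n)) * (x 0 ω - μ)) ^ 4)) N ∂P + L := by
      intro n
      have hn : (0 : ℝ) ≤ n := n.cast_nonneg
      have e := ((h.identDistrib hn).comp (u := fun y : ℝ => min (ENNReal.ofReal ((y - μ) ^ 4))
        (N : ℝ≥0∞)) (by fun_prop)).lintegral_eq
      simp only [Function.comp_def] at e
      rw [← e]
      calc _ ≤ ∫⁻ ω, (min (ENNReal.ofReal (8 * (Real.exp (-(θ * n)) * (x 0 ω - μ)) ^ 4)) N +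
            8 * (ENNReal.ofReal (σ ^ 4) * ENNReal.ofReal (noise θ b n ω ^ 4))) ∂P := by
            refine lintegral_mono_ae ?_
            filter_upwards [h.eq_noise] with ω hω
            rw [hω n hn]
            have h8 : (8 : ℝ≥0∞) = ENNReal.ofReal 8 := by simp
            have := add_pow_four_le (Real.exp (-(θ * n)) * (x 0 ω - μ)) (σ * noise θ b n ω)
            have h9 : ENNReal.ofReal ((Real.exp (-(θ * n)) * (x 0 ω - μ) + σ * noise θ b n ω) ^ 4) ≤
                ENNReal.ofReal (8 * (Real.exp (-(θ * n)) * (x 0 ω - μ)) ^ 4) +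
                8 * (ENNReal.ofReal (σ ^ 4) * ENNReal.ofReal (noise θ b n ω ^ 4)) := by
              rw [h8, ← ENNReal.ofReal_mul (by positivity), ← ENNReal.ofReal_mul (by norm_num),
                ← ENNReal.ofReal_add (by positivity) (by positivity), ← mul_pow]
              exact ENNReal.ofReal_le_ofReal this
            refine (min_le_min_right _ h9).trans ?_
            rcases le_total (ENNReal.ofReal (8 * (Real.exp (-(θ * n)) * (x 0 ω - μ)) ^ 4)) N
              with hle | hle
            · rw [min_eq_left hle]; exact min_le_left _ _
            · rw [min_eq_right hle]; exact (min_le_right _ _).trans le_self_add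
        _ ≤ _ := by
            rw [lintegral_add_left (by fun_prop), lintegral_const_mul' _ _ (by simp),
              lintegral_const_mul' _ _ ENNReal.ofReal_ne_top]
            refine add_le_add le_rfl ?_
            rw [hL]
            gcongr
            exact hKt n hn
    have hlim : Tendsto (fun n : ℕ => ∫⁻ ω, min (ENNReal.ofReal (8 * (Real.exp (-(θ * n)) *
        (x 0 ω - μ)) ^ 4)) N ∂P + L) atTop (𝓝 (∫⁻ _, 0 ∂P + L)) := by
      refine Tendsto.add_const L ?_
      refine tendsto_lintegral_of_dominated_convergence (fun _ => (N : ℝ≥0∞))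
        (fun n => by fun_prop) (fun n => Eventually.of_forall fun ω => min_le_right _ _)
        (by simp) (Eventually.of_forall fun ω => ?_)
      have hexp : Tendsto (fun n : ℕ => Real.exp (-(θ * n))) atTop (𝓝 0) :=
        Real.tendsto_exp_neg_atTop_nhds_zero.comp
          (tendsto_natCast_atTop_atTop.const_mul_atTop hθ)
      have h1 : Tendsto (fun n : ℕ => 8 * (Real.exp (-(θ * n)) * (x 0 ω - μ)) ^ 4) atTop
          (𝓝 (8 * (0 * (x 0 ω - μ)) ^ 4)) := ((hexp.mul_const _).pow 4).const_mul 8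
      have h2 := (ENNReal.tendsto_ofReal h1).min (tendsto_const_nhds (x := (N : ℝ≥0∞)))
      simpa using h2
    simp only [lintegral_zero, zero_add] at hlim
    exact ge_of_tendsto' hlim step
  have hmono : Tendsto (fun N : ℕ => ∫⁻ ω, min (ENNReal.ofReal ((x 0 ω - μ) ^ 4)) N ∂P) atTop
      (𝓝 (∫⁻ ω, ENNReal.ofReal ((x 0 ω - μ) ^ 4) ∂P)) := by
    refine lintegral_tendsto_of_tendsto_of_monotone (fun N => by fun_prop)
      (Eventually.of_forall fun ω N N' hN => min_le_min_left _ (by exact_mod_cast hN))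
      (Eventually.of_forall fun ω => ?_)
    refine tendsto_const_nhds.congr' ?_
    obtain ⟨N₀, hN₀⟩ := exists_nat_ge ((x 0 ω - μ) ^ 4)
    filter_upwards [eventually_ge_atTop N₀] with N hN
    rw [min_eq_left]
    refine (ENNReal.ofReal_le_ofReal (hN₀.trans (Nat.cast_le.2 hN))).trans ?_
    simp
  exact (le_of_tendsto' hmono hbound).trans_lt hLt

lemma memLp_four [IsProbabilityMeasure P] (h : ContFOU P H θ μ σ b x) (hH : 0 < H) (hθ : 0 < θ)
    (hσ : σ ≠ 0) {t : ℝ} (ht : 0 ≤ t) : MemLp (x t) 4 P := by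
  have h0 : MemLp (fun ω => x 0 ω - μ) 4 P := by
    refine ⟨((h.meas_x 0).sub_const μ).aestronglyMeasurable, ?_⟩
    rw [eLpNorm_lt_top_iff_lintegral_rpow_enorm_lt_top (by norm_num) (by norm_num)]
    refine (lintegral_congr fun ω => ?_).trans_lt (h.lintegral_pow_four_lt_top hH hθ hσ)
    rw [show (4 : ℝ≥0∞).toReal = ((4 : ℕ) : ℝ) by norm_num, ENNReal.rpow_natCast,
      Real.enorm_eq_ofReal_abs, ← ENNReal.ofReal_pow (abs_nonneg _), Even.pow_abs (by decide)]
  have h1 : MemLp (x 0) 4 P :=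
    (h0.add (memLp_const μ)).ae_eq (Eventually.of_forall fun ω => by simp)
  exact ((h.identDistrib ht).memLp_iff).2 h1

lemma memLp_two [IsProbabilityMeasure P] (h : ContFOU P H θ μ σ b x) (hH : 0 < H) (hθ : 0 < θ)
    (hσ : σ ≠ 0) {t : ℝ} (ht : 0 ≤ t) : MemLp (x t) 2 P :=
  (h.memLp_four hH hθ hσ ht).mono_exponent (by norm_num)

end ContFOU

end

end

noncomputable section

set_option linter.unusedSectionVars false

/-! ### The variance equation -/

namespace ContFOU
variable {Ω : Type*} [MeasurableSpace Ω] {P : Measure Ω} {H θ μ σ : ℝ} {b x : ℝ → Ω → ℝ}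

/-- The centered process. -/
def centered (P : Measure Ω) (x : ℝ → Ω → ℝ) (t : ℝ) (ω : Ω) : ℝ := x t ω - ∫ ω, x 0 ω ∂P

/-- The autocovariance, extended to an even function on the line. -/
def acov (P : Measure Ω) (x : ℝ → Ω → ℝ) (t : ℝ) : ℝ :=
  ∫ ω, centered P x 0 ω * centered P x |t| ω ∂P

variable [IsProbabilityMeasure P]

lemma memLp_centered (h : ContFOU P H θ μ σ b x) (hH : 0 < H) (hθ : 0 < θ) (hσ : σ ≠ 0) {t : ℝ}
    (ht : 0 ≤ t) : MemLp (centered P x t) 2 P :=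
  (h.memLp_two hH hθ hσ ht).sub (memLp_const _)

lemma integral_eq (h : ContFOU P H θ μ σ b x) {t : ℝ} (ht : 0 ≤ t) :
    ∫ ω, x t ω ∂P = ∫ ω, x 0 ω ∂P := (h.identDistrib ht).integral_eq

lemma integral_centered (h : ContFOU P H θ μ σ b x) (hH : 0 < H) (hθ : 0 < θ) (hσ : σ ≠ 0) {t : ℝ}
    (ht : 0 ≤ t) : ∫ ω, centered P x t ω ∂P = 0 := by
  unfold centered
  rw [integral_sub ((h.memLp_two hH hθ hσ ht).integrable one_le_two) (integrable_const _),
    h.integral_eq ht]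
  simp

lemma integral_centered_mul_of_le (h : ContFOU P H θ μ σ b x) {s t : ℝ} (hs : 0 ≤ s) (hst : s ≤ t) :
    ∫ ω, centered P x s ω * centered P x t ω ∂P = acov P x (t - s) := by
  set m := ∫ ω, x 0 ω ∂P with hm
  have := ((h.stationary s 0 (t - s) hs le_rfl (sub_nonneg.2 hst)).comp
    (u := fun p : ℝ × ℝ => (p.1 - m) * (p.2 - m)) (by fun_prop)).integral_eq
  simp only [Function.comp_def, add_zero, add_sub_cancel] at this
  rw [acov, abs_of_nonneg (sub_nonneg.2 hst)]
  exact this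

lemma acov_neg (t : ℝ) : acov P x (-t) = acov P x t := by rw [acov, acov, abs_neg]

lemma integral_centered_mul (h : ContFOU P H θ μ σ b x) {s t : ℝ} (hs : 0 ≤ s) (ht : 0 ≤ t) :
    ∫ ω, centered P x s ω * centered P x t ω ∂P = acov P x (s - t) := by
  rcases le_total s t with hst | hst
  · rw [h.integral_centered_mul_of_le hs hst, ← acov_neg]; congr 1; ring
  · rw [← h.integral_centered_mul_of_le ht hst]
    simp only [mul_comm]

lemma integral_centered_sq (h : ContFOU P H θ μ σ b x) {t : ℝ} (ht : 0 ≤ t) :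
    ∫ ω, centered P x t ω ^ 2 ∂P = acov P x 0 := by
  rw [← sub_self t, ← h.integral_centered_mul ht ht]
  simp only [sq]

lemma abs_integral_mul_le {f g : Ω → ℝ} (hf : MemLp f 2 P) (hg : MemLp g 2 P) :
    ∫ ω, |f ω * g ω| ∂P ≤ (∫ ω, f ω ^ 2 ∂P + ∫ ω, g ω ^ 2 ∂P) / 2 := by
  rw [← integral_add hf.integrable_sq hg.integrable_sq, ← integral_div]
  refine integral_mono (hf.integrable_mul hg).abs
    ((hf.integrable_sq.add hg.integrable_sq).div_const 2) fun ω => ?_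
  simp only [abs_mul]
  nlinarith [sq_nonneg (|f ω| - |g ω|), sq_abs (f ω), sq_abs (g ω)]

lemma abs_acov_le (h : ContFOU P H θ μ σ b x) (hH : 0 < H) (hθ : 0 < θ) (hσ : σ ≠ 0) (t : ℝ) :
    |acov P x t| ≤ acov P x 0 := by
  have := abs_integral_mul_le (h.memLp_centered hH hθ hσ le_rfl)
    (h.memLp_centered hH hθ hσ (abs_nonneg t))
  rw [h.integral_centered_sq le_rfl, h.integral_centered_sq (abs_nonneg t)] at this
  refine (abs_integral_le_integral_abs).trans (this.trans (le_of_eq ?_))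
  ring

lemma measurable_uncurry_centered (h : ContFOU P H θ μ σ b x) :
    Measurable (Function.uncurry (centered P x)) :=
  h.measurable_uncurry_x.sub_const _

/-- Measurability and boundedness are enough to integrate the autocovariance; its continuity is only
obtained afterwards, from the variance equation. -/
lemma measurable_acov (h : ContFOU P H θ μ σ b x) : Measurable (acov P x) := by
  have hc := h.measurable_uncurry_centered
  have h1 : Measurable fun z : ℝ × Ω => centered P x 0 z.2 * centered P x |z.1| z.2 :=
    (hc.comp (measurable_const.prodMk measurable_snd)).mul
      (hc.comp (measurable_fst.abs.prodMk measurable_snd))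
  exact (h1.stronglyMeasurable.integral_prod_right').measurable

lemma intervalIntegrable_acov (h : ContFOU P H θ μ σ b x) (hH : 0 < H) (hθ : 0 < θ) (hσ : σ ≠ 0)
    (a c : ℝ) : IntervalIntegrable (acov P x) volume a c := by
  refine (intervalIntegrable_const (c := acov P x 0)).mono_fun'
    h.measurable_acov.aestronglyMeasurable (Eventually.of_forall fun t => ?_)
  exact h.abs_acov_le hH hθ hσ t

/-- Fubini for a square integrable variable against the time integral of the process. -/
lemma integral_mul_integral_centered (h : ContFOU P H θ μ σ b x) (hH : 0 < H) (hθ : 0 < θ)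
    (hσ : σ ≠ 0) {Z : Ω → ℝ} (hZ : MemLp Z 2 P) {t : ℝ} (ht : 0 ≤ t) :
    ∫ ω, Z ω * (∫ s in (0 : ℝ)..t, centered P x s ω) ∂P =
      ∫ s in (0 : ℝ)..t, ∫ ω, Z ω * centered P x s ω ∂P := by
  rw [intervalIntegral_integral_swap]
  · simp only [intervalIntegral.integral_const_mul]
  · rw [Set.uIoc_of_le ht]
    have hm : AEStronglyMeasurable (Function.uncurry fun s ω => Z ω * centered P x s ω)
        ((volume.restrict (Set.Ioc 0 t)).prod P) :=
      (hZ.aestronglyMeasurable.comp_snd).mul h.measurable_uncurry_centered.aestronglyMeasurable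
    rw [integrable_prod_iff hm]
    constructor
    · filter_upwards [ae_restrict_mem measurableSet_Ioc] with s hs
      exact hZ.integrable_mul (h.memLp_centered hH hθ hσ hs.1.le)
    · refine Integrable.mono' (integrable_const ((∫ ω, Z ω ^ 2 ∂P + acov P x 0) / 2))
        hm.norm.integral_prod_right' ?_
      filter_upwards [ae_restrict_mem measurableSet_Ioc] with s hs
      rw [Real.norm_of_nonneg (integral_nonneg fun ω => norm_nonneg _)]
      have := abs_integral_mul_le hZ (h.memLp_centered hH hθ hσ hs.1.le)
      rwa [h.integral_centered_sq hs.1.le] at this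

/-- Square `σ b_t = Y_t - Y_0 + θ ∫ Y` and take expectations. Only the autocovariance of `Y` enters,
never the correlation of `Y` with `b`. -/
lemma acov_equation (h : ContFOU P H θ μ σ b x) (hH : 0 < H) (hθ : 0 < θ) (hσ : σ ≠ 0) {t : ℝ}
    (ht : 0 ≤ t) : σ ^ 2 * t ^ (2 * H) = 2 * (acov P x 0 - acov P x t) +
      2 * θ ^ 2 * ∫ s in (0 : ℝ)..t, ∫ u in (0 : ℝ)..s, acov P x u := by
  set m := ∫ ω, x 0 ω ∂P with hm
  set Y := centered P x with hY
  set R := acov P x with hR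
  set I : Ω → ℝ := fun ω => ∫ s in (0 : ℝ)..t, Y s ω with hI
  have hYL : ∀ {t}, 0 ≤ t → MemLp (Y t) 2 P := fun ht => h.memLp_centered hH hθ hσ ht
  have hbL := h.memLp_b hσ t
  have hIeq : ∀ᵐ ω ∂P, θ * I ω = σ * b t ω - (Y t ω - Y 0 ω) - θ * (m - μ) * t := by
    filter_upwards [h.equation] with ω hω
    have hc := h.cont_x ω
    have e1 : ∫ s in (0 : ℝ)..t, (x s ω - μ) = I ω + (m - μ) * t := by
      have : ∀ s, x s ω - μ = Y s ω + (m - μ) := fun s => by rw [hY, centered]; ring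
      have hcY : Continuous fun s => Y s ω := hc.sub continuous_const
      simp only [this]
      rw [intervalIntegral.integral_add (hcY.intervalIntegrable _ _) (by simp),
        intervalIntegral.integral_const]
      simp [mul_comm, hI]
    have := hω t ht
    rw [e1] at this
    have e2 : Y t ω - Y 0 ω = x t ω - x 0 ω := by rw [hY, centered, centered]; ring
    rw [e2]
    linear_combination this
  have hIL : MemLp I 2 P := by
    have : MemLp (fun ω => θ⁻¹ * (σ * b t ω - (Y t ω - Y 0 ω) - θ * (m - μ) * t)) 2 P :=
      (((hbL.const_mul σ).sub ((hYL ht).sub (hYL le_rfl))).sub (memLp_const _)).const_mul _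
    refine this.ae_eq ?_
    filter_upwards [hIeq] with ω hω
    rw [← hω, inv_mul_cancel_left₀ hθ.ne']
  have hI0 : ∫ ω, I ω ∂P = 0 := by
    have := h.integral_mul_integral_centered hH hθ hσ (memLp_const (1 : ℝ)) ht
    simp only [one_mul] at this
    rw [hI, hY, this]
    refine (intervalIntegral.integral_congr (g := fun _ => (0 : ℝ)) fun s hs => ?_).trans (by simp)
    rw [Set.uIcc_of_le ht] at hs
    exact h.integral_centered hH hθ hσ hs.1
  -- All other terms of `hIeq` are centered, so the deterministic drift vanishes; the stationary
  -- mean is `μ`.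
  have hdrift : θ * (m - μ) * t = 0 := by
    have e := integral_congr_ae hIeq
    rw [integral_const_mul, hI0, integral_sub, integral_sub, integral_const_mul, h.mean_zero,
      integral_sub ((hYL ht).integrable one_le_two) ((hYL le_rfl).integrable one_le_two),
      h.integral_centered hH hθ hσ ht, h.integral_centered hH hθ hσ le_rfl] at e
    · simpa using e
    · exact (hbL.const_mul σ).integrable one_le_two
    · exact ((hYL ht).sub (hYL le_rfl)).integrable one_le_two
    · exact ((hbL.const_mul σ).sub ((hYL ht).sub (hYL le_rfl))).integrable one_le_two
    · exact integrable_const _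
  have hsq : ∀ᵐ ω ∂P, (σ * b t ω) ^ 2 = (Y t ω ^ 2 + Y 0 ω ^ 2 - 2 * (Y 0 ω * Y t ω)) +
      (2 * θ * (Y t ω * I ω) - 2 * θ * (Y 0 ω * I ω) + θ ^ 2 * (I ω * I ω)) := by
    filter_upwards [hIeq] with ω hω
    have : σ * b t ω = Y t ω - Y 0 ω + θ * I ω := by rw [hω, hdrift]; ring
    rw [this]; ring
  have hint := integral_congr_ae hsq
  have i1 := (hYL ht).integrable_sq
  have i2 := (hYL (le_refl 0)).integrable_sq
  have i3 : Integrable (fun ω => 2 * (Y 0 ω * Y t ω)) P :=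
    ((hYL (le_refl 0)).integrable_mul (hYL ht)).const_mul 2
  have i4 : Integrable (fun ω => 2 * θ * (Y t ω * I ω)) P :=
    ((hYL ht).integrable_mul hIL).const_mul (2 * θ)
  have i5 : Integrable (fun ω => 2 * θ * (Y 0 ω * I ω)) P :=
    ((hYL (le_refl 0)).integrable_mul hIL).const_mul (2 * θ)
  have i6 : Integrable (fun ω => θ ^ 2 * (I ω * I ω)) P :=
    (hIL.integrable_mul hIL).const_mul (θ ^ 2)
  have i12 : Integrable (fun ω => Y t ω ^ 2 + Y 0 ω ^ 2) P := i1.add i2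
  have i123 : Integrable (fun ω => Y t ω ^ 2 + Y 0 ω ^ 2 - 2 * (Y 0 ω * Y t ω)) P := i12.sub i3
  have i45 : Integrable (fun ω => 2 * θ * (Y t ω * I ω) - 2 * θ * (Y 0 ω * I ω)) P := i4.sub i5
  have i456 : Integrable (fun ω => 2 * θ * (Y t ω * I ω) - 2 * θ * (Y 0 ω * I ω) +
      θ ^ 2 * (I ω * I ω)) P := i45.add i6
  have hLHS : ∫ ω, (σ * b t ω) ^ 2 ∂P = σ ^ 2 * t ^ (2 * H) := by
    simp only [mul_pow]
    rw [integral_const_mul, ← h.variance_b hσ ht, variance_of_integral_eq_zero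
      (h.meas_b t).aemeasurable (h.mean_zero t)]
  have hRHS : ∫ ω, ((Y t ω ^ 2 + Y 0 ω ^ 2 - 2 * (Y 0 ω * Y t ω)) +
      (2 * θ * (Y t ω * I ω) - 2 * θ * (Y 0 ω * I ω) + θ ^ 2 * (I ω * I ω))) ∂P =
      ((∫ ω, Y t ω ^ 2 ∂P) + (∫ ω, Y 0 ω ^ 2 ∂P) - 2 * ∫ ω, Y 0 ω * Y t ω ∂P) +
      (2 * θ * (∫ ω, Y t ω * I ω ∂P) - 2 * θ * (∫ ω, Y 0 ω * I ω ∂P) +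
        θ ^ 2 * ∫ ω, I ω * I ω ∂P) := by
    rw [integral_add i123 i456, integral_sub i12 i3, integral_add i1 i2, integral_add i45 i6,
      integral_sub i4 i5, integral_const_mul, integral_const_mul, integral_const_mul,
      integral_const_mul]
  set G : ℝ → ℝ := fun s => ∫ u in (0 : ℝ)..s, R u with hG
  have hRi : ∀ a c, IntervalIntegrable R volume a c := h.intervalIntegrable_acov hH hθ hσ
  have cG : Continuous G := intervalIntegral.continuous_primitive hRi 0
  -- The left side is `∫_0^t R(s - u) du`; it splits at `u = s` because `R` is even.
  have hYI : ∀ s, 0 ≤ s → ∫ ω, Y s ω * I ω ∂P = G s + G (t - s) := by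
    intro s hs
    rw [hI, hY, h.integral_mul_integral_centered hH hθ hσ (hYL hs) ht]
    have e1 : ∫ u in (0 : ℝ)..t, ∫ ω, centered P x s ω * centered P x u ω ∂P =
        ∫ u in (0 : ℝ)..t, R (s - u) := by
      refine intervalIntegral.integral_congr fun u hu => ?_
      rw [Set.uIcc_of_le ht] at hu
      exact h.integral_centered_mul hs hu.1
    rw [e1, intervalIntegral.integral_comp_sub_left, sub_zero]
    have e2 : ∫ u in (0 : ℝ)..(t - s), R u = ∫ u in (s - t)..0, R u := by
      have := intervalIntegral.integral_comp_neg (a := 0) (b := t - s) R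
      rw [neg_zero, neg_sub] at this
      rw [← this]
      exact intervalIntegral.integral_congr fun u _ => (acov_neg u).symm
    simp only [hG]
    rw [e2, add_comm, intervalIntegral.integral_add_adjacent_intervals (hRi _ _) (hRi _ _)]
  have hII : ∫ ω, I ω * I ω ∂P = 2 * ∫ s in (0 : ℝ)..t, G s := by
    have e1 := h.integral_mul_integral_centered hH hθ hσ hIL ht
    have e2 : ∫ s in (0 : ℝ)..t, ∫ ω, I ω * centered P x s ω ∂P =
        ∫ s in (0 : ℝ)..t, (G s + G (t - s)) := by
      refine intervalIntegral.integral_congr fun s hs => ?_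
      rw [Set.uIcc_of_le ht] at hs
      rw [← hYI s hs.1]
      simp only [mul_comm, hY]
    have e3 : ∫ s in (0 : ℝ)..t, G (t - s) = ∫ s in (0 : ℝ)..t, G s := by
      rw [intervalIntegral.integral_comp_sub_left]; simp
    rw [e2, intervalIntegral.integral_add (cG.intervalIntegrable _ _)
      (Continuous.intervalIntegrable (by fun_prop) _ _), e3] at e1
    rw [two_mul, ← e1]
  have h01 : ∫ ω, Y 0 ω * Y t ω ∂P = R t := by
    rw [hY, h.integral_centered_mul le_rfl ht, zero_sub, acov_neg]
  have hG0 : G 0 = 0 := by simp [hG]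
  -- The cross terms at times `t` and `0` both equal `G t` and cancel.
  rw [hLHS, hRHS, h.integral_centered_sq ht, h.integral_centered_sq le_rfl, h01, hYI t ht,
    hYI 0 le_rfl, hII, sub_self, sub_zero, hG0] at hint
  rw [hint]
  ring

/-- The variance equation expresses the autocovariance through `|t| ^ (2H)` and a double primitive
of a bounded measurable function. -/
lemma continuous_acov (h : ContFOU P H θ μ σ b x) (hH : 0 < H) (hθ : 0 < θ) (hσ : σ ≠ 0) :
    Continuous (acov P x) := by
  set G : ℝ → ℝ := fun s => ∫ u in (0 : ℝ)..s, acov P x u with hG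
  have cG : Continuous G :=
    intervalIntegral.continuous_primitive (h.intervalIntegrable_acov hH hθ hσ) 0
  have cGG : Continuous fun t => ∫ s in (0 : ℝ)..t, G s :=
    intervalIntegral.continuous_primitive (fun a c => cG.intervalIntegrable a c) 0
  have cp : Continuous fun t : ℝ => t ^ (2 * H) := Real.continuous_rpow_const (by linarith)
  have : acov P x = fun t => acov P x 0 - σ ^ 2 / 2 * |t| ^ (2 * H) +
      θ ^ 2 * ∫ s in (0 : ℝ)..|t|, G s := by
    funext t
    have e := h.acov_equation hH hθ hσ (abs_nonneg t)
    have e1 : acov P x |t| = acov P x t := by rw [acov, acov, abs_abs]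
    rw [e1] at e
    simp only [hG]
    linarith
  rw [this]
  exact (continuous_const.sub (continuous_const.mul (cp.comp continuous_abs))).add
    (continuous_const.mul (cGG.comp continuous_abs))

lemma acov_eq_spectral (h : ContFOU P H θ μ σ b x) (hH : 0 < H) (hH1 : H < 1) (hθ : 0 < θ)
    (hσ : σ ≠ 0) {t : ℝ} (ht : 0 ≤ t) : acov P x 0 - acov P x t = 2 * fouZeta H θ σ *
      ∫ l in Set.Ioi (0 : ℝ), (1 - Real.cos (l * t)) * fouSpectral H θ l :=
  variance_eq_spectral hH hH1 hθ σ (h.continuous_acov hH hθ hσ)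
    (fun t _ => h.abs_acov_le hH hθ hσ t) (fun _ ht => h.acov_equation hH hθ hσ ht) ht

lemma exists_isRoughVariance (h : ContFOU P H θ μ σ b x) (hH : 0 < H) (hθ : 0 < θ)
    (hσ : σ ≠ 0) {T α : ℝ} (hT : 0 < T) (h0 : 0 < α) (h1 : α < 1) (hα : α ≤ 2 * H) :
    ∃ C, 0 ≤ C ∧ IsRoughVariance (fun t => acov P x 0 - acov P x t) T α C :=
  isRoughVariance_of_equation hH h0 h1 hα hT (h.continuous_acov hH hθ hσ)
    (fun t _ => h.abs_acov_le hH hθ hσ t) (fun _ ht => h.acov_equation hH hθ hσ ht)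

lemma integral_sub_sq (h : ContFOU P H θ μ σ b x) (hH : 0 < H) (hθ : 0 < θ) (hσ : σ ≠ 0) {s t : ℝ}
    (hs : 0 ≤ s) (hst : s ≤ t) :
    ∫ ω, (x t ω - x s ω) ^ 2 ∂P = 2 * (acov P x 0 - acov P x (t - s)) := by
  have ht := hs.trans hst
  have e : ∀ ω, (x t ω - x s ω) ^ 2 = centered P x t ω ^ 2 + centered P x s ω ^ 2 -
      2 * (centered P x s ω * centered P x t ω) := fun ω => by
    rw [centered, centered]; ring
  have i1 := (h.memLp_centered hH hθ hσ ht).integrable_sq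
  have i2 := (h.memLp_centered hH hθ hσ hs).integrable_sq
  have i3 := ((h.memLp_centered hH hθ hσ hs).integrable_mul (h.memLp_centered hH hθ hσ ht)).const_mul 2
  simp only [e]
  have := integral_sub (i1.add i2) i3
  simp only [Pi.add_apply, Pi.mul_apply] at this
  rw [this, integral_add i1 i2, integral_const_mul, h.integral_centered_sq ht,
    h.integral_centered_sq hs, h.integral_centered_mul_of_le hs hst]
  ring

lemma covariance_eq (h : ContFOU P H θ μ σ b x) {t : ℝ} (ht : 0 ≤ t) :
    cov[x 0, x t; P] = acov P x t := by
  rw [covariance, acov, abs_of_nonneg ht, h.integral_eq ht]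
  rfl

end ContFOU

end

noncomputable section

/-! ### Limits along dissections -/

namespace Dissection

/-- The dissection of `[0, T]` into `n + 1` cells of equal length. -/
def uniform {T : ℝ} (hT : 0 < T) (n : ℕ) : Dissection T where
  n := n + 1
  pt k := T * k / (n + 1)
  strictMono a b h := by
    have : ((a : ℕ) : ℝ) < (b : ℕ) := by exact_mod_cast h
    simp only
    gcongr
  first := by simp
  last := by simp; field_simp

lemma mesh_uniform_le {T : ℝ} (hT : 0 < T) (n : ℕ) : (uniform hT n).mesh ≤ T / (n + 1) := by
  have : Nonempty (Fin (uniform hT n).n) := ⟨⟨0, Nat.succ_pos n⟩⟩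
  refine ciSup_le fun k => le_of_eq ?_
  have e1 : ((k.succ : ℕ) : ℝ) = (k : ℕ) + 1 := by simp
  have e2 : ((k.castSucc : ℕ) : ℝ) = (k : ℕ) := by simp
  change T * ((k.succ : ℕ) : ℝ) / (n + 1) - T * ((k.castSucc : ℕ) : ℝ) / (n + 1) = _
  rw [e1, e2]
  ring

lemma tendsto_mesh_uniform {T : ℝ} (hT : 0 < T) :
    Tendsto (fun n => (uniform hT n).mesh) atTop (𝓝 0) :=
  squeeze_zero (fun n => mesh_nonneg _) (mesh_uniform_le hT)
    (by simpa [div_eq_mul_one_div T] using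
      (tendsto_one_div_add_atTop_nhds_zero_nat (𝕜 := ℝ)).const_mul T)

/-- The dissection of `[0, T]` into a single cell. -/
def single {T : ℝ} (hT : 0 < T) : Dissection T where
  n := 1
  pt := ![0, T]
  strictMono := by
    rw [Fin.strictMono_iff_lt_succ]
    intro i
    fin_cases i
    simpa using hT
  first := rfl
  last := rfl

end Dissection

section
variable {Ω : Type*} [MeasurableSpace Ω] {P : Measure Ω}

/-- A family indexed by dissections that is Cauchy in `L²` as the mesh tends to zero converges. -/
lemma exists_memLp_limit_of_mesh {T : ℝ} (hT : 0 < T) {F : Dissection T → Ω → ℝ}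
    (hF : ∀ D, MemLp (F D) 2 P) {g : ℝ → ℝ≥0∞} (hg : Tendsto g (𝓝 0) (𝓝 0))
    (h : ∀ D D', eLpNorm (fun ω => F D ω - F D' ω) 2 P ≤ g D.mesh + g D'.mesh) :
    ∃ S : Ω → ℝ, MemLp S 2 P ∧ ∀ D : ℕ → Dissection T,
      Tendsto (fun n => (D n).mesh) atTop (𝓝 0) →
        Tendsto (fun n => eLpNorm (fun ω => F (D n) ω - S ω) 2 P) atTop (𝓝 0) := by
  -- The limit is built along uniform dissections; any other sequence is then compared with this
  -- one.
  set U : ℕ → Dissection T := Dissection.uniform hT with hU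
  have hgU : Tendsto (fun n => g (U n).mesh) atTop (𝓝 0) :=
    hg.comp (Dissection.tendsto_mesh_uniform hT)
  have hc : CauchySeq fun n => (hF (U n)).toLp := by
    rw [EMetric.cauchySeq_iff]
    intro ε hε
    have hε2 : 0 < ε / 2 := ENNReal.half_pos hε.ne'
    obtain ⟨N, hN⟩ := eventually_atTop.1 (hgU.eventually_lt_const hε2)
    refine ⟨N, fun m hm n hn => ?_⟩
    rw [Lp.edist_toLp_toLp]
    refine (h _ _).trans_lt ?_
    rw [← ENNReal.add_halves ε]
    exact ENNReal.add_lt_add (hN m hm) (hN n hn)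
  obtain ⟨S, hS⟩ := cauchySeq_tendsto_of_complete hc
  have hSU : Tendsto (fun n => eLpNorm (fun ω => F (U n) ω - S ω) 2 P) atTop (𝓝 0) := by
    rw [Lp.tendsto_Lp_iff_tendsto_eLpNorm'] at hS
    refine hS.congr fun n => eLpNorm_congr_ae ?_
    filter_upwards [(hF (U n)).coeFn_toLp] with ω hω
    simp [hω]
  refine ⟨S, Lp.memLp S, fun D hD => ?_⟩
  have hlim : Tendsto (fun n => g (D n).mesh + g (U n).mesh +
      eLpNorm (fun ω => F (U n) ω - S ω) 2 P) atTop (𝓝 0) := by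
    simpa using ((hg.comp hD).add hgU).add hSU
  refine tendsto_of_tendsto_of_tendsto_of_le_of_le tendsto_const_nhds hlim (fun _ => zero_le)
    fun n => ?_
  have e : (fun ω => F (D n) ω - S ω) = (fun ω => F (D n) ω - F (U n) ω) +
      fun ω => F (U n) ω - S ω := by
    funext ω; simp
  simp only
  rw [e]
  refine (eLpNorm_add_le ((hF _).sub (hF _)).aestronglyMeasurable
    ((hF _).sub (Lp.memLp S)).aestronglyMeasurable one_le_two).trans ?_
  exact add_le_add (h _ _) le_rfl

lemma tendsto_integral_of_tendsto_eLpNorm_two [IsProbabilityMeasure P] {F : ℕ → Ω → ℝ} {S : Ω → ℝ}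
    (hF : ∀ n, MemLp (F n) 2 P) (hS : MemLp S 2 P)
    (h : Tendsto (fun n => eLpNorm (fun ω => F n ω - S ω) 2 P) atTop (𝓝 0)) :
    Tendsto (fun n => ∫ ω, F n ω ∂P) atTop (𝓝 (∫ ω, S ω ∂P)) := by
  refine tendsto_integral_of_L1' S hS.aestronglyMeasurable
    (Eventually.of_forall fun n => (hF n).integrable one_le_two) ?_
  refine tendsto_of_tendsto_of_tendsto_of_le_of_le tendsto_const_nhds h (fun _ => zero_le)
    fun n => ?_
  exact eLpNorm_le_eLpNorm_of_exponent_le one_le_two ((hF n).sub hS).aestronglyMeasurable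

/-- With symmetric averages the summands are exact differences of `x_T x - x² / 2`, so the
dissection plays no role. -/
lemma trapezoid_self {T : ℝ} (D : Dissection T) (x : ℝ → ℝ) :
    trapezoid D x x = (x T - x 0) ^ 2 / 2 := by
  set f : ℕ → ℝ := fun k => x T * x (D.node k) - x (D.node k) ^ 2 / 2 with hf
  have : trapezoid D x x = ∑ k ∈ Finset.range D.n, (f (k + 1) - f k) :=
    Finset.sum_congr rfl fun k _ => by simp only [hf]; ring
  rw [this, Finset.sum_range_sub, hf]
  simp only [D.node_n, D.node_zero]
  ring

lemma plSig_incrPath {Ω : Type*} {d : ℕ} (X : Fin d → ℝ≥0 → Ω → ℝ) {T : ℝ} (hT : 0 < T) (D : Dissection T)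
    (ω : Ω) (i j : Fin d) : plSig D (incrPath X ω) 0 T [i, j] =
      trapezoid D (fun t => X i t.toNNReal ω) (fun t => X j t.toNNReal ω) := by
  rw [plSig_two hT]
  exact Finset.sum_congr rfl fun k _ => by simp only [incrPath]; ring

lemma IsRoughVariance.mono {v : ℝ → ℝ} {T α C C' : ℝ} (h : IsRoughVariance v T α C) (h0 : 0 ≤ α)
    (h1 : α ≤ 1) (hC : C ≤ C') : IsRoughVariance v T α C' where
  diff_le a b ha hab hb := (h.diff_le ha hab hb).trans
    (mul_le_mul_of_nonneg_right hC (sub_nonneg.2 (Real.rpow_le_rpow ha hab h0)))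
  second_diff_le x a b hx ha hb hT := by
    refine (h.second_diff_le hx ha hb hT).trans (mul_le_mul_of_nonneg_right hC ?_)
    have := rectIncr_rpow_nonneg h0 h1 (a := 0) (b := a) (c := x + a) (d := x + a + b) ha
      (by linarith) (by linarith)
    rw [rectIncr] at this
    rw [sub_zero, sub_zero, show x + a + b - a = x + b by ring, show x + a - a = x by ring] at this
    linarith

/-- A one-cell dissection bounds the coordinates over `[0, T]` by the `p`-variation distance. -/
lemma ofReal_abs_sub_le_pVarDist {d : ℕ} {p T : ℝ} (hT : 0 < T) (hp : 2 ≤ p)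
    (A B : ℝ → ℝ → List (Fin d) → ℝ) (i j : Fin d) :
    ENNReal.ofReal |A 0 T [i, j] - B 0 T [i, j]| ≤ pVarDist p T A B := by
  have hlen : 1 ≤ [i, j].length ∧ [i, j].length ≤ ⌊p⌋₊ :=
    ⟨by simp, by simpa using Nat.le_floor (by exact_mod_cast hp)⟩
  refine le_trans (le_of_eq ?_) (le_iSup₂_of_le [i, j] hlen
    (le_iSup_of_le (Dissection.single hT) le_rfl))
  have hsum : ∀ f : Fin (Dissection.single hT).n → ℝ≥0∞, ∑ k, f k = f ⟨0, Nat.one_pos⟩ := fun f =>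
    Fin.sum_univ_one f
  rw [hsum, ← ENNReal.rpow_mul]
  have e : p / ([i, j].length : ℝ) * (([i, j].length : ℝ) / p) = 1 := by
    have : p ≠ 0 := by linarith
    simp; field_simp
  rw [e, ENNReal.rpow_one]
  rfl

end

/-! ### The stationary fractional Ornstein-Uhlenbeck process -/

namespace IsStationaryFOU
set_option linter.unusedSectionVars false

variable {Ω : Type*} [MeasurableSpace Ω] {P : Measure Ω} {H : ℝ} {d : ℕ}
  {θ μ σ : Fin d → ℝ} {B X : Fin d → ℝ≥0 → Ω → ℝ}

lemma exists_contFOU [IsProbabilityMeasure P] (hX : IsStationaryFOU P H θ μ σ B X) (hH : 0 < H)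
    (i : Fin d) :
    ∃ b x, ContFOU P H (θ i) (μ i) (σ i) b x ∧ ∀ᵐ ω ∂P, ∀ t : ℝ, x t ω = X i t.toNNReal ω := by
  obtain ⟨X', mX, cX, eX⟩ := exists_continuous_modification (hX.measurable i) (hX.continuous i)
  obtain ⟨B', mB, cB, eB⟩ :=
    exists_continuous_modification (hX.fbm i).measurable (hX.fbm i).continuous
  have hL : ∀ t, MemLp (B i t) 2 P := fun t => ((hX.fbm i).gaussian.hasGaussianLaw_eval t).memLp_two
  refine ⟨fun t => B' t.toNNReal, fun t => X' t.toNNReal, ⟨fun ω => (cB ω).comp continuous_real_toNNReal,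
    fun ω => (cX ω).comp continuous_real_toNNReal, fun t => mB _, fun t => mX _, ?_, ?_, ?_, ?_, ?_⟩,
    by filter_upwards [eX] with ω h t using h _⟩
  · filter_upwards [hX.equation i, eX, eB] with ω h1 h2 h3 t ht
    have := h1 t.toNNReal
    rw [Real.coe_toNNReal t ht] at this
    simp only [h2, h3, Real.toNNReal_zero]
    exact this
  · intro τ s t hτ hs ht
    have h := (hX.stationary τ.toNNReal 2 ![s.toNNReal, t.toNNReal]).comp
      (u := fun f : Fin 2 → Fin d → ℝ => (f 0 i, f 1 i)) (by fun_prop)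
    simp only [Function.comp_def, Matrix.cons_val_zero, Matrix.cons_val_one] at h
    rw [Real.toNNReal_add hτ hs, Real.toNNReal_add hτ ht]
    refine (IdentDistrib.of_ae_eq ((mX _).prodMk (mX _)).aemeasurable ?_).trans (h.trans
      (IdentDistrib.of_ae_eq ((mX _).prodMk (mX _)).aemeasurable ?_).symm)
    · filter_upwards [eX] with ω hω
      rw [hω, hω]
    · filter_upwards [eX] with ω hω
      rw [hω, hω]
  · intro s t
    refine ((hX.fbm i).gaussian.hasGaussianLaw_fun_sub (s := t.toNNReal)
      (t := s.toNNReal)).congr ?_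
    filter_upwards [eB] with ω hω
    rw [hω, hω]
  · intro t
    rw [← (hX.fbm i).mean_zero t.toNNReal]
    refine integral_congr_ae ?_
    filter_upwards [eB] with ω hω using hω _
  · intro s t hs hst
    have hvar : ∀ t, Var[B i t; P] = (t : ℝ) ^ (2 * H) := fun t => by
      have h0 := (hX.fbm i).covariance t t
      rw [covariance_self ((hX.fbm i).measurable t).aemeasurable, sub_self, abs_zero,
        Real.zero_rpow (by positivity)] at h0
      rw [h0]
      ring
    have e : Var[fun ω => B' t.toNNReal ω - B' s.toNNReal ω; P] =
        Var[fun ω => B i t.toNNReal ω - B i s.toNNReal ω; P] := by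
      refine variance_congr ?_
      filter_upwards [eB] with ω hω
      rw [hω, hω]
    rw [e, variance_fun_sub (hL _) (hL _), hvar, hvar, (hX.fbm i).covariance,
      Real.coe_toNNReal t (hs.trans hst), Real.coe_toNNReal s hs, abs_of_nonneg (sub_nonneg.2 hst)]
    ring

/-! ### The level-2 signature: moments, existence, uniqueness and comparison with lifts -/

variable [IsProbabilityMeasure P]

lemma memLp_four (hX : IsStationaryFOU P H θ μ σ B X) (hH : 0 < H) (hθ : ∀ i, 0 < θ i)
    (hσ : ∀ i, 0 < σ i) (i : Fin d) (t : ℝ≥0) : MemLp (X i t) 4 P := by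
  obtain ⟨b, x, h, hx⟩ := hX.exists_contFOU hH i
  refine (h.memLp_four hH (hθ i) (hσ i).ne' t.2).ae_eq ?_
  filter_upwards [hx] with ω hω
  simpa using hω t

lemma memLp_two (hX : IsStationaryFOU P H θ μ σ B X) (hH : 0 < H) (hθ : ∀ i, 0 < θ i)
    (hσ : ∀ i, 0 < σ i) (i : Fin d) (t : ℝ≥0) : MemLp (X i t) 2 P :=
  (hX.memLp_four hH hθ hσ i t).mono_exponent (by norm_num)

lemma integral_eq (hX : IsStationaryFOU P H θ μ σ B X) (hH : 0 < H) (i : Fin d) (t : ℝ≥0) :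
    ∫ ω, X i t ω ∂P = ∫ ω, X i 0 ω ∂P := by
  obtain ⟨b, x, h, hx⟩ := hX.exists_contFOU hH i
  have e : ∀ t : ℝ≥0, ∫ ω, x t ω ∂P = ∫ ω, X i t ω ∂P := fun t => by
    refine integral_congr_ae ?_
    filter_upwards [hx] with ω hω
    simpa using hω t
  have := h.integral_eq t.2
  rw [← e, ← e]
  exact this

lemma autocov_eq {b x : ℝ → Ω → ℝ} {i : Fin d} (h : ContFOU P H (θ i) (μ i) (σ i) b x)
    (hx : ∀ᵐ ω ∂P, ∀ t : ℝ, x t ω = X i t.toNNReal ω) (t : ℝ≥0) :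
    autocov P X i t = ContFOU.acov P x t := by
  have e : ∀ t : ℝ≥0, x t =ᵐ[P] X i t := fun t => by
    filter_upwards [hx] with ω hω
    simpa using hω t
  rw [← h.covariance_eq t.coe_nonneg, autocov]
  have e0 : x 0 =ᵐ[P] X i 0 := by simpa using e 0
  rw [covariance, covariance, integral_congr_ae e0, integral_congr_ae (e t)]
  refine integral_congr_ae ?_
  filter_upwards [e0, e t] with ω h1 h2
  rw [h1, h2]

lemma integral_sub_sq (hX : IsStationaryFOU P H θ μ σ B X) (hH : 0 < H) (hθ : ∀ i, 0 < θ i)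
    (hσ : ∀ i, 0 < σ i) (i : Fin d) (t : ℝ≥0) :
    ∫ ω, (X i t ω - X i 0 ω) ^ 2 ∂P = 2 * (autocov P X i 0 - autocov P X i t) := by
  obtain ⟨b, x, h, hx⟩ := hX.exists_contFOU hH i
  rw [autocov_eq h hx, autocov_eq h hx]
  have := h.integral_sub_sq hH (hθ i) (hσ i).ne' le_rfl t.2
  rw [sub_zero] at this
  rw [NNReal.coe_zero]
  refine Eq.trans (integral_congr_ae ?_) this
  filter_upwards [hx] with ω hω
  rw [hω, hω]
  simp

lemma exists_isRoughVariance (hX : IsStationaryFOU P H θ μ σ B X) (hH : 0 < H)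
    (hθ : ∀ i, 0 < θ i) (hσ : ∀ i, 0 < σ i) (i : Fin d) {T α : ℝ} (hT : 0 < T) (h0 : 0 < α)
    (h1 : α < 1) (hα : α ≤ 2 * H) : ∃ (v : ℝ → ℝ) (C : ℝ), 0 ≤ C ∧ IsRoughVariance v T α C ∧
      ∀ s t, 0 ≤ s → s ≤ t → ∫ ω, (X i t.toNNReal ω - X i s.toNNReal ω) ^ 2 ∂P = 2 * v (t - s) := by
  obtain ⟨b, x, h, hx⟩ := hX.exists_contFOU hH i
  obtain ⟨C, hC, hv⟩ := h.exists_isRoughVariance hH (hθ i) (hσ i).ne' hT h0 h1 hα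
  refine ⟨_, C, hC, hv, fun s t hs hst => ?_⟩
  rw [← h.integral_sub_sq hH (hθ i) (hσ i).ne' hs hst]
  refine integral_congr_ae ?_
  filter_upwards [hx] with ω hω
  rw [hω, hω]

lemma indepFun (hX : IsStationaryFOU P H θ μ σ B X) {i j : Fin d} (hij : i ≠ j) :
    IndepFun (fun ω (t : ℝ) => X i t.toNNReal ω) (fun ω (t : ℝ) => X j t.toNNReal ω) P :=
  (hX.indep_coord.indepFun hij).comp (φ := fun (f : ℝ≥0 → ℝ) (t : ℝ) => f t.toNNReal)
    (ψ := fun (f : ℝ≥0 → ℝ) (t : ℝ) => f t.toNNReal) (by fun_prop) (by fun_prop)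

/-- The diagonal entry is a squared increment and uses the fourth moments; off the diagonal,
independence makes second moments sufficient. -/
lemma memLp_plSig (hX : IsStationaryFOU P H θ μ σ B X) (hH : 0 < H) (hθ : ∀ i, 0 < θ i)
    (hσ : ∀ i, 0 < σ i) {T : ℝ} (hT : 0 < T) (D : Dissection T) (i j : Fin d) :
    MemLp (fun ω => plSig D (incrPath X ω) 0 T [i, j]) 2 P := by
  simp only [plSig_incrPath X hT]
  rcases eq_or_ne i j with rfl | hij
  · simp only [trapezoid_self, div_eq_mul_inv]
    have h4 : MemLp (fun ω => X i T.toNNReal ω - X i (0 : ℝ).toNNReal ω) 4 P :=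
      (hX.memLp_four hH hθ hσ i _).sub (hX.memLp_four hH hθ hσ i _)
    have e4 : (4 : ℝ≥0∞)⁻¹ = 2⁻¹ / 2 := by
      rw [div_eq_mul_inv, ← ENNReal.mul_inv (by simp) (by simp)]; norm_num
    have : ENNReal.HolderTriple 4 4 2 := ⟨by rw [e4, ENNReal.add_halves]⟩
    have := h4.mul (r := 2) h4
    refine (this.mul_const 2⁻¹).ae_eq (Eventually.of_forall fun ω => ?_)
    simp only [Pi.mul_apply, sq]
  · have hL : ∀ k (t : ℝ), MemLp (fun ω => X k t.toNNReal ω) 2 P :=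
      fun k t => hX.memLp_two hH hθ hσ k _
    refine memLp_two_sum_mul_of_indep _ (fun k => (hL i _).sub (hL i _)) (fun k => ?_) fun k l => ?_
    · simp only [div_eq_mul_inv]
      exact (hL j _).sub (((hL j _).add (hL j _)).mul_const _)
    · exact (hX.indepFun hij).comp
        (φ := fun f : ℝ → ℝ => (f (D.node (k + 1)) - f (D.node k)) *
          (f (D.node (l + 1)) - f (D.node l)))
        (ψ := fun f : ℝ → ℝ => (f T - (f (D.node k) + f (D.node (k + 1))) / 2) *
          (f T - (f (D.node l) + f (D.node (l + 1))) / 2)) (by fun_prop) (by fun_prop)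

/-- The value is the same for all dissections, so it passes to the limit unchanged. Off the diagonal
each summand is a product of independent factors, the first being centered by stationarity. -/
lemma integral_plSig (hX : IsStationaryFOU P H θ μ σ B X) (hH : 0 < H) (hθ : ∀ i, 0 < θ i)
    (hσ : ∀ i, 0 < σ i) {T : ℝ≥0} (hT : 0 < T) (D : Dissection T) (i j : Fin d) :
    ∫ ω, plSig D (incrPath X ω) 0 T [i, j] ∂P =
      if i = j then autocov P X i 0 - autocov P X i T else 0 := by
  simp only [plSig_incrPath X (NNReal.coe_pos.2 hT)]
  rcases eq_or_ne i j with rfl | hij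
  · simp only [trapezoid_self, Real.toNNReal_coe, Real.toNNReal_zero, if_true]
    rw [integral_div, hX.integral_sub_sq hH hθ hσ]
    ring
  · rw [if_neg hij]
    have hL : ∀ k (t : ℝ), MemLp (fun ω => X k t.toNNReal ω) 2 P :=
      fun k t => hX.memLp_two hH hθ hσ k _
    set A : ℕ → Ω → ℝ := fun k ω => X i (D.node (k + 1)).toNNReal ω - X i (D.node k).toNNReal ω
      with hAdef
    set Y : ℕ → Ω → ℝ := fun k ω => X j (T : ℝ).toNNReal ω - (X j (D.node k).toNNReal ω +
      X j (D.node (k + 1)).toNNReal ω) / 2 with hYdef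
    have hA : ∀ k, MemLp (A k) 2 P := fun k => (hL i _).sub (hL i _)
    have hY : ∀ k, MemLp (Y k) 2 P := fun k => by
      simp only [hYdef, div_eq_mul_inv]
      exact (hL j _).sub (((hL j _).add (hL j _)).mul_const _)
    have hind : ∀ k, IndepFun (A k) (Y k) P := fun k =>
      (hX.indepFun hij).comp (φ := fun f : ℝ → ℝ => f (D.node (k + 1)) - f (D.node k))
        (ψ := fun f : ℝ → ℝ => f T - (f (D.node k) + f (D.node (k + 1))) / 2)
        (by fun_prop) (by fun_prop)
    have hint : ∀ k, Integrable (fun ω => A k ω * Y k ω) P := fun k =>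
      (hind k).integrable_mul ((hA k).integrable one_le_two) ((hY k).integrable one_le_two)
    change ∫ ω, ∑ k ∈ Finset.range D.n, A k ω * Y k ω ∂P = 0
    rw [integral_finsetSum _ fun k _ => hint k]
    refine Finset.sum_eq_zero fun k _ => ?_
    rw [(hind k).integral_fun_mul_eq_mul_integral (hA k).aestronglyMeasurable
      (hY k).aestronglyMeasurable]
    have : ∫ ω, A k ω ∂P = 0 := by
      rw [hAdef, integral_sub ((hL i _).integrable one_le_two) ((hL i _).integrable one_le_two),
        hX.integral_eq hH, hX.integral_eq hH i (D.node k).toNNReal, sub_self]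
    rw [this, zero_mul]

lemma exists_modulus (hX : IsStationaryFOU P H θ μ σ B X) (hH : 1 / 4 < H) (hθ : ∀ i, 0 < θ i)
    (hσ : ∀ i, 0 < σ i) {T : ℝ} (hT : 0 < T) (i j : Fin d) :
    ∃ g : ℝ → ℝ≥0∞, Tendsto g (𝓝 0) (𝓝 0) ∧ ∀ D D' : Dissection T,
      eLpNorm (fun ω => plSig D (incrPath X ω) 0 T [i, j] - plSig D' (incrPath X ω) 0 T [i, j]) 2 P
        ≤ g D.mesh + g D'.mesh := by
  have hH0 : 0 < H := by linarith
  rcases eq_or_ne i j with rfl | hij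
  · refine ⟨fun _ => 0, tendsto_const_nhds, fun D D' => ?_⟩
    simp only [plSig_incrPath X hT, trapezoid_self, sub_self]
    simp
  -- The estimates need `α ≤ 2H` for the variance function, `α < 1` for concavity and `α > 1/2` for
  -- `mesh ^ (2α - 1)` to vanish; this is where `H > 1/4` enters. Any number strictly between `1/2`
  -- and `1` could replace `3/4`.
  set α := min (2 * H) (3 / 4) with hα
  have h0 : 1 / 2 < α := lt_min (by linarith) (by norm_num)
  have h1 : α < 1 := (min_le_right _ _).trans_lt (by norm_num)
  obtain ⟨v, C, hC, hv, hvX⟩ := hX.exists_isRoughVariance hH0 hθ hσ i hT (by linarith) h1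
    (min_le_left _ _)
  obtain ⟨v', C', hC', hv', hvX'⟩ := hX.exists_isRoughVariance hH0 hθ hσ j hT (by linarith) h1
    (min_le_left _ _)
  refine ⟨fun m => ENNReal.ofReal (Real.sqrt (areaConst α (max C C') * (m ^ (2 * α - 1) * T))),
    ?_, fun D D' => ?_⟩
  · have hc : Continuous fun m : ℝ =>
        ENNReal.ofReal (Real.sqrt (areaConst α (max C C') * (m ^ (2 * α - 1) * T))) :=
      ENNReal.continuous_ofReal.comp (Real.continuous_sqrt.comp (continuous_const.mul
        ((Real.continuous_rpow_const (by linarith)).mul continuous_const)))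
    have := hc.tendsto 0
    rwa [Real.zero_rpow (by linarith), zero_mul, mul_zero, Real.sqrt_zero, ENNReal.ofReal_zero]
      at this
  · have hm : ∀ D : Dissection T, AEStronglyMeasurable (fun ω => trapezoid D
        (fun t => X i t.toNNReal ω) (fun t => X j t.toNNReal ω)) P := fun D => by
      simp only [← plSig_incrPath X hT]
      exact (hX.memLp_plSig hH0 hθ hσ hT D i j).aestronglyMeasurable
    simp only [plSig_incrPath X hT]
    exact eLpNorm_trapezoid_sub_le (X := fun t => X i t.toNNReal) (Y := fun t => X j t.toNNReal)
      (fun t => hX.memLp_two hH0 hθ hσ i _) (fun t => hX.memLp_two hH0 hθ hσ j _)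
      (hX.indepFun hij) (hC.trans (le_max_left _ _)) h0 h1
      (hv.mono (by linarith) h1.le (le_max_left _ _))
      (hv'.mono (by linarith) h1.le (le_max_right _ _))
      (fun s t hs hst _ => hvX s t hs hst) (fun s t hs hst _ => hvX' s t hs hst) D D' hm

theorem exists_isLevelTwoSignature (hX : IsStationaryFOU P H θ μ σ B X) (hH : 1 / 4 < H)
    (hθ : ∀ i, 0 < θ i) (hσ : ∀ i, 0 < σ i) {T : ℝ} (hT : 0 < T) :
    ∃ S, IsLevelTwoSignature P X T S := by
  have : ∀ i j, ∃ S : Ω → ℝ, MemLp S 2 P ∧ ∀ D : ℕ → Dissection T,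
      Tendsto (fun n => (D n).mesh) atTop (𝓝 0) → Tendsto
        (fun n => eLpNorm (fun ω => plSig (D n) (incrPath X ω) 0 T [i, j] - S ω) 2 P)
        atTop (𝓝 0) := fun i j => by
    obtain ⟨g, hg, hgD⟩ := hX.exists_modulus hH hθ hσ hT i j
    exact exists_memLp_limit_of_mesh hT
      (F := fun D ω => plSig D (incrPath X ω) 0 T [i, j]) (fun D => hX.memLp_plSig (by linarith) hθ hσ hT D i j) hg hgD
  choose S hS using this
  exact ⟨S, fun i j => hS i j⟩

lemma tendstoInMeasure (hX : IsStationaryFOU P H θ μ σ B X) (hH : 0 < H)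
    (hθ : ∀ i, 0 < θ i) (hσ : ∀ i, 0 < σ i) {T : ℝ} (hT : 0 < T) {S : Fin d → Fin d → Ω → ℝ}
    (hS : IsLevelTwoSignature P X T S) (i j : Fin d) :
    TendstoInMeasure P (fun n ω => plSig (Dissection.uniform hT n) (incrPath X ω) 0 T [i, j]) atTop
      (S i j) :=
  tendstoInMeasure_of_tendsto_eLpNorm two_ne_zero
    (fun _ => (hX.memLp_plSig hH hθ hσ hT _ i j).aestronglyMeasurable)
    (hS i j).1.aestronglyMeasurable ((hS i j).2 _ (Dissection.tendsto_mesh_uniform hT))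

theorem isLevelTwoSignature_unique (hX : IsStationaryFOU P H θ μ σ B X) (hH : 0 < H)
    (hθ : ∀ i, 0 < θ i) (hσ : ∀ i, 0 < σ i) {T : ℝ} (hT : 0 < T) {S S' : Fin d → Fin d → Ω → ℝ}
    (hS : IsLevelTwoSignature P X T S) (hS' : IsLevelTwoSignature P X T S') (i j : Fin d) :
    S i j =ᵐ[P] S' i j :=
  tendstoInMeasure_ae_unique (hX.tendstoInMeasure hH hθ hσ hT hS i j)
    (hX.tendstoInMeasure hH hθ hσ hT hS' i j)

theorem integral_levelTwoSignature (hX : IsStationaryFOU P H θ μ σ B X) (hH : 0 < H)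
    (hθ : ∀ i, 0 < θ i) (hσ : ∀ i, 0 < σ i) {T : ℝ≥0} (hT : 0 < T) {S : Fin d → Fin d → Ω → ℝ}
    (hS : IsLevelTwoSignature P X T S) (i j : Fin d) :
    ∫ ω, S i j ω ∂P = if i = j then autocov P X i 0 - autocov P X i T else 0 := by
  have hT' : (0 : ℝ) < T := NNReal.coe_pos.2 hT
  have := tendsto_integral_of_tendsto_eLpNorm_two
    (fun n => hX.memLp_plSig hH hθ hσ hT' (Dissection.uniform hT' n) i j) (hS i j).1
    ((hS i j).2 _ (Dissection.tendsto_mesh_uniform hT'))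
  simp only [hX.integral_plSig hH hθ hσ hT] at this
  exact tendsto_nhds_unique this tendsto_const_nhds

/-- Since `p ≥ 2`, level 2 is part of the rough path distance, and the one-cell dissection bounds
its value over `[0, T]`. Along uniform dissections the same integrals thus converge in probability
to both sides. -/
theorem ae_eq_of_isCanonicalLift (hX : IsStationaryFOU P H θ μ σ B X) (hH : 0 < H)
    (hθ : ∀ i, 0 < θ i) (hσ : ∀ i, 0 < σ i) {T p : ℝ} (hT : 0 < T) (hp : 2 ≤ p)
    {S : Fin d → Fin d → Ω → ℝ} (hS : IsLevelTwoSignature P X T S)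
    {L : Ω → ℝ → ℝ → List (Fin d) → ℝ} (hL : IsCanonicalLift P X p T L) (i j : Fin d) :
    S i j =ᵐ[P] fun ω => L ω 0 T [i, j] := by
  refine tendstoInMeasure_ae_unique (hX.tendstoInMeasure hH hθ hσ hT hS i j) fun ε hε => ?_
  refine tendsto_of_tendsto_of_tendsto_of_le_of_le tendsto_const_nhds
    (hL.2 _ (Dissection.tendsto_mesh_uniform hT) ε hε) (fun _ => zero_le) fun n => ?_
  refine measure_mono fun ω hω => ?_
  refine le_trans ?_ (ofReal_abs_sub_le_pVarDist hT hp _ _ i j)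
  rw [← Real.dist_eq, ← edist_dist]
  exact hω

theorem isLevelTwoSignature_of_isCanonicalLift (hX : IsStationaryFOU P H θ μ σ B X)
    (hH : 1 / 4 < H) (hθ : ∀ i, 0 < θ i) (hσ : ∀ i, 0 < σ i) {T p : ℝ} (hT : 0 < T) (hp : 2 ≤ p)
    {L : Ω → ℝ → ℝ → List (Fin d) → ℝ} (hL : IsCanonicalLift P X p T L) :
    IsLevelTwoSignature P X T fun i j ω => L ω 0 T [i, j] := by
  obtain ⟨S, hS⟩ := hX.exists_isLevelTwoSignature hH hθ hσ hT
  intro i j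
  have h := hX.ae_eq_of_isCanonicalLift (by linarith) hθ hσ hT hp hS hL i j
  refine ⟨(hS i j).1.ae_eq h, fun D hD => ((hS i j).2 D hD).congr fun n => eLpNorm_congr_ae ?_⟩
  filter_upwards [h] with ω hω
  rw [hω]

theorem autocov_sub_eq (hX : IsStationaryFOU P H θ μ σ B X) (hH : 0 < H) (hH1 : H < 1)
    (hθ : ∀ i, 0 < θ i) (hσ : ∀ i, 0 < σ i) (i : Fin d) (t : ℝ≥0) :
    autocov P X i 0 - autocov P X i t = 2 * fouZeta H (θ i) (σ i) *
      ∫ l in Set.Ioi (0 : ℝ), (1 - Real.cos (l * t)) * fouSpectral H (θ i) l := by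
  obtain ⟨b, x, h, hx⟩ := hX.exists_contFOU hH i
  rw [autocov_eq h hx, autocov_eq h hx]
  exact h.acov_eq_spectral hH hH1 (hθ i) (hσ i).ne' t.2

end IsStationaryFOU

end

theorem mainTheorem9 {Ω : Type*} [MeasurableSpace Ω] (P : Measure Ω) [IsProbabilityMeasure P]
    {d : ℕ} (H : ℝ) (hH : 1 / 4 < H) (hH1 : H < 1)
    (θ μ σ : Fin d → ℝ) (hθ : ∀ i, 0 < θ i) (hσ : ∀ i, 0 < σ i)
    (B X : Fin d → ℝ≥0 → Ω → ℝ) (hX : IsStationaryFOU P H θ μ σ B X)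
    (Δ : ℝ≥0) (hΔ : 0 < Δ) :
    -- the level-2 signature over `[0, Δ]` exists, it is unique up to null sets, and its
    -- expectation is finite with the stated value
    (∃ S, IsLevelTwoSignature P X Δ S) ∧
    (∀ S S', IsLevelTwoSignature P X Δ S → IsLevelTwoSignature P X Δ S' →
      ∀ i j, S i j =ᵐ[P] S' i j) ∧
    (∀ S, IsLevelTwoSignature P X Δ S → ∀ i j, Integrable (S i j) P ∧
      ∫ ω, S i j ω ∂P = if i = j then autocov P X i 0 - autocov P X i Δ else 0) ∧
    -- the same for the level-2 component of the canonical geometric rough path lift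
    (∀ p : ℝ, max 2 (1 / H) < p → ∀ L, IsCanonicalLift P X p Δ L →
      IsLevelTwoSignature P X Δ (fun i j ω => L ω 0 Δ [i, j]) ∧
      ∀ i j, Integrable (fun ω => L ω 0 Δ [i, j]) P ∧
        ∫ ω, L ω 0 Δ [i, j] ∂P = if i = j then autocov P X i 0 - autocov P X i Δ else 0) ∧
    -- the diagonal value is a spectral integral
    (∀ i, (∀ t, MemLp (X i t) 2 P) ∧
      IntegrableOn (fouSpectral H (θ i)) (Set.Ioi 0) ∧
      IntegrableOn (fun l => (1 - Real.cos (l * Δ)) * fouSpectral H (θ i) l) (Set.Ioi 0) ∧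
      autocov P X i 0 - autocov P X i Δ =
        2 * fouZeta H (θ i) (σ i) *
          ∫ l in Set.Ioi (0 : ℝ), (1 - Real.cos (l * Δ)) * fouSpectral H (θ i) l) := by
  have hH0 : 0 < H := by linarith
  have hΔ' : (0 : ℝ) < Δ := NNReal.coe_pos.2 hΔ
  have hE : ∀ S, IsLevelTwoSignature P X Δ S → ∀ i j, Integrable (S i j) P ∧
      ∫ ω, S i j ω ∂P = if i = j then autocov P X i 0 - autocov P X i Δ else 0 := fun S hS i j =>
    ⟨(hS i j).1.integrable one_le_two, hX.integral_levelTwoSignature hH0 hθ hσ hΔ hS i j⟩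
  refine ⟨hX.exists_isLevelTwoSignature hH hθ hσ hΔ',
    fun S S' hS hS' => hX.isLevelTwoSignature_unique hH0 hθ hσ hΔ' hS hS', hE, fun p hp L hL => ?_,
    fun i => ⟨hX.memLp_two hH0 hθ hσ i, integrableOn_fouSpectral hH0 hH1 (hθ i), ?_,
      hX.autocov_sub_eq hH0 hH1 hθ hσ i Δ⟩⟩
  · have hS := hX.isLevelTwoSignature_of_isCanonicalLift hH hθ hσ hΔ'
      ((le_max_left _ _).trans hp.le) hL
    exact ⟨hS, hE _ hS⟩
  · refine integrableOn_mul_fouSpectral (c := 2) hH0 hH1 (hθ i) (by fun_prop) fun l _ => ?_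
    rw [abs_le]
    constructor <;> linarith [Real.neg_one_le_cos (l * Δ), Real.cos_le_one (l * Δ)]
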